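/- Work either with smooth real manifolds or with complex manifolds (finite-dimensional, Hausdorff, second countable, of pure dimension; "smooth" means holomorphic and "diffeomorphism" means biholomorphism in the complex case; submanifolds are embedded). In a Lie groupoid $\Gamma\rightrightarrows M$ with source $s$ and target $t$, the product $\gamma\gamma'$ is defined when $t(\gamma)=s(\gamma')$; for $I,J\subset M$ put $\Gamma_I=s^{-1}(I)$ and $\Gamma_I^J=s^{-1}(I)\cap t^{-1}(J)$. A subset $\mathcal S\subset M$ is $\Gamma$-stable if $t(\gamma)\in\mathcal S\Leftrightarrow s(\gamma)\in\mathcal S$ for all $\gamma\in\Gamma$. A Morita equivalence $\mathcal X$ between Lie groupoids $\Gamma\rightrightarrows M$ and $\Gamma'\rightrightarrows M'$ is a manifold $X$ with surjective submersions $p:X\to M$, $p':X\to M'$, a left $\Gamma$-action along $p$ and a right $\Gamma'$-action along $p'$ (with $\gamma\cdot x$ defined when $t(\gamma)=p(x)$, and $x\cdot\gamma'$ when $p'(x)=s(\gamma')$) that commute, preserve the fibres of $p'$ and of $p$ respectively, and are proper, free and transitive on the fibres of $p'$ and of $p$ respectively. For $\mathcal S\subset M$ let $\underline{\mathcal X}(\mathcal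 S)=p'(p^{-1}(\mathcal S))$. For a right $\Gamma$-module $(Z,\phi)$, $\underline{\mathcal X}(Z,\phi)$ is the quotient of $Z\times_{\phi,M,p}X$ by $(z,x)\sim(z\cdot\gamma^{-1},\gamma\cdot x)$, with the map $[z,x]\mapsto p'(x)$ and the right action $[z,x]\cdot\gamma'=[z,x\cdot\gamma']$. A Lie subgroupoid $R\rightrightarrows L$ of $\Gamma\rightrightarrows M$ is a Lie groupoid with $R\subset\Gamma$ and $L\subset M$ submanifolds, and with the structure maps induced by those of $\Gamma$; it is closed if $R$ is closed in $\Gamma_L^L$. For a $\Gamma$-stable submanifold $\mathcal S$ of $M$, it is full in $\mathcal S$ if $L\cap\mathcal S$ is dense in $L$; $T_m\mathcal S=T_mF_m+T_mL$ for all $m\in L\cap\mathcal S$, where $F_m$ is the $\Gamma$-orbit of $m$; $L$ meets every $\Gamma$-orbit contained in $\mathcal S$; and $R\supset\Gamma_{L\cap\mathcal S}^{L\cap\mathcal S}$. For such a closed $R$, let $Z(R)=R\backslash\Gamma_L$ with $\phi_R([\gamma])=t(\gamma)$ and the right action $[\gamma]\cdot\gamma'=[\gamma\gamma']$; this is a $\Gamma$-resolution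 of $\overline{\mathcal S}$. Two resolutions $(Z_1,\phi_1)$, $(Z_2,\phi_2)$ coincide if there is a diffeomorphism $\Phi:Z_1\to Z_2$ with $\phi_2\circ\Phi=\phi_1$. Given Lie subgroupoids $R\rightrightarrows L$ of $\Gamma$ and $R'\rightrightarrows L'$ of $\Gamma'$, a Morita equivalence of Lie subgroupoids of the form $(\mathcal X,\mathcal Y,\mathfrak i)$ consists of a Morita equivalence $\mathcal Y$ between $R\rightrightarrows L$ and $R'\rightrightarrows L'$, given by a manifold $Y$, and an injective immersion $\mathfrak i:Y\to X$ that commutes with the maps $p,p'$ of $\mathcal X$ and $\mathcal Y$ and satisfies $\mathfrak i(r\cdot y\cdot r')=r\cdot\mathfrak i(y)\cdot r'$ whenever $t(r)=p(y)$ and $p'(y)=s(r')$. **Proposition.** Let $\mathcal X$ be a Morita equivalence between Lie groupoids $\Gamma\rightrightarrows M$ and $\Gamma'\rightrightarrows M'$, let $\mathcal S$ be a $\Gamma$-stable submanifold of $M$, and let $\mathcal S'=\underline{\mathcal X}(\mathcal S)$. Let $R\rightrightarrows L$ be a closed Lie subgroupoid of $\Gamma$ full in $\mathcal S$ and $R'\rightrightarrows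 L'$ a closed Lie subgroupoid of $\Gamma'$ full in $\mathcal S'$. Then the following are equivalent: (i) the resolutions $\underline{\mathcal X}(Z(R),\phi_R)$ and $(Z(R'),\phi_{R'})$ coincide; (ii) there exists a Morita equivalence of Lie subgroupoids of the form $(\mathcal X,\mathcal Y,\mathfrak i)$ between $R\rightrightarrows L$ and $R'\rightrightarrows L'$. Moreover the pair $(\mathcal Y,\mathfrak i)$ in (ii) is unique when it exists: for any two such pairs $(\mathcal Y_1,\mathfrak i_1)$, $(\mathcal Y_2,\mathfrak i_2)$ one has $\mathfrak i_1(Y_1)=\mathfrak i_2(Y_2)$, and there is a diffeomorphism $h:Y_1\to Y_2$ with $\mathfrak i_2\circ h=\mathfrak i_1$ that commutes with the maps $p,p'$ and with the actions of $R$ and $R'$. -/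

import Mathlib

open Set Topology TopologicalSpace Manifold ContDiff

universe u v

/-! ### Manifolds -/

/-- A finite-dimensional manifold without boundary over `𝕜 = ℝ` (smooth) or `𝕜 = ℂ` (complex, since
`C^∞` over `ℂ` means holomorphic), Hausdorff and second countable, of pure dimension `dim`. -/
structure SmoothMfd (𝕜 : Type v) [RCLike 𝕜] where
  carrier : Type u
  dim : ℕ
  top : TopologicalSpace carrier
  charted : ChartedSpace (EuclideanSpace 𝕜 (Fin dim)) carrier
  isManifold : IsManifold 𝓘(𝕜, EuclideanSpace 𝕜 (Fin dim)) ∞ carrier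
  t2 : T2Space carrier
  secondCountable : SecondCountableTopology carrier

namespace SmoothMfd

variable {𝕜 : Type v} [RCLike 𝕜]

instance : CoeSort (SmoothMfd.{u} 𝕜) (Type u) := ⟨SmoothMfd.carrier⟩

attribute [instance] top charted isManifold t2 secondCountable

/-- The model space of `M`. -/
noncomputable abbrev Model (M : SmoothMfd.{u} 𝕜) : Type v := EuclideanSpace 𝕜 (Fin M.dim)

/-- The model with corners of `M` (no boundary). -/
noncomputable abbrev I (M : SmoothMfd.{u} 𝕜) : ModelWithCorners 𝕜 M.Model M.Model := 𝓘(𝕜, M.Model)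

/-- `S ⊆ M` is an embedded submanifold. -/
def IsEmbeddedSubmanifold (M : SmoothMfd.{u} 𝕜) (S : Set M) : Prop :=
  ∃ (N : SmoothMfd.{u} 𝕜) (i : N → M), IsSmoothEmbedding N.I M.I ∞ i ∧ range i = S

/-- The velocity at time `0` of a curve `c` in `M`. The tangent space of `M` at `c 0` is, in Mathlib,
the model space (through the preferred chart at `c 0`). -/
noncomputable def velocity (M : SmoothMfd.{u} 𝕜) (c : 𝕜 → M) : M.Model :=
  let d : 𝕜 →L[𝕜] M.Model := mfderiv 𝓘(𝕜, 𝕜) M.I c 0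
  d 1

/-- The tangent space at `m` of a submanifold `S ∋ m` of `M`: all velocities of
smooth (holomorphic) curves in `S` starting at `m`. -/
def tangentTo (M : SmoothMfd.{u} 𝕜) (S : Set M) (m : M) : Set (TangentSpace M.I m) :=
  {w | ∃ (U : Set 𝕜) (c : 𝕜 → M), IsOpen U ∧ (0 : 𝕜) ∈ U ∧ ContMDiffOn 𝓘(𝕜, 𝕜) M.I ∞ c U ∧
    MapsTo c U S ∧ c 0 = m ∧ w = M.velocity c}

end SmoothMfd

/-! ### Lie groupoids -/

/-- A Lie groupoid `Arr ⇉ Obj`. The product `mul g h` is meaningful when `tgt g = src h`; its values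
at other pairs are irrelevant and unconstrained. -/
structure LieGroupoid (𝕜 : Type v) [RCLike 𝕜] where
  Arr : SmoothMfd.{u} 𝕜
  Obj : SmoothMfd.{u} 𝕜
  src : Arr → Obj
  tgt : Arr → Obj
  unit : Obj → Arr
  inv : Arr → Arr
  mul : Arr → Arr → Arr
  src_unit : ∀ m, src (unit m) = m
  tgt_unit : ∀ m, tgt (unit m) = m
  src_inv : ∀ g, src (inv g) = tgt g
  tgt_inv : ∀ g, tgt (inv g) = src g
  src_mul : ∀ g h, tgt g = src h → src (mul g h) = src g
  tgt_mul : ∀ g h, tgt g = src h → tgt (mul g h) = tgt h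
  mul_assoc : ∀ g h k, tgt g = src h → tgt h = src k → mul (mul g h) k = mul g (mul h k)
  unit_mul : ∀ g, mul (unit (src g)) g = g
  mul_unit : ∀ g, mul g (unit (tgt g)) = g
  mul_inv : ∀ g, mul g (inv g) = unit (src g)
  inv_mul : ∀ g, mul (inv g) g = unit (tgt g)
  submersion_src : IsSubmersion Arr.I Obj.I ∞ src
  submersion_tgt : IsSubmersion Arr.I Obj.I ∞ tgt
  contMDiff_unit : ContMDiff Obj.I Arr.I ∞ unit
  contMDiff_inv : ContMDiff Arr.I Arr.I ∞ inv
  contMDiffOn_mul : ContMDiffOn (Arr.I.prod Arr.I) Arr.I ∞ (fun q : Arr × Arr => mul q.1 q.2)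
    {q | tgt q.1 = src q.2}

namespace LieGroupoid

variable {𝕜 : Type v} [RCLike 𝕜] (Γ : LieGroupoid.{u} 𝕜)

/-- `S` is `Γ`-stable. -/
def IsStable (S : Set Γ.Obj) : Prop := ∀ g : Γ.Arr, Γ.tgt g ∈ S ↔ Γ.src g ∈ S

/-- The tangent space at `m` of the `Γ`-orbit through `m`: all velocities of curves
`ε ↦ tgt (γ ε)` where `γ` is a smooth (holomorphic) curve in the source fibre of `m`
starting at the unit of `m`. -/
def orbitTangent (m : Γ.Obj) : Set (TangentSpace Γ.Obj.I m) :=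
  {w | ∃ (U : Set 𝕜) (c : 𝕜 → Γ.Arr), IsOpen U ∧ (0 : 𝕜) ∈ U ∧
    ContMDiffOn 𝓘(𝕜, 𝕜) Γ.Arr.I ∞ c U ∧ (∀ e ∈ U, Γ.src (c e) = m) ∧ c 0 = Γ.unit m ∧
    w = Γ.Obj.velocity (fun e => Γ.tgt (c e))}

lemma inv_inv (g : Γ.Arr) : Γ.inv (Γ.inv g) = g := by
  have h1 : Γ.mul (Γ.mul (Γ.inv (Γ.inv g)) (Γ.inv g)) g
      = Γ.mul (Γ.inv (Γ.inv g)) (Γ.mul (Γ.inv g) g) :=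
    Γ.mul_assoc _ _ _ (Γ.tgt_inv _) (Γ.tgt_inv _)
  rw [Γ.inv_mul, Γ.inv_mul, Γ.tgt_inv, Γ.unit_mul] at h1
  have h2 : Γ.tgt g = Γ.tgt (Γ.inv (Γ.inv g)) := by rw [Γ.tgt_inv, Γ.src_inv]
  rw [h2, Γ.mul_unit] at h1
  exact h1.symm

lemma inv_unit (m : Γ.Obj) : Γ.inv (Γ.unit m) = Γ.unit m := by
  have h := Γ.mul_inv (Γ.unit m)
  have h2 := Γ.unit_mul (Γ.inv (Γ.unit m))
  rw [Γ.src_inv, Γ.tgt_unit] at h2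
  rw [h2, Γ.src_unit] at h
  exact h

lemma inv_mul_cancel_left (g h : Γ.Arr) (hc : Γ.tgt g = Γ.src h) :
    Γ.mul (Γ.inv g) (Γ.mul g h) = h := by
  rw [← Γ.mul_assoc _ _ _ (Γ.tgt_inv g) hc, Γ.inv_mul, hc, Γ.unit_mul]

lemma inv_mul_rev (g h : Γ.Arr) (hc : Γ.tgt g = Γ.src h) :
    Γ.inv (Γ.mul g h) = Γ.mul (Γ.inv h) (Γ.inv g) := by
  have c1 : Γ.tgt (Γ.inv h) = Γ.src (Γ.inv g) := by rw [Γ.tgt_inv, Γ.src_inv, hc]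
  have c2 : Γ.tgt (Γ.mul g h) = Γ.src (Γ.inv h) := by rw [Γ.tgt_mul _ _ hc, Γ.src_inv]
  have key : Γ.mul (Γ.mul g h) (Γ.mul (Γ.inv h) (Γ.inv g)) = Γ.unit (Γ.src g) := by
    rw [← Γ.mul_assoc _ _ _ c2 c1, Γ.mul_assoc g h (Γ.inv h) hc (Γ.src_inv h).symm, Γ.mul_inv,
      ← hc, Γ.mul_unit, Γ.mul_inv]
  have c3 : Γ.tgt (Γ.mul g h) = Γ.src (Γ.mul (Γ.inv h) (Γ.inv g)) := by
    rw [c2, Γ.src_mul _ _ c1]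
  have := Γ.inv_mul_cancel_left _ _ c3
  rw [key] at this
  rw [← this]
  have h4 := Γ.mul_unit (Γ.inv (Γ.mul g h))
  rw [Γ.tgt_inv, Γ.src_mul _ _ hc] at h4
  exact h4.symm

end LieGroupoid

/-! ### Morita equivalences -/

/-- A Morita equivalence between Lie groupoids `Γ` and `Γ'`: a `Γ`-`Γ'`-bimodule `M ← X → M'`
whose left and right actions are free, proper and transitive on the fibres of `p'` and of `p`
respectively. The left action `lact g x` is meaningful when `tgt g = p x` and the right action
`ract x h` when `p' x = src h`; other values are irrelevant. -/
structure LieMorita {𝕜 : Type v} [RCLike 𝕜] (Γ Γ' : LieGroupoid.{u} 𝕜) where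
  X : SmoothMfd.{u} 𝕜
  p : X → Γ.Obj
  p' : X → Γ'.Obj
  lact : Γ.Arr → X → X
  ract : X → Γ'.Arr → X
  surjective_p : Function.Surjective p
  surjective_p' : Function.Surjective p'
  submersion_p : IsSubmersion X.I Γ.Obj.I ∞ p
  submersion_p' : IsSubmersion X.I Γ'.Obj.I ∞ p'
  p_lact : ∀ g x, Γ.tgt g = p x → p (lact g x) = Γ.src g
  lact_mul : ∀ g h x, Γ.tgt g = Γ.src h → Γ.tgt h = p x → lact (Γ.mul g h) x = lact g (lact h x)
  lact_unit : ∀ x, lact (Γ.unit (p x)) x = x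
  contMDiffOn_lact : ContMDiffOn (Γ.Arr.I.prod X.I) X.I ∞ (fun q : Γ.Arr × X => lact q.1 q.2)
    {q | Γ.tgt q.1 = p q.2}
  p'_ract : ∀ x h, p' x = Γ'.src h → p' (ract x h) = Γ'.tgt h
  ract_mul : ∀ x g h, p' x = Γ'.src g → Γ'.tgt g = Γ'.src h →
    ract x (Γ'.mul g h) = ract (ract x g) h
  ract_unit : ∀ x, ract x (Γ'.unit (p' x)) = x
  contMDiffOn_ract : ContMDiffOn (X.I.prod Γ'.Arr.I) X.I ∞ (fun q : X × Γ'.Arr => ract q.1 q.2)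
    {q | p' q.1 = Γ'.src q.2}
  p'_lact : ∀ g x, Γ.tgt g = p x → p' (lact g x) = p' x
  p_ract : ∀ x h, p' x = Γ'.src h → p (ract x h) = p x
  lact_ract : ∀ g x h, Γ.tgt g = p x → p' x = Γ'.src h →
    ract (lact g x) h = lact g (ract x h)
  lact_free : ∀ g x, Γ.tgt g = p x → lact g x = x → g = Γ.unit (p x)
  ract_free : ∀ x h, p' x = Γ'.src h → ract x h = x → h = Γ'.unit (p' x)
  lact_transitive : ∀ x y, p' x = p' y → ∃ g, Γ.tgt g = p x ∧ lact g x = y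
  ract_transitive : ∀ x y, p x = p y → ∃ h, p' x = Γ'.src h ∧ ract x h = y
  lact_proper : IsProperMap
    (fun q : {q : Γ.Arr × X // Γ.tgt q.1 = p q.2} => (lact q.1.1 q.1.2, q.1.2))
  ract_proper : IsProperMap
    (fun q : {q : X × Γ'.Arr // p' q.1 = Γ'.src q.2} => (q.1.1, ract q.1.1 q.1.2))

/-- The stable subset `p' (p⁻¹ S)` of `M'` corresponding to the stable subset `S` of `M`. -/
def LieMorita.image {𝕜 : Type v} [RCLike 𝕜] {Γ Γ' : LieGroupoid.{u} 𝕜} (X : LieMorita Γ Γ')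
    (S : Set Γ.Obj) : Set Γ'.Obj := X.p' '' (X.p ⁻¹' S)

/-! ### Lie subgroupoids -/

/-- A Lie subgroupoid `R ⇉ L` of `Γ ⇉ M`: a Lie groupoid with `R` and `L` embedded in `Γ` and `M`
compatibly with the structure maps. -/
structure LieSubgroupoid {𝕜 : Type v} [RCLike 𝕜] (Γ : LieGroupoid.{u} 𝕜) where
  R : LieGroupoid.{u} 𝕜
  incl : R.Arr → Γ.Arr
  inclObj : R.Obj → Γ.Obj
  embedding_incl : IsSmoothEmbedding R.Arr.I Γ.Arr.I ∞ incl
  embedding_inclObj : IsSmoothEmbedding R.Obj.I Γ.Obj.I ∞ inclObj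
  src_incl : ∀ r, Γ.src (incl r) = inclObj (R.src r)
  tgt_incl : ∀ r, Γ.tgt (incl r) = inclObj (R.tgt r)
  incl_unit : ∀ l, incl (R.unit l) = Γ.unit (inclObj l)
  incl_inv : ∀ r, incl (R.inv r) = Γ.inv (incl r)
  incl_mul : ∀ r r', R.tgt r = R.src r' → incl (R.mul r r') = Γ.mul (incl r) (incl r')

namespace LieSubgroupoid

variable {𝕜 : Type v} [RCLike 𝕜] {Γ : LieGroupoid.{u} 𝕜} (R : LieSubgroupoid Γ)

/-- The base `L`, as a subset of `M`. -/
def base : Set Γ.Obj := range R.inclObj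

/-- The arrows of the subgroupoid, as a subset of `Γ`. -/
def arrows : Set Γ.Arr := range R.incl

/-- `R` is a closed subset of `Γ_L^L`. -/
def IsClosedSubgroupoid : Prop :=
  IsClosed ((↑) ⁻¹' R.arrows : Set {g : Γ.Arr // Γ.src g ∈ R.base ∧ Γ.tgt g ∈ R.base})

/-- `R ⇉ L` is a Lie subgroupoid in `S`: `L ∩ S` is dense in `L`, `L` intersects transversally
the orbits contained in `S`, and `L` meets all the orbits contained in `S`. -/
structure IsIn (S : Set Γ.Obj) : Prop where
  dense : Dense (R.inclObj ⁻¹' S)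
  transverse : ∀ m ∈ R.base ∩ S, ∀ w : TangentSpace Γ.Obj.I m,
    w ∈ Γ.Obj.tangentTo S m ↔
      ∃ a ∈ Γ.orbitTangent m, ∃ b ∈ Γ.Obj.tangentTo R.base m, w = a + b
  meets : ∀ m ∈ S, ∃ g : Γ.Arr, Γ.src g = m ∧ Γ.tgt g ∈ R.base

/-- `R ⇉ L` is a Lie subgroupoid full in `S`: it is in `S`, and every arrow of `Γ` connecting two
points of `L ∩ S` belongs to `R`. -/
structure IsFullIn (S : Set Γ.Obj) : Prop extends R.IsIn S where
  full : ∀ g : Γ.Arr, Γ.src g ∈ R.base ∩ S → Γ.tgt g ∈ R.base ∩ S → g ∈ R.arrows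

end LieSubgroupoid

/-- A Morita equivalence of Lie subgroupoids of the form `(X, Y, i)`, for a given Morita
equivalence `X` of the ambient groupoids. -/
structure SubgroupoidMorita {𝕜 : Type v} [RCLike 𝕜] {Γ Γ' : LieGroupoid.{u} 𝕜}
    (X : LieMorita Γ Γ') (R : LieSubgroupoid Γ) (R' : LieSubgroupoid Γ') where
  Y : LieMorita R.R R'.R
  i : Y.X → X.X
  injective_i : Function.Injective i
  immersion_i : IsImmersion Y.X.I X.X.I ∞ i
  p_i : ∀ y, X.p (i y) = R.inclObj (Y.p y)
  p'_i : ∀ y, X.p' (i y) = R'.inclObj (Y.p' y)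
  i_act : ∀ r y r', R.R.tgt r = Y.p y → Y.p' y = R'.R.src r' →
    i (Y.ract (Y.lact r y) r') = X.ract (X.lact (R.incl r) (i y)) (R'.incl r')

/-- An isomorphism between `(X, Y₁, i₁)` and `(X, Y₂, i₂)`: an isomorphism of bimodules
`Y₁ ≅ Y₂` over the identity of `X`. -/
structure SubgroupoidMorita.Iso {𝕜 : Type v} [RCLike 𝕜] {Γ Γ' : LieGroupoid.{u} 𝕜}
    {X : LieMorita Γ Γ'} {R : LieSubgroupoid Γ} {R' : LieSubgroupoid Γ'}
    (A B : SubgroupoidMorita X R R') where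
  toDiffeo : Diffeomorph A.Y.X.I B.Y.X.I A.Y.X B.Y.X ∞
  i_comp : ∀ y, B.i (toDiffeo y) = A.i y
  p_comp : ∀ y, B.Y.p (toDiffeo y) = A.Y.p y
  p'_comp : ∀ y, B.Y.p' (toDiffeo y) = A.Y.p' y
  map_lact : ∀ r y, R.R.tgt r = A.Y.p y → toDiffeo (A.Y.lact r y) = B.Y.lact r (toDiffeo y)
  map_ract : ∀ y r', A.Y.p' y = R'.R.src r' → toDiffeo (A.Y.ract y r') = B.Y.ract (toDiffeo y) r'

/-! ### Smooth structures on quotients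

Submanifolds, fibre products and quotients carry their smooth structure in the form of plots: the
smooth (holomorphic) maps from open subsets of the spaces `𝕜ⁿ`. On a manifold the plots
are the smooth maps, on a submanifold the smooth maps with values in it, and on a quotient `A / ∼`
the maps that locally lift to plots of `A`; when `A / ∼` is a quotient manifold, i.e.
`A → A / ∼` is a surjective submersion, these are exactly the smooth maps into it, because
a surjective submersion has local sections. A map between manifolds is smooth if and only if it takes
plots to plots. -/

/-- A smooth structure on a type `A` given by its plots (a diffeology over `𝕜`). Only the values of
`f` on `U` matter in `IsPlot U f`. -/
structure SmoothStr (𝕜 : Type v) [RCLike 𝕜] (A : Type u) where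
  IsPlot : ∀ {n : ℕ}, Opens (EuclideanSpace 𝕜 (Fin n)) → (EuclideanSpace 𝕜 (Fin n) → A) → Prop
  const : ∀ {n : ℕ} (U : Opens (EuclideanSpace 𝕜 (Fin n))) (z : A), IsPlot U fun _ => z
  comp : ∀ {m n : ℕ} {V : Opens (EuclideanSpace 𝕜 (Fin m))} {U : Opens (EuclideanSpace 𝕜 (Fin n))}
    {f : EuclideanSpace 𝕜 (Fin n) → A} {h : EuclideanSpace 𝕜 (Fin m) → EuclideanSpace 𝕜 (Fin n)},
    IsPlot U f → ContDiffOn 𝕜 ∞ h V → MapsTo h V U → IsPlot V (f ∘ h)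
  local_plot : ∀ {n : ℕ} {U : Opens (EuclideanSpace 𝕜 (Fin n))} {f : EuclideanSpace 𝕜 (Fin n) → A},
    (∀ x ∈ U, ∃ (V : Opens (EuclideanSpace 𝕜 (Fin n))) (g : EuclideanSpace 𝕜 (Fin n) → A),
      x ∈ V ∧ V ≤ U ∧ IsPlot V g ∧ EqOn f g V) → IsPlot U f

/-- Smooth maps: they take plots to plots. -/
def IsSmoothMap {𝕜 : Type v} [RCLike 𝕜] {A B : Type u} (DA : SmoothStr 𝕜 A) (DB : SmoothStr 𝕜 B)
    (F : A → B) : Prop :=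
  ∀ {n : ℕ} (U : Opens (EuclideanSpace 𝕜 (Fin n))) (f : EuclideanSpace 𝕜 (Fin n) → A),
    DA.IsPlot U f → DB.IsPlot U fun x => F (f x)

namespace SmoothStr

variable {𝕜 : Type v} [RCLike 𝕜] {A B : Type u}

/-- The smooth structure of a manifold. -/
def ofMfd (M : SmoothMfd.{u} 𝕜) : SmoothStr 𝕜 M where
  IsPlot {n} U f := ContMDiffOn 𝓘(𝕜, EuclideanSpace 𝕜 (Fin n)) M.I ∞ f U
  const U z := contMDiffOn_const
  comp hf hh hm := hf.comp hh.contMDiffOn hm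
  local_plot {n U f} H := by
    intro x hx
    obtain ⟨V, g, hxV, -, hg, hfg⟩ := H x hx
    have hn : (V : Set (EuclideanSpace 𝕜 (Fin n))) ∈ 𝓝 x := V.isOpen.mem_nhds hxV
    exact ((hg.contMDiffAt hn).congr_of_eventuallyEq
      (Filter.mem_of_superset hn hfg)).contMDiffWithinAt

/-- The induced smooth structure on a subset. -/
def sub (D : SmoothStr 𝕜 A) (P : A → Prop) : SmoothStr 𝕜 {a : A // P a} where
  IsPlot U f := D.IsPlot U fun x => (f x : A)
  const U z := D.const U z
  comp hf hh hm := D.comp hf hh hm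
  local_plot H := by
    refine D.local_plot fun x hx => ?_
    obtain ⟨V, g, hxV, hVU, hg, hfg⟩ := H x hx
    exact ⟨V, _, hxV, hVU, hg, fun y hy => by simp only [hfg hy]⟩

/-- The product smooth structure. -/
def prod (DA : SmoothStr 𝕜 A) (DB : SmoothStr 𝕜 B) : SmoothStr 𝕜 (A × B) where
  IsPlot U f := DA.IsPlot U (fun x => (f x).1) ∧ DB.IsPlot U (fun x => (f x).2)
  const U z := ⟨DA.const U z.1, DB.const U z.2⟩
  comp hf hh hm := ⟨DA.comp hf.1 hh hm, DB.comp hf.2 hh hm⟩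
  local_plot H := by
    refine ⟨DA.local_plot fun x hx => ?_, DB.local_plot fun x hx => ?_⟩ <;>
      obtain ⟨V, g, hxV, hVU, hg, hfg⟩ := H x hx
    · exact ⟨V, _, hxV, hVU, hg.1, fun y hy => by simp only [hfg hy]⟩
    · exact ⟨V, _, hxV, hVU, hg.2, fun y hy => by simp only [hfg hy]⟩

/-- The quotient smooth structure. -/
def quot (D : SmoothStr 𝕜 A) (r : Setoid A) : SmoothStr 𝕜 (Quotient r) where
  IsPlot {n} U f := ∀ x ∈ U, ∃ (V : Opens (EuclideanSpace 𝕜 (Fin n)))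
    (g : EuclideanSpace 𝕜 (Fin n) → A), x ∈ V ∧ V ≤ U ∧ D.IsPlot V g ∧
      ∀ y ∈ V, f y = Quotient.mk r (g y)
  const U z := by
    intro x hx
    obtain ⟨a, rfl⟩ := Quotient.exists_rep z
    exact ⟨U, fun _ => a, hx, le_rfl, D.const U a, fun _ _ => rfl⟩
  comp {m n V U f h} hf hh hm := by
    intro x hx
    obtain ⟨W, g, hxW, hWU, hg, hfg⟩ := hf (h x) (hm hx)
    refine ⟨⟨_, hh.continuousOn.isOpen_inter_preimage V.isOpen W.isOpen⟩, g ∘ h, ⟨hx, hxW⟩,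
      fun y hy => hy.1, D.comp hg (hh.mono fun y hy => hy.1) fun y hy => hy.2,
      fun y hy => hfg _ hy.2⟩
  local_plot {n U f} H := by
    intro x hx
    obtain ⟨V, g, hxV, hVU, hg, hfg⟩ := H x hx
    obtain ⟨W, k, hxW, hWV, hk, hgk⟩ := hg x hxV
    exact ⟨W, k, hxW, hWV.trans hVU, hk, fun y hy => (hfg (hWV hy)).trans (hgk y hy)⟩

end SmoothStr

/-! ### Right modules and their transport along Morita equivalences -/

/-- A right module `(Z, φ)` over a Lie groupoid `Γ`. The action `act z g` is meaningful when
`φ z = src g`; other values are irrelevant. -/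
structure RightModule {𝕜 : Type v} [RCLike 𝕜] (Γ : LieGroupoid.{u} 𝕜) where
  Z : Type u
  str : SmoothStr 𝕜 Z
  φ : Z → Γ.Obj
  act : Z → Γ.Arr → Z
  smooth_φ : IsSmoothMap str (.ofMfd Γ.Obj) φ
  φ_act : ∀ z g, φ z = Γ.src g → φ (act z g) = Γ.tgt g
  act_unit : ∀ z, act z (Γ.unit (φ z)) = z
  act_mul : ∀ z g h, φ z = Γ.src g → Γ.tgt g = Γ.src h → act z (Γ.mul g h) = act (act z g) h
  smooth_act : IsSmoothMap ((str.prod (.ofMfd Γ.Arr)).sub fun q => φ q.1 = Γ.src q.2) str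
    (fun q => act q.1.1 q.1.2)

/-- `(Z₁, φ₁)` and `(Z₂, φ₂)` coincide as resolutions: there is an isomorphism (diffeomorphism or
biholomorphism) `Z₁ ≅ Z₂` intertwining `φ₁` and `φ₂`. -/
def RightModule.Coincide {𝕜 : Type v} [RCLike 𝕜] {Γ : LieGroupoid.{u} 𝕜}
    (A B : RightModule Γ) : Prop :=
  ∃ e : A.Z ≃ B.Z, IsSmoothMap A.str B.str e ∧ IsSmoothMap B.str A.str e.symm ∧
    ∀ z, B.φ (e z) = A.φ z

namespace LieSubgroupoid

variable {𝕜 : Type v} [RCLike 𝕜] {Γ : LieGroupoid.{u} 𝕜} (R : LieSubgroupoid Γ)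

/-- `Γ_L`, the arrows of `Γ` with source in `L`. -/
abbrev SourceIn : Type u := {g : Γ.Arr // Γ.src g ∈ R.base}

/-- `a ∼ r · a` for `r ∈ R`. -/
def leftOrbitRel : Setoid R.SourceIn where
  r a b := ∃ r : R.R.Arr, Γ.tgt (R.incl r) = Γ.src a.1 ∧ b.1 = Γ.mul (R.incl r) a.1
  iseqv := by
    refine ⟨fun a => ?_, ?_, ?_⟩
    · obtain ⟨l, hl⟩ := a.2
      exact ⟨R.R.unit l, by rw [R.incl_unit, Γ.tgt_unit, hl],
        by rw [R.incl_unit, hl, Γ.unit_mul]⟩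
    · rintro a b ⟨r, hr, hb⟩
      refine ⟨R.R.inv r, ?_, ?_⟩
      · rw [R.incl_inv, Γ.tgt_inv, hb, Γ.src_mul _ _ hr]
      · rw [R.incl_inv, hb, Γ.inv_mul_cancel_left _ _ hr]
    · rintro a b c ⟨r, hr, hb⟩ ⟨q, hq, hc⟩
      have hqr : Γ.tgt (R.incl q) = Γ.src (R.incl r) := by rw [hq, hb, Γ.src_mul _ _ hr]
      have hqr' : R.R.tgt q = R.R.src r := by
        apply R.embedding_inclObj.isEmbedding.injective
        rw [← R.tgt_incl, ← R.src_incl, hqr]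
      refine ⟨R.R.mul q r, ?_, ?_⟩
      · rw [R.incl_mul _ _ hqr', Γ.tgt_mul _ _ hqr, hr]
      · rw [hc, hb, R.incl_mul _ _ hqr', Γ.mul_assoc _ _ _ hqr hr]

lemma tgt_of_rel {a b : R.SourceIn} (h : R.leftOrbitRel a b) : Γ.tgt a.1 = Γ.tgt b.1 := by
  obtain ⟨r, hr, hb⟩ := h
  rw [hb, Γ.tgt_mul _ _ hr]

open Classical in
/-- Right translation on `Γ_L`: `(a, g) ↦ a g` when this is defined (and `a` otherwise). -/
noncomputable def translate (a : R.SourceIn) (g : Γ.Arr) : R.SourceIn :=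
  if h : Γ.tgt a.1 = Γ.src g then ⟨Γ.mul a.1 g, by rw [Γ.src_mul _ _ h]; exact a.2⟩ else a

lemma coe_translate (a : R.SourceIn) (g : Γ.Arr) (h : Γ.tgt a.1 = Γ.src g) :
    (R.translate a g).1 = Γ.mul a.1 g := by
  rw [translate, dif_pos h]

lemma translate_rel (g : Γ.Arr) {a b : R.SourceIn} (hab : R.leftOrbitRel a b) :
    R.leftOrbitRel (R.translate a g) (R.translate b g) := by
  by_cases h : Γ.tgt a.1 = Γ.src g
  · have h' : Γ.tgt b.1 = Γ.src g := by rw [← R.tgt_of_rel hab, h]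
    obtain ⟨r, hr, hb⟩ := hab
    refine ⟨r, ?_, ?_⟩
    · rw [R.coe_translate _ _ h, Γ.src_mul _ _ h, hr]
    · rw [R.coe_translate _ _ h, R.coe_translate _ _ h', hb, Γ.mul_assoc _ _ _ hr h]
  · have h' : ¬ Γ.tgt b.1 = Γ.src g := by rwa [← R.tgt_of_rel hab]
    rw [translate, dif_neg h, translate, dif_neg h']
    exact hab

/-- The right `Γ`-module `(Z(R), φ_R)`: `Z(R) = R \ Γ_L`, `φ_R [a] = tgt a` and `[a] · g = [a g]`. -/
noncomputable def resolution : RightModule Γ where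
  Z := Quotient R.leftOrbitRel
  str := ((SmoothStr.ofMfd Γ.Arr).sub fun g => Γ.src g ∈ R.base).quot R.leftOrbitRel
  φ := Quotient.lift (fun a => Γ.tgt a.1) fun _ _ h => R.tgt_of_rel h
  act z g := Quotient.map (fun a => R.translate a g) (fun _ _ h => R.translate_rel g h) z
  smooth_φ := by
    intro n U f hf
    refine SmoothStr.local_plot _ fun x hx => ?_
    obtain ⟨V, a, hxV, hVU, ha, hfa⟩ := hf x hx
    refine ⟨V, fun y => Γ.tgt (a y).1, hxV, hVU, Γ.submersion_tgt.contMDiff.comp_contMDiffOn ha,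
      fun y hy => ?_⟩
    simp only [hfa y hy]
    rfl
  φ_act z g h := by
    induction z using Quotient.inductionOn with
    | h a =>
      have h : Γ.tgt a.1 = Γ.src g := h
      change Γ.tgt (R.translate a g).1 = _
      rw [R.coe_translate _ _ h, Γ.tgt_mul _ _ h]
  act_unit z := by
    induction z using Quotient.inductionOn with
    | h a =>
      refine congrArg (Quotient.mk R.leftOrbitRel) (Subtype.ext ?_)
      change (R.translate a (Γ.unit (Γ.tgt a.1))).1 = a.1
      rw [R.coe_translate _ _ (Γ.src_unit _).symm, Γ.mul_unit]
  act_mul z g k h hc := by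
    induction z using Quotient.inductionOn with
    | h a =>
      have h : Γ.tgt a.1 = Γ.src g := h
      have h2 : Γ.tgt (R.translate a g).1 = Γ.src k := by
        rw [R.coe_translate _ _ h, Γ.tgt_mul _ _ h, hc]
      refine congrArg (Quotient.mk R.leftOrbitRel) (Subtype.ext ?_)
      change (R.translate a (Γ.mul g k)).1 = (R.translate (R.translate a g) k).1
      rw [R.coe_translate _ _ (by rw [Γ.src_mul _ _ hc, h]), R.coe_translate _ k h2,
        R.coe_translate _ _ h, Γ.mul_assoc _ _ _ h hc]
  smooth_act := by
    intro n U f hf x hx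
    obtain ⟨V, a, hxV, hVU, ha, hfa⟩ := hf.1 x hx
    have hc : ∀ y ∈ V, Γ.tgt (a y).1 = Γ.src (f y).1.2 := by
      intro y hy
      have h1 := (f y).2
      have h2 : (f y).1.1 = Quotient.mk R.leftOrbitRel (a y) := hfa y hy
      rw [h2] at h1
      exact h1
    refine ⟨V, fun y => R.translate (a y) (f y).1.2, hxV, hVU, ?_, fun y hy => ?_⟩
    · have ha' : ContMDiffOn 𝓘(𝕜, EuclideanSpace 𝕜 (Fin n)) Γ.Arr.I ∞ (fun y => (a y).1) V := ha
      have hf' : ContMDiffOn 𝓘(𝕜, EuclideanSpace 𝕜 (Fin n)) Γ.Arr.I ∞ (fun y => (f y).1.2) V :=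
        ContMDiffOn.mono hf.2 hVU
      exact (Γ.contMDiffOn_mul.comp (ha'.prodMk hf') (fun y hy => hc y hy)).congr
        fun y hy => R.coe_translate _ _ (hc y hy)
    · have h2 : (f y).1.1 = Quotient.mk R.leftOrbitRel (a y) := hfa y hy
      simp only [h2]
      rfl

end LieSubgroupoid

namespace LieMorita

variable {𝕜 : Type v} [RCLike 𝕜] {Γ Γ' : LieGroupoid.{u} 𝕜} (X : LieMorita Γ Γ')
  (Z : RightModule Γ)

/-- The fibre product `Z ×_{φ, M, p} X`. -/
abbrev FibreProd : Type u := {q : Z.Z × X.X // Z.φ q.1 = X.p q.2}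

/-- `(z, x) ∼ (z g⁻¹, g x)`. -/
def diagRel : Setoid (X.FibreProd Z) where
  r a b := ∃ g : Γ.Arr, Γ.tgt g = X.p a.1.2 ∧ b.1.1 = Z.act a.1.1 (Γ.inv g) ∧
    b.1.2 = X.lact g a.1.2
  iseqv := by
    refine ⟨fun a => ?_, ?_, ?_⟩
    · refine ⟨Γ.unit (X.p a.1.2), Γ.tgt_unit _, ?_, (X.lact_unit _).symm⟩
      rw [Γ.inv_unit, ← a.2, Z.act_unit]
    · rintro a b ⟨g, hg, h1, h2⟩
      have e1 : Z.φ a.1.1 = Γ.src (Γ.inv g) := by rw [a.2, Γ.src_inv, hg]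
      refine ⟨Γ.inv g, ?_, ?_, ?_⟩
      · rw [h2, X.p_lact _ _ hg, Γ.tgt_inv]
      · rw [h1, Γ.inv_inv, ← Z.act_mul _ _ _ e1 (Γ.tgt_inv g), Γ.inv_mul, hg, ← a.2, Z.act_unit]
      · rw [h2, ← X.lact_mul _ _ _ (Γ.tgt_inv g) hg, Γ.inv_mul, hg, X.lact_unit]
    · rintro a b c ⟨g, hg, h1, h2⟩ ⟨k, hk, h3, h4⟩
      have e1 : Z.φ a.1.1 = Γ.src (Γ.inv g) := by rw [a.2, Γ.src_inv, hg]
      have e2 : Γ.tgt k = Γ.src g := by rw [hk, h2, X.p_lact _ _ hg]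
      refine ⟨Γ.mul k g, ?_, ?_, ?_⟩
      · rw [Γ.tgt_mul _ _ e2, hg]
      · rw [h3, h1, Γ.inv_mul_rev _ _ e2, Z.act_mul _ _ _ e1 (by rw [Γ.tgt_inv, Γ.src_inv, e2])]
      · rw [h4, h2, X.lact_mul _ _ _ e2 hg]

lemma p'_of_rel {a b : X.FibreProd Z} (h : X.diagRel Z a b) : X.p' a.1.2 = X.p' b.1.2 := by
  obtain ⟨g, hg, -, h2⟩ := h
  rw [h2, X.p'_lact _ _ hg]

open Classical in
/-- `((z, x), h) ↦ (z, x h)` when this is defined (and `(z, x)` otherwise). -/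
noncomputable def translate (a : X.FibreProd Z) (h : Γ'.Arr) : X.FibreProd Z :=
  if hc : X.p' a.1.2 = Γ'.src h then
    ⟨(a.1.1, X.ract a.1.2 h), by rw [X.p_ract _ _ hc]; exact a.2⟩
  else a

lemma coe_translate (a : X.FibreProd Z) (h : Γ'.Arr) (hc : X.p' a.1.2 = Γ'.src h) :
    (X.translate Z a h).1 = (a.1.1, X.ract a.1.2 h) := by
  rw [translate, dif_pos hc]

lemma translate_rel (h : Γ'.Arr) {a b : X.FibreProd Z} (hab : X.diagRel Z a b) :
    X.diagRel Z (X.translate Z a h) (X.translate Z b h) := by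
  by_cases hc : X.p' a.1.2 = Γ'.src h
  · have hc' : X.p' b.1.2 = Γ'.src h := by rw [← X.p'_of_rel Z hab, hc]
    obtain ⟨g, hg, h1, h2⟩ := hab
    refine ⟨g, ?_, ?_, ?_⟩
    · rw [X.coe_translate _ _ _ hc, X.p_ract _ _ hc, hg]
    · rw [X.coe_translate _ _ _ hc, X.coe_translate _ _ _ hc', h1]
    · rw [X.coe_translate _ _ _ hc, X.coe_translate _ _ _ hc', h2, X.lact_ract _ _ _ hg hc]
  · have hc' : ¬ X.p' b.1.2 = Γ'.src h := by rwa [← X.p'_of_rel Z hab]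
    rw [translate, dif_neg hc, translate, dif_neg hc']
    exact hab

/-- The right `Γ'`-module corresponding to the right `Γ`-module `(Z, φ)`: the quotient of
`Z ×_{φ, M, p} X` by `(z, x) ∼ (z g⁻¹, g x)`, with the map `[z, x] ↦ p' x` and the action
`[z, x] · h = [z, x h]`. -/
noncomputable def transport : RightModule Γ' where
  Z := Quotient (X.diagRel Z)
  str := ((Z.str.prod (.ofMfd X.X)).sub fun q => Z.φ q.1 = X.p q.2).quot (X.diagRel Z)
  φ := Quotient.lift (fun a => X.p' a.1.2) fun _ _ h => X.p'_of_rel Z h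
  act z h := Quotient.map (fun a => X.translate Z a h) (fun _ _ hab => X.translate_rel Z h hab) z
  smooth_φ := by
    intro n U f hf
    refine SmoothStr.local_plot _ fun x hx => ?_
    obtain ⟨V, a, hxV, hVU, ha, hfa⟩ := hf x hx
    refine ⟨V, fun y => X.p' (a y).1.2, hxV, hVU,
      X.submersion_p'.contMDiff.comp_contMDiffOn ha.2, fun y hy => ?_⟩
    simp only [hfa y hy]
    rfl
  φ_act z h hc := by
    induction z using Quotient.inductionOn with
    | h a =>
      have hc : X.p' a.1.2 = Γ'.src h := hc
      change X.p' (X.translate Z a h).1.2 = _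
      rw [X.coe_translate _ _ _ hc, X.p'_ract _ _ hc]
  act_unit z := by
    induction z using Quotient.inductionOn with
    | h a =>
      refine congrArg (Quotient.mk (X.diagRel Z)) (Subtype.ext ?_)
      change (X.translate Z a (Γ'.unit (X.p' a.1.2))).1 = a.1
      rw [X.coe_translate _ _ _ (Γ'.src_unit _).symm, X.ract_unit]
  act_mul z g k h hc := by
    induction z using Quotient.inductionOn with
    | h a =>
      have h : X.p' a.1.2 = Γ'.src g := h
      have h2 : X.p' (X.translate Z a g).1.2 = Γ'.src k := by
        rw [X.coe_translate _ _ _ h, X.p'_ract _ _ h, hc]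
      refine congrArg (Quotient.mk (X.diagRel Z)) (Subtype.ext ?_)
      change (X.translate Z a (Γ'.mul g k)).1 = (X.translate Z (X.translate Z a g) k).1
      rw [X.coe_translate _ _ _ (by rw [Γ'.src_mul _ _ hc, h]), X.coe_translate _ _ k h2,
        X.coe_translate _ _ _ h, X.ract_mul _ _ _ h hc]
  smooth_act := by
    intro n U f hf x hx
    obtain ⟨V, a, hxV, hVU, ha, hfa⟩ := hf.1 x hx
    have h2 : ∀ y ∈ V, (f y).1.1 = Quotient.mk (X.diagRel Z) (a y) := hfa
    have hc : ∀ y ∈ V, X.p' (a y).1.2 = Γ'.src (f y).1.2 := by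
      intro y hy
      have h1 := (f y).2
      rw [h2 y hy] at h1
      exact h1
    refine ⟨V, fun y => X.translate Z (a y) (f y).1.2, hxV, hVU, ⟨?_, ?_⟩, fun y hy => ?_⟩
    · refine Z.str.local_plot fun y hy => ⟨V, fun y => (a y).1.1, hy, le_rfl, ha.1, fun w hw => ?_⟩
      simp only [X.coe_translate _ _ _ (hc w hw)]
    · have ha' : ContMDiffOn 𝓘(𝕜, EuclideanSpace 𝕜 (Fin n)) X.X.I ∞ (fun y => (a y).1.2) V := ha.2
      have hf' : ContMDiffOn 𝓘(𝕜, EuclideanSpace 𝕜 (Fin n)) Γ'.Arr.I ∞ (fun y => (f y).1.2) V :=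
        ContMDiffOn.mono hf.2 hVU
      exact (X.contMDiffOn_ract.comp (ha'.prodMk hf') (fun y hy => hc y hy)).congr
        fun y hy => congrArg Prod.snd (X.coe_translate _ _ _ (hc y hy))
    · simp only [h2 y hy]
      rfl

end LieMorita

/-! Every class of the transported resolution is represented by `([1], x)` with `p x ∈ L`, uniquely
up to `R`, so the transport of `Z(R)` is `R \ p⁻¹(L)`. An isomorphism onto `Z(R') = R' \ Γ'_{L'}`
over `M'` amounts to a relation between points `x` of `p⁻¹(L)` and arrows `a` of `Γ'_{L'}`
(`IsResolutionRel`). The bimodule sought is the set `Y` of those `x` that are related to the unit at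
`p' x`. Conversely, a subbimodule `Y` relates `x` to `a` when `x = y a` with `y` in `Y`, and this
relation descends to an isomorphism.

The crux of (i) ⇒ (ii) is that an isomorphism which merely respects the maps to `M'` is
automatically `Γ'`-equivariant (`rel_ract`). If `x` is related to `a` and `x g` to `b`, then `b` and
`a g` have the same target, so `d = b (a g)⁻¹` is an arrow between points of `L'`. All these data
extend smoothly along `L` near `p x`. Over `L ∩ S` the arrow `d` joins points of `L' ∩ S'`, hence
lies in `R'` by fullness; since `L ∩ S` is dense in `L` and `R'` is closed, `d` lies in `R'` over
all of `L` near `p x` (`mem_arrows_of_isFullIn`). The same argument, applied to the arrow that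
carries a point of one subbimodule to a point of another over the same point of `L`, gives
uniqueness (`exists_i_eq`).

The analytic input is smooth division: `g` depends smoothly on `x` and `x g`
(`smoothNear_division`). Properness and freeness give continuity. Smoothness requires the orbit maps
`g ↦ x g` to be immersive: being injective, each is immersive at some arrow by a maximal rank
argument, and equivariance spreads this to all arrows (`isOrbitImmersive`). With division, `Y` is
locally parametrized by `L` times a source fibre of `R'` (`nonempty_parametrization`), hence is an
embedded submanifold, to which the structure of `X` restricts (`nonempty_subgroupoidMorita`). -/

/-! ### The inverse function theorem -/

section Calculus

variable {𝕜 : Type*} [RCLike 𝕜] {E E' F : Type*} [NormedAddCommGroup E] [NormedSpace 𝕜 E]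
  [NormedAddCommGroup E'] [NormedSpace 𝕜 E'] [NormedAddCommGroup F] [NormedSpace 𝕜 F]

/-- Inverse function theorem, as the existence of a smooth local change of coordinates. -/
lemma exists_openPartialHomeomorph_of_hasFDerivAt_equiv [CompleteSpace E] {g : E → E'} {a : E}
    (hg : ∀ᶠ y in 𝓝 a, ContDiffAt 𝕜 ∞ g y) {g' : E ≃L[𝕜] E'}
    (hg' : HasFDerivAt g (g' : E →L[𝕜] E') a) :
    ∃ e : OpenPartialHomeomorph E E', a ∈ e.source ∧ EqOn e g e.source ∧
      ContDiffOn 𝕜 ∞ e e.source ∧ ContDiffOn 𝕜 ∞ e.symm e.target := by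
  have ha := hg.self_of_nhds
  set e₀ := ha.toOpenPartialHomeomorph g hg' (by simp) with he₀
  have hcoe : (e₀ : E → E') = g := rfl
  have hcont : ContinuousAt (fderiv 𝕜 g) a :=
    (ha.fderiv_right (m := 0) (by simp)).continuousAt
  -- The inverse is smooth where the derivative is invertible. This is an open condition, so the
  -- local inverse can be restricted to such points.
  have hinv : ∀ᶠ y in 𝓝 a, fderiv 𝕜 g y ∈ range ((↑) : (E ≃L[𝕜] E') → E →L[𝕜] E') := by
    refine hcont.eventually_mem (ContinuousLinearEquiv.isOpen.mem_nhds ?_)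
    exact ⟨g', hg'.fderiv.symm⟩
  obtain ⟨s, hs, hso, has⟩ := eventually_nhds_iff.mp (hg.and hinv)
  have hsrc : (e₀.restr s).source = e₀.source ∩ s := by
    rw [e₀.restr_source, hso.interior_eq]
  refine ⟨e₀.restr s, ?_, fun _ _ => rfl, ?_, ?_⟩
  · rw [hsrc]
    exact ⟨ha.mem_toOpenPartialHomeomorph_source hg' _, has⟩
  · intro y hy
    rw [hsrc] at hy
    exact (hs y hy.2).1.contDiffWithinAt
  · intro y hy
    have hy' := (e₀.restr s).map_target hy
    rw [hsrc] at hy'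
    obtain ⟨f', hf'⟩ := (hs _ hy'.2).2
    refine (OpenPartialHomeomorph.contDiffAt_symm (e₀.restr s) hy (f₀' := f') ?_
      (hs _ hy'.2).1).contDiffWithinAt
    rw [hf']
    exact ((hs _ hy'.2).1.differentiableAt (by simp)).hasFDerivAt

/-- A smooth map with injective derivative has a smooth local left inverse. -/
lemma exists_leftInverse_of_injective_fderiv [FiniteDimensional 𝕜 E] [FiniteDimensional 𝕜 E']
    {f : E → E'} {a : E} (hf : ∀ᶠ y in 𝓝 a, ContDiffAt 𝕜 ∞ f y)
    (hinj : Function.Injective (fderiv 𝕜 f a)) :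
    ∃ r : E' → E, (∀ᶠ y in 𝓝 (f a), ContDiffAt 𝕜 ∞ r y) ∧ ∀ᶠ y in 𝓝 a, r (f y) = y := by
  have : CompleteSpace E := FiniteDimensional.complete 𝕜 E
  obtain ⟨A₀, hA₀⟩ := (fderiv 𝕜 f a : E →ₗ[𝕜] E').exists_leftInverse_of_injective
    (LinearMap.ker_eq_bot.mpr hinj)
  -- `A` is a linear left inverse of the derivative, so `A ∘ f` is a local diffeomorphism `e`, and
  -- `e⁻¹ ∘ A` is the left inverse.
  let A : E' →L[𝕜] E := LinearMap.toContinuousLinearMap A₀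
  have hd : HasFDerivAt (A ∘ f) ((ContinuousLinearEquiv.refl 𝕜 E : E ≃L[𝕜] E) : E →L[𝕜] E) a := by
    have h1 := A.hasFDerivAt.comp a (hf.self_of_nhds.differentiableAt (by simp)).hasFDerivAt
    refine h1.congr_fderiv ?_
    ext w
    exact LinearMap.congr_fun hA₀ w
  have hs : ∀ᶠ y in 𝓝 a, ContDiffAt 𝕜 ∞ (A ∘ f) y := hf.mono fun y hy =>
    A.contDiff.contDiffAt.comp y hy
  obtain ⟨e, hae, heq, -, hesymm⟩ := exists_openPartialHomeomorph_of_hasFDerivAt_equiv hs hd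
  have hmem : A (f a) ∈ e.target := by
    have := e.map_source hae
    rwa [heq hae] at this
  refine ⟨e.symm ∘ A, ?_, ?_⟩
  · have : ∀ᶠ y in 𝓝 (f a), A y ∈ e.target :=
      A.continuous.continuousAt.eventually_mem (e.open_target.mem_nhds hmem)
    filter_upwards [this] with y hy
    exact (hesymm.contDiffAt (e.open_target.mem_nhds hy)).comp y A.contDiff.contDiffAt
  · filter_upwards [e.open_source.mem_nhds hae] with y hy
    have : A (f y) = e y := (heq hy).symm
    simp only [Function.comp_apply, this]
    exact e.left_inv hy

/-- A smooth map with a smooth local left inverse is, in suitable coordinates of the target, the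
inclusion of a factor. -/
lemma exists_straightening_of_leftInverse [FiniteDimensional 𝕜 E] [FiniteDimensional 𝕜 E']
    [FiniteDimensional 𝕜 F]
    (hdim : Module.finrank 𝕜 E + Module.finrank 𝕜 F = Module.finrank 𝕜 E')
    {f : E → E'} {r : E' → E} {a : E} (hf : ∀ᶠ y in 𝓝 a, ContDiffAt 𝕜 ∞ f y)
    (hr : ∀ᶠ y in 𝓝 (f a), ContDiffAt 𝕜 ∞ r y) (hrf : ∀ᶠ y in 𝓝 a, r (f y) = y) :
    ∃ e : OpenPartialHomeomorph E' (E × F), f a ∈ e.source ∧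
      ContDiffOn 𝕜 ∞ e e.source ∧ ContDiffOn 𝕜 ∞ e.symm e.target ∧
      ∀ᶠ y in 𝓝 a, e (f y) = (y, 0) := by
  have : CompleteSpace E' := FiniteDimensional.complete 𝕜 E'
  have hra : r (f a) = a := hrf.self_of_nhds
  set B := fderiv 𝕜 f a
  set A := fderiv 𝕜 r (f a)
  have hB : HasFDerivAt f B a := (hf.self_of_nhds.differentiableAt (by simp)).hasFDerivAt
  have hA : HasFDerivAt r A (f a) := (hr.self_of_nhds.differentiableAt (by simp)).hasFDerivAt
  have hAB : A.comp B = ContinuousLinearMap.id 𝕜 E := by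
    refine (hA.comp a hB).unique ((hasFDerivAt_id a).congr_of_eventuallyEq ?_)
    filter_upwards [hrf] with y hy using hy
  have hABv : ∀ w, A (B w) = w := fun w => DFunLike.congr_fun hAB w
  have hsurj : Function.Surjective A := fun w => ⟨B w, hABv w⟩
  have hker : Module.finrank 𝕜 (LinearMap.ker (A : E' →ₗ[𝕜] E)) = Module.finrank 𝕜 F := by
    have h1 := LinearMap.finrank_range_add_finrank_ker (A : E' →ₗ[𝕜] E)
    have h2 : LinearMap.range (A : E' →ₗ[𝕜] E) = ⊤ := LinearMap.range_eq_top.mpr hsurj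
    rw [h2, finrank_top] at h1
    omega
  let κ := (LinearEquiv.ofFinrankEq _ _ hker).toLinearMap
  let π₀ : E' →ₗ[𝕜] LinearMap.ker (A : E' →ₗ[𝕜] E) :=
    LinearMap.codRestrict _ (LinearMap.id - (B : E →ₗ[𝕜] E') ∘ₗ (A : E' →ₗ[𝕜] E))
      (fun w => by simp [hABv])
  let P : E' →L[𝕜] F := LinearMap.toContinuousLinearMap (κ ∘ₗ π₀)
  -- The first coordinate inverts `f`; the second records the displacement of `y` from `f (r y)`
  -- along `ker A ≅ F`, and so vanishes on the image of `f`.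
  let g : E' → E × F := fun y => (r y, P (y - f (r y)))
  have hcomp : ∀ᶠ y in 𝓝 (f a), ContDiffAt 𝕜 ∞ f (r y) := by
    have hc : ContinuousAt r (f a) := hr.self_of_nhds.continuousAt
    have hf' : ∀ᶠ y in 𝓝 (r (f a)), ContDiffAt 𝕜 ∞ f y := by rwa [hra]
    exact hc.eventually hf'
  have hg : ∀ᶠ y in 𝓝 (f a), ContDiffAt 𝕜 ∞ g y := by
    filter_upwards [hr, hcomp] with y h1 h2
    exact h1.prodMk (P.contDiff.contDiffAt.comp y (contDiffAt_id.sub (h2.comp y h1)))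
  let G : E' →L[𝕜] E × F := A.prod (P.comp (ContinuousLinearMap.id 𝕜 E' - B.comp A))
  have hG : HasFDerivAt g G (f a) := by
    have hB' : HasFDerivAt f B (r (f a)) := by rwa [hra]
    exact hA.prodMk (P.hasFDerivAt.comp (f a) ((hasFDerivAt_id (f a)).sub (hB'.comp (f a) hA)))
  have hGinj : Function.Injective G := by
    rw [injective_iff_map_eq_zero]
    intro w hw
    have h1 : A w = 0 := congrArg Prod.fst hw
    have h2 : P (w - B (A w)) = 0 := congrArg Prod.snd hw
    rw [h1, map_zero, sub_zero] at h2
    have h3 : π₀ w = 0 := (LinearEquiv.ofFinrankEq _ _ hker).injective (by rw [map_zero]; exact h2)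
    have h4 := congrArg Subtype.val h3
    simpa [π₀, h1] using h4
  have hdim' : Module.finrank 𝕜 E' = Module.finrank 𝕜 (E × F) := by
    rw [Module.finrank_prod, hdim]
  let G' : E' ≃L[𝕜] E × F :=
    (LinearEquiv.ofInjectiveOfFinrankEq (G : E' →ₗ[𝕜] E × F) hGinj hdim').toContinuousLinearEquiv
  have hGG' : (G' : E' →L[𝕜] E × F) = G := by ext w <;> rfl
  rw [← hGG'] at hG
  obtain ⟨e, hae, heq, he1, he2⟩ := exists_openPartialHomeomorph_of_hasFDerivAt_equiv hg hG
  refine ⟨e, hae, he1, he2, ?_⟩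
  have hc : ContinuousAt f a := hB.continuousAt
  filter_upwards [hrf, hc.eventually_mem (e.open_source.mem_nhds hae)] with y hy hys
  rw [heq hys]
  simp [g, hy]

/-- A smooth map with a smooth local section is, in suitable coordinates of the source, the
projection to a factor. -/
lemma exists_straightening_of_section [FiniteDimensional 𝕜 E] [FiniteDimensional 𝕜 E']
    [FiniteDimensional 𝕜 F]
    (hdim : Module.finrank 𝕜 E' + Module.finrank 𝕜 F = Module.finrank 𝕜 E)
    {f : E → E'} {s : E' → E} {a : E} (hf : ∀ᶠ y in 𝓝 a, ContDiffAt 𝕜 ∞ f y)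
    (hs : ContDiffAt 𝕜 ∞ s (f a)) (hsa : s (f a) = a) (hfs : ∀ᶠ y in 𝓝 (f a), f (s y) = y) :
    ∃ e : OpenPartialHomeomorph E (E' × F), a ∈ e.source ∧
      ContDiffOn 𝕜 ∞ e e.source ∧ ContDiffOn 𝕜 ∞ e.symm e.target ∧
      ∀ y ∈ e.source, (e y).1 = f y := by
  have : CompleteSpace E := FiniteDimensional.complete 𝕜 E
  set A := fderiv 𝕜 f a
  set B := fderiv 𝕜 s (f a)
  have hA : HasFDerivAt f A a := (hf.self_of_nhds.differentiableAt (by simp)).hasFDerivAt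
  have hB : HasFDerivAt s B (f a) := (hs.differentiableAt (by simp)).hasFDerivAt
  have hAB : A.comp B = ContinuousLinearMap.id 𝕜 E' := by
    have hA' : HasFDerivAt f A (s (f a)) := by rwa [hsa]
    refine (hA'.comp (f a) hB).unique ((hasFDerivAt_id (f a)).congr_of_eventuallyEq ?_)
    filter_upwards [hfs] with y hy using hy
  have hABv : ∀ w, A (B w) = w := fun w => DFunLike.congr_fun hAB w
  have hsurj : Function.Surjective A := fun w => ⟨B w, hABv w⟩
  have hker : Module.finrank 𝕜 (LinearMap.ker (A : E →ₗ[𝕜] E')) = Module.finrank 𝕜 F := by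
    have h1 := LinearMap.finrank_range_add_finrank_ker (A : E →ₗ[𝕜] E')
    have h2 : LinearMap.range (A : E →ₗ[𝕜] E') = ⊤ := LinearMap.range_eq_top.mpr hsurj
    rw [h2, finrank_top] at h1
    omega
  let κ := (LinearEquiv.ofFinrankEq _ _ hker).toLinearMap
  let π₀ : E →ₗ[𝕜] LinearMap.ker (A : E →ₗ[𝕜] E') :=
    LinearMap.codRestrict _ (LinearMap.id - (B : E' →ₗ[𝕜] E) ∘ₗ (A : E →ₗ[𝕜] E'))
      (fun w => by simp [hABv])
  let P : E →L[𝕜] F := LinearMap.toContinuousLinearMap (κ ∘ₗ π₀)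
  -- `f` itself is the first coordinate, and `P` is linear and maps `ker A` isomorphically onto `F`.
  let g : E → E' × F := fun y => (f y, P y)
  have hg : ∀ᶠ y in 𝓝 a, ContDiffAt 𝕜 ∞ g y := by
    filter_upwards [hf] with y h1
    exact h1.prodMk P.contDiff.contDiffAt
  let G : E →L[𝕜] E' × F := A.prod P
  have hG : HasFDerivAt g G a := hA.prodMk P.hasFDerivAt
  have hGinj : Function.Injective G := by
    rw [injective_iff_map_eq_zero]
    intro w hw
    have h1 : A w = 0 := congrArg Prod.fst hw
    have h2 : P w = 0 := congrArg Prod.snd hw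
    have h3 : π₀ w = 0 := (LinearEquiv.ofFinrankEq _ _ hker).injective (by rw [map_zero]; exact h2)
    have h4 := congrArg Subtype.val h3
    simpa [π₀, h1] using h4
  have hdim' : Module.finrank 𝕜 E = Module.finrank 𝕜 (E' × F) := by
    rw [Module.finrank_prod, hdim]
  let G' : E ≃L[𝕜] E' × F :=
    (LinearEquiv.ofInjectiveOfFinrankEq (G : E →ₗ[𝕜] E' × F) hGinj hdim').toContinuousLinearEquiv
  have hGG' : (G' : E →L[𝕜] E' × F) = G := by ext w <;> rfl
  rw [← hGG'] at hG
  obtain ⟨e, hae, heq, he1, he2⟩ := exists_openPartialHomeomorph_of_hasFDerivAt_equiv hg hG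
  exact ⟨e, hae, he1, he2, fun y hy => by rw [heq hy]⟩

/-- An injective smooth map has injective derivative somewhere. -/
lemma exists_injective_fderiv_of_injOn [FiniteDimensional 𝕜 E] [FiniteDimensional 𝕜 E']
    {f : E → E'} {U : Set E} (hU : IsOpen U) (hne : U.Nonempty)
    (hf : ∀ y ∈ U, ContDiffAt 𝕜 ∞ f y) (hinj : InjOn f U) :
    ∃ y ∈ U, Function.Injective (fderiv 𝕜 f y) := by
  have : CompleteSpace E := FiniteDimensional.complete 𝕜 E
  let rk : E → ℕ := fun y => Module.finrank 𝕜 (LinearMap.range (fderiv 𝕜 f y : E →ₗ[𝕜] E'))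
  have hbdd : ∃ b, ∀ y ∈ U, rk y ≤ b := ⟨Module.finrank 𝕜 E', fun y _ => Submodule.finrank_le _⟩
  -- Injectivity will hold wherever the rank of the derivative is maximal, because near such a point
  -- the rank is constant.
  obtain ⟨a, haU, hmax⟩ : ∃ a ∈ U, ∀ y ∈ U, rk y ≤ rk a := by
    obtain ⟨b, hb⟩ := hbdd
    have hfin : (rk '' U).Finite := (finite_Iic b).subset (by rintro _ ⟨y, hy, rfl⟩; exact hb y hy)
    obtain ⟨_, ⟨a, haU, rfl⟩, h⟩ := exists_max_image _ id hfin (hne.image rk)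
    exact ⟨a, haU, fun y hy => h _ (mem_image_of_mem rk hy)⟩
  refine ⟨a, haU, ?_⟩
  set A := fderiv 𝕜 f a with hAdef
  let R := LinearMap.range (A : E →ₗ[𝕜] E')
  let K := LinearMap.ker (A : E →ₗ[𝕜] E')
  obtain ⟨P₀, hP₀⟩ := R.subtype.exists_leftInverse_of_injective R.ker_subtype
  obtain ⟨Q₀, hQ₀⟩ := K.subtype.exists_leftInverse_of_injective K.ker_subtype
  let P : E' →L[𝕜] R := LinearMap.toContinuousLinearMap P₀
  let Q : E →L[𝕜] K := LinearMap.toContinuousLinearMap Q₀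
  have hP : ∀ w : R, P w = w := fun w => LinearMap.congr_fun hP₀ w
  have hQ : ∀ w : K, Q w = w := fun w => LinearMap.congr_fun hQ₀ w
  -- Coordinates near `a` adapted to `f`: the component of `f` along the range of its derivative,
  -- completed by a coordinate on the kernel.
  let g : E → R × K := fun y => (P (f y), Q y)
  have hg : ∀ y ∈ U, ContDiffAt 𝕜 ∞ g y := fun y hy =>
    (P.contDiff.contDiffAt.comp y (hf y hy)).prodMk Q.contDiff.contDiffAt
  have hdf : ∀ y ∈ U, HasFDerivAt f (fderiv 𝕜 f y) y := fun y hy =>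
    ((hf y hy).differentiableAt (by simp)).hasFDerivAt
  have hg' : ∀ y ∈ U, HasFDerivAt g ((P.comp (fderiv 𝕜 f y)).prod Q) y := fun y hy =>
    (P.hasFDerivAt.comp y (hdf y hy)).prodMk Q.hasFDerivAt
  have hinjA : Function.Injective ((P.comp A).prod Q) := by
    rw [injective_iff_map_eq_zero]
    intro w hw
    have h1 : P (A w) = 0 := congrArg Prod.fst hw
    have h2 : Q w = 0 := congrArg Prod.snd hw
    have h3 : (⟨A w, w, rfl⟩ : R) = 0 := (hP ⟨A w, w, rfl⟩).symm.trans h1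
    have h4 : A w = 0 := congrArg Subtype.val h3
    have h5 := (hQ ⟨w, h4⟩).symm.trans h2
    exact congrArg Subtype.val h5
  have hdim : Module.finrank 𝕜 E = Module.finrank 𝕜 (R × K) := by
    rw [Module.finrank_prod]
    exact (LinearMap.finrank_range_add_finrank_ker (A : E →ₗ[𝕜] E')).symm
  let G' : E ≃L[𝕜] R × K :=
    (LinearEquiv.ofInjectiveOfFinrankEq (((P.comp A).prod Q : E →L[𝕜] R × K) : E →ₗ[𝕜] R × K)
      hinjA hdim).toContinuousLinearEquiv
  have hGG' : (G' : E →L[𝕜] R × K) = (P.comp A).prod Q := by ext w <;> rfl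
  have hga : HasFDerivAt g (G' : E →L[𝕜] R × K) a := by
    rw [hGG']
    exact hg' a haU
  obtain ⟨e, hae, heq, -, hesymm⟩ := exists_openPartialHomeomorph_of_hasFDerivAt_equiv
    ((hU.eventually_mem haU).mono hg) hga
  have hcont : ContinuousAt (fderiv 𝕜 g) a :=
    ((hg a haU).fderiv_right (m := 0) (by simp)).continuousAt
  have hinv : ∀ᶠ y in 𝓝 a, fderiv 𝕜 g y ∈ range ((↑) : (E ≃L[𝕜] R × K) → E →L[𝕜] R × K) :=
    hcont.eventually_mem (ContinuousLinearEquiv.isOpen.mem_nhds ⟨G', hga.fderiv.symm⟩)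
  -- Near `a` the composite of `P` with the derivative is still onto `R`. By maximality the rank is
  -- then exactly `dim R`, so `P` is injective on the range of the derivative.
  have hker : ∀ᶠ y in 𝓝 a, ∀ w, P (fderiv 𝕜 f y w) = 0 → fderiv 𝕜 f y w = 0 := by
    filter_upwards [hinv, hU.mem_nhds haU] with y ⟨D, hD⟩ hyU w hw
    let Ry := LinearMap.range (fderiv 𝕜 f y : E →ₗ[𝕜] E')
    let Py : Ry →ₗ[𝕜] R := P₀ ∘ₗ Ry.subtype
    have hsurj : Function.Surjective Py := by
      intro c
      obtain ⟨w', hw'⟩ := D.surjective (c, 0)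
      refine ⟨⟨fderiv 𝕜 f y w', w', rfl⟩, ?_⟩
      have h1 : fderiv 𝕜 g y w' = (c, 0) := by rw [← hD]; exact hw'
      rw [(hg' y hyU).fderiv] at h1
      exact congrArg Prod.fst h1
    have hrk : Module.finrank 𝕜 Ry = Module.finrank 𝕜 R :=
      le_antisymm (hmax y hyU) (LinearMap.finrank_le_finrank_of_surjective hsurj)
    have hinj : Function.Injective Py :=
      (LinearMap.injective_iff_surjective_of_finrank_eq_finrank hrk).mpr hsurj
    have h2 : (⟨fderiv 𝕜 f y w, w, rfl⟩ : Ry) = 0 := hinj (by rw [map_zero]; exact hw)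
    exact congrArg Subtype.val h2
  rw [injective_iff_map_eq_zero]
  intro w hw
  by_contra hw0
  let k : K := ⟨w, hw⟩
  have hk : k ≠ 0 := fun h => hw0 (congrArg Subtype.val h)
  -- A line in the kernel direction, in the coordinates `g`. Along it `P ∘ f` is constant, so by
  -- `hker` the derivative of `f` vanishes too and `f` is constant, against injectivity.
  let l : 𝕜 → R × K := fun t => e a + t • ((0 : R), k)
  have hl : ∀ t, HasFDerivAt l ((ContinuousLinearMap.id 𝕜 𝕜).smulRight ((0 : R), k)) t := fun t =>
    ((hasFDerivAt_id t).smul_const ((0 : R), k)).const_add (e a)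
  have hl0 : l 0 = e a := by simp [l]
  have hlc : ContinuousAt l 0 := (hl 0).continuousAt
  have hev : ∀ᶠ t in 𝓝 (0 : 𝕜), l t ∈ e.target ∧ e.symm (l t) ∈ U ∧
      ∀ w, P (fderiv 𝕜 f (e.symm (l t)) w) = 0 → fderiv 𝕜 f (e.symm (l t)) w = 0 := by
    have h1 : ∀ᶠ t in 𝓝 (0 : 𝕜), l t ∈ e.target :=
      hlc.eventually_mem (e.open_target.mem_nhds (by rw [hl0]; exact e.map_source hae))
    have hsc : Filter.Tendsto (fun t => e.symm (l t)) (𝓝 0) (𝓝 a) := by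
      have h2 := (e.continuousAt_symm (e.map_source hae)).tendsto
      rw [e.left_inv hae, ← hl0] at h2
      exact h2.comp hlc
    exact h1.and ((hsc.eventually_mem (hU.mem_nhds haU)).and (hsc.eventually hker))
  obtain ⟨ε, hε, hball⟩ := Metric.eventually_nhds_iff_ball.mp hev
  have hd : ∀ t ∈ Metric.ball (0 : 𝕜) ε,
      HasFDerivAt (fun t => f (e.symm (l t))) (0 : 𝕜 →L[𝕜] E') t := by
    intro t ht
    obtain ⟨htar, htU, hk0⟩ := hball t ht
    have hs : HasFDerivAt e.symm (fderiv 𝕜 e.symm (l t)) (l t) :=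
      ((hesymm.contDiffAt (e.open_target.mem_nhds htar)).differentiableAt (by simp)).hasFDerivAt
    have hc := (hdf _ htU).comp t (hs.comp t (hl t))
    refine hc.congr_fderiv ?_
    ext
    simp only [zero_apply]
    apply hk0
    have hconst : ∀ᶠ u in 𝓝 t, P (f (e.symm (l u))) = (e a).1 := by
      filter_upwards [(Metric.isOpen_ball).mem_nhds ht] with u hu
      have h1 : g (e.symm (l u)) = l u := by
        rw [← heq (e.map_target (hball u hu).1), e.right_inv (hball u hu).1]
      have h2 := congrArg Prod.fst h1
      simpa [g, l] using h2
    have h3 := (P.hasFDerivAt.comp t hc).unique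
      ((hasFDerivAt_const (e a).1 t).congr_of_eventuallyEq hconst)
    exact DFunLike.congr_fun h3 1
  obtain ⟨t, ht0, htε⟩ := NormedField.exists_norm_lt 𝕜 hε
  have htb : t ∈ Metric.ball (0 : 𝕜) ε := by simpa using htε
  have h0b : (0 : 𝕜) ∈ Metric.ball (0 : 𝕜) ε := Metric.mem_ball_self hε
  have heqf := Metric.isOpen_ball.is_const_of_fderiv_eq_zero
    (convex_ball (0 : 𝕜) ε).isPreconnected
    (fun s hs => (hd s hs).differentiableAt.differentiableWithinAt)
    (fun s hs => (hd s hs).fderiv) htb h0b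
  have heq2 := hinj (hball t htb).2.1 (hball 0 h0b).2.1 heqf
  have heq3 := e.symm.injOn (hball t htb).1 (hball 0 h0b).1 heq2
  have heq4 : t • k = 0 := by simpa [l] using congrArg Prod.snd heq3
  rcases smul_eq_zero.mp heq4 with h | h
  · exact (norm_pos_iff.mp ht0) h
  · exact hk h

end Calculus

/-! ### Maps that are smooth near a point -/

section SmoothNear

variable {𝕜 : Type*} [RCLike 𝕜]
  {E₁ H₁ M₁ E₂ H₂ M₂ E₃ H₃ M₃ : Type*}
  [NormedAddCommGroup E₁] [NormedSpace 𝕜 E₁] [TopologicalSpace H₁] [TopologicalSpace M₁]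
  [NormedAddCommGroup E₂] [NormedSpace 𝕜 E₂] [TopologicalSpace H₂] [TopologicalSpace M₂]
  [NormedAddCommGroup E₃] [NormedSpace 𝕜 E₃] [TopologicalSpace H₃] [TopologicalSpace M₃]
  [ChartedSpace H₁ M₁] [ChartedSpace H₂ M₂] [ChartedSpace H₃ M₃]
  (I₁ : ModelWithCorners 𝕜 E₁ H₁) (I₂ : ModelWithCorners 𝕜 E₂ H₂) (I₃ : ModelWithCorners 𝕜 E₃ H₃)

/-- `f` is smooth at all points of a neighbourhood of `x`. -/
def SmoothNear (f : M₁ → M₂) (x : M₁) : Prop := ∀ᶠ y in 𝓝 x, ContMDiffAt I₁ I₂ ∞ f y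

variable {I₁ I₂ I₃} {f f' : M₁ → M₂} {g : M₂ → M₃} {h : M₁ → M₃} {x : M₁}

lemma SmoothNear.contMDiffAt (hf : SmoothNear I₁ I₂ f x) : ContMDiffAt I₁ I₂ ∞ f x :=
  hf.self_of_nhds

lemma SmoothNear.continuousAt (hf : SmoothNear I₁ I₂ f x) : ContinuousAt f x :=
  hf.contMDiffAt.continuousAt

lemma SmoothNear.eventually (hf : SmoothNear I₁ I₂ f x) : ∀ᶠ y in 𝓝 x, SmoothNear I₁ I₂ f y :=
  eventually_eventually_nhds.mpr hf

lemma ContMDiff.smoothNear (hf : ContMDiff I₁ I₂ ∞ f) : SmoothNear I₁ I₂ f x :=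
  Filter.Eventually.of_forall fun y => hf y

lemma ContMDiffOn.smoothNear {s : Set M₁} (hf : ContMDiffOn I₁ I₂ ∞ f s) (hs : s ∈ 𝓝 x) :
    SmoothNear I₁ I₂ f x := by
  filter_upwards [eventually_mem_nhds_iff.mpr hs] with y hy using hf.contMDiffAt hy

lemma SmoothNear.congr (hf : SmoothNear I₁ I₂ f x) (h : f' =ᶠ[𝓝 x] f) :
    SmoothNear I₁ I₂ f' x := by
  filter_upwards [hf, eventually_eventually_nhds.mpr h] with y h1 h2
    using h1.congr_of_eventuallyEq h2

lemma SmoothNear.comp_of_eq {y : M₂} (hg : SmoothNear I₂ I₃ g y) (hf : SmoothNear I₁ I₂ f x)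
    (hy : f x = y) : SmoothNear I₁ I₃ (fun z => g (f z)) x := by
  subst hy
  filter_upwards [hf, hf.continuousAt.eventually hg] with z h1 h2 using h2.comp z h1

lemma SmoothNear.comp (hg : SmoothNear I₂ I₃ g (f x)) (hf : SmoothNear I₁ I₂ f x) :
    SmoothNear I₁ I₃ (fun z => g (f z)) x :=
  hg.comp_of_eq hf rfl

lemma ContMDiff.comp_smoothNear (hg : ContMDiff I₂ I₃ ∞ g) (hf : SmoothNear I₁ I₂ f x) :
    SmoothNear I₁ I₃ (fun z => g (f z)) x :=
  hg.smoothNear.comp hf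

/-- The set `s` need not be open: in the applications it consists of the composable pairs, on which
alone products and actions are smooth. -/
lemma ContMDiffOn.comp_smoothNear {s : Set M₂} (hg : ContMDiffOn I₂ I₃ ∞ g s)
    (hf : SmoothNear I₁ I₂ f x) (hs : ∀ᶠ z in 𝓝 x, f z ∈ s) :
    SmoothNear I₁ I₃ (fun z => g (f z)) x := by
  filter_upwards [hf, eventually_eventually_nhds.mpr hs] with z h1 h2
  exact ((hg (f z) h2.self_of_nhds).comp z (h1.contMDiffWithinAt (s := f ⁻¹' s))
    fun _ hw => hw).contMDiffAt h2

lemma SmoothNear.prodMk (hf : SmoothNear I₁ I₂ f x) (hh : SmoothNear I₁ I₃ h x) :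
    SmoothNear I₁ (I₂.prod I₃) (fun z => (f z, h z)) x := by
  filter_upwards [hf, hh] with z h1 h2 using h1.prodMk h2

lemma smoothNear_const (c : M₂) : SmoothNear I₁ I₂ (fun _ => c) x := contMDiff_const.smoothNear

lemma smoothNear_id : SmoothNear I₁ I₁ (fun z => z) x := contMDiff_id.smoothNear

lemma smoothNear_fst {q : M₁ × M₂} : SmoothNear (I₁.prod I₂) I₁ Prod.fst q :=
  contMDiff_fst.smoothNear

lemma smoothNear_snd {q : M₁ × M₂} : SmoothNear (I₁.prod I₂) I₂ Prod.snd q :=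
  contMDiff_snd.smoothNear

lemma contMDiff_of_smoothNear (hf : ∀ x, SmoothNear I₁ I₂ f x) : ContMDiff I₁ I₂ ∞ f :=
  fun x => (hf x).contMDiffAt

lemma smoothNear_extChartAt [IsManifold I₁ ∞ M₁] : SmoothNear I₁ 𝓘(𝕜, E₁) (extChartAt I₁ x) x :=
  (contMDiffOn_extChartAt (n := ∞)).smoothNear
    ((chartAt H₁ x).open_source.mem_nhds (mem_chart_source H₁ x))

lemma smoothNear_extChartAt_symm [IsManifold I₁ ∞ M₁] [I₁.Boundaryless] :
    SmoothNear 𝓘(𝕜, E₁) I₁ (extChartAt I₁ x).symm (extChartAt I₁ x x) :=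
  (contMDiffOn_extChartAt_symm (n := ∞) x).smoothNear (extChartAt_target_mem_nhds x)

lemma eventually_extChartAt_symm_extChartAt :
    ∀ᶠ y in 𝓝 x, (extChartAt I₁ x).symm (extChartAt I₁ x y) = y := by
  filter_upwards [extChartAt_source_mem_nhds (I := I₁) x] with y hy
  exact (extChartAt I₁ x).left_inv hy

lemma eventually_extChartAt_extChartAt_symm [I₁.Boundaryless] :
    ∀ᶠ y in 𝓝 (extChartAt I₁ x x), extChartAt I₁ x ((extChartAt I₁ x).symm y) = y := by
  filter_upwards [extChartAt_target_mem_nhds (I := I₁) x] with y hy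
  exact (extChartAt I₁ x).right_inv hy

/-- Smoothness near a point, read in charts. -/
lemma SmoothNear.contDiffAt_extChartAt [IsManifold I₁ ∞ M₁] [I₁.Boundaryless]
    [IsManifold I₂ ∞ M₂] (hf : SmoothNear I₁ I₂ f x) :
    ∀ᶠ y in 𝓝 (extChartAt I₁ x x), ContDiffAt 𝕜 ∞
      (fun z => extChartAt I₂ (f x) (f ((extChartAt I₁ x).symm z))) y := by
  have h0 : (extChartAt I₁ x).symm (extChartAt I₁ x x) = x := extChartAt_to_inv x
  have h1 := hf.comp_of_eq (smoothNear_extChartAt_symm (I₁ := I₁) (x := x)) h0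
  have h2 := (smoothNear_extChartAt (I₁ := I₂) (x := f x)).comp_of_eq h1 (by rw [h0])
  filter_upwards [h2] with y hy using hy.contDiffAt

/-- A smooth map with injective derivative at a point has a smooth local left inverse. -/
lemma SmoothNear.exists_leftInverse [IsManifold I₁ ∞ M₁] [I₁.Boundaryless]
    [IsManifold I₂ ∞ M₂] [I₂.Boundaryless] [FiniteDimensional 𝕜 E₁] [FiniteDimensional 𝕜 E₂]
    (hf : SmoothNear I₁ I₂ f x) (hinj : Function.Injective (mfderiv I₁ I₂ f x)) :
    ∃ r : M₂ → M₁, SmoothNear I₂ I₁ r (f x) ∧ ∀ᶠ y in 𝓝 x, r (f y) = y := by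
  let f' : E₁ →L[𝕜] E₂ := mfderiv I₁ I₂ f x
  have hd : HasFDerivAt (fun z => extChartAt I₂ (f x) (f ((extChartAt I₁ x).symm z))) f'
      (extChartAt I₁ x x) :=
    HasFDerivWithinAt.hasFDerivAt (hf.contMDiffAt.mdifferentiableAt (by simp)).hasMFDerivAt.2
      (by rw [I₁.range_eq_univ]; exact Filter.univ_mem)
  have hc := hf.contDiffAt_extChartAt
  have hinj' : Function.Injective (fderiv 𝕜
      (fun z => extChartAt I₂ (f x) (f ((extChartAt I₁ x).symm z))) (extChartAt I₁ x x)) := by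
    rw [hd.fderiv]
    exact hinj
  obtain ⟨r, hr, hrf⟩ := exists_leftInverse_of_injective_fderiv hc hinj'
  have h0 : (extChartAt I₁ x).symm (extChartAt I₁ x x) = x := extChartAt_to_inv x
  simp only [h0] at hr
  have hr' : SmoothNear 𝓘(𝕜, E₂) 𝓘(𝕜, E₁) r (extChartAt I₂ (f x) (f x)) :=
    hr.mono fun y hy => hy.contMDiffAt
  have hrx : r (extChartAt I₂ (f x) (f x)) = extChartAt I₁ x x := by
    have := hrf.self_of_nhds
    rwa [h0] at this
  refine ⟨fun y => (extChartAt I₁ x).symm (r (extChartAt I₂ (f x) y)),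
    (smoothNear_extChartAt_symm).comp_of_eq (hr'.comp smoothNear_extChartAt) hrx, ?_⟩
  filter_upwards [(continuousAt_extChartAt (I := I₁) x).eventually hrf,
    eventually_extChartAt_symm_extChartAt (I₁ := I₁) (x := x)] with y h1 h2
  rw [h2] at h1
  rw [h1, h2]

end SmoothNear

/-! ### Immersions, submersions and embeddings -/

namespace SmoothMfd

variable {𝕜 : Type v} [RCLike 𝕜] {M N : SmoothMfd.{u} 𝕜}

/-- A chart of the model space composed with the preferred chart. -/
lemma trans_mem_maximalAtlas (x : M) (e : OpenPartialHomeomorph M.Model M.Model)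
    (h1 : ContDiffOn 𝕜 ∞ e e.source) (h2 : ContDiffOn 𝕜 ∞ e.symm e.target) :
    (chartAt M.Model x) ≫ₕ e ∈ IsManifold.maximalAtlas M.I ∞ M := by
  have hc := IsManifold.chart_mem_maximalAtlas (I := M.I) (n := ∞) x
  refine OpenPartialHomeomorph.mem_maximalAtlas_of_contMDiffOn _ ?_ ?_
  · refine h1.contMDiffOn.comp ((contMDiffOn_of_mem_maximalAtlas hc).mono ?_) ?_
    · intro y hy
      rw [OpenPartialHomeomorph.trans_source] at hy
      exact hy.1
    · intro y hy
      rw [OpenPartialHomeomorph.trans_source] at hy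
      exact hy.2
  · refine (contMDiffOn_symm_of_mem_maximalAtlas hc).comp (h2.contMDiffOn.mono ?_) ?_
    · intro y hy
      rw [OpenPartialHomeomorph.trans_target] at hy
      exact hy.1
    · intro y hy
      rw [OpenPartialHomeomorph.trans_target] at hy
      exact hy.2

lemma extChartAt_eq (x : M) : (extChartAt M.I x : M → M.Model) = chartAt M.Model x := by
  ext y; simp

lemma extChartAt_symm_eq (x : M) :
    ((extChartAt M.I x).symm : M.Model → M) = (chartAt M.Model x).symm := by
  ext y; simp

/-- The standard complement of the model space of `N` in that of `M`. -/
abbrev Compl (M N : SmoothMfd.{u} 𝕜) : Type v := EuclideanSpace 𝕜 (Fin (M.dim - N.dim))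

/-- The differential of `f` has a left inverse. This inequality makes the truncated subtraction in
`Compl` a genuine one. -/
lemma finrank_le_of_leftInverse {E E' : Type*} [NormedAddCommGroup E] [NormedSpace 𝕜 E]
    [NormedAddCommGroup E'] [NormedSpace 𝕜 E'] [FiniteDimensional 𝕜 E']
    {f : E → E'} {r : E' → E} {a : E} (hf : DifferentiableAt 𝕜 f a)
    (hr : DifferentiableAt 𝕜 r (f a)) (hrf : ∀ᶠ y in 𝓝 a, r (f y) = y) :
    Module.finrank 𝕜 E ≤ Module.finrank 𝕜 E' := by
  have h := (hr.hasFDerivAt.comp a hf.hasFDerivAt).unique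
    ((hasFDerivAt_id a).congr_of_eventuallyEq (by filter_upwards [hrf] with y hy using hy))
  refine LinearMap.finrank_le_finrank_of_injective (f := (fderiv 𝕜 f a : E →ₗ[𝕜] E')) ?_
  exact Function.LeftInverse.injective (g := fderiv 𝕜 r (f a)) fun w => DFunLike.congr_fun h w

/-- A smooth map with a smooth local left inverse is an immersion. -/
lemma isImmersionAtOfComplement_of_leftInverse {f : M → N} {r : N → M} {x : M}
    (hf : SmoothNear M.I N.I f x) (hr : SmoothNear N.I M.I r (f x))
    (hrf : ∀ᶠ y in 𝓝 x, r (f y) = y) :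
    IsImmersionAtOfComplement (Compl N M) M.I N.I ∞ f x := by
  let φ := chartAt M.Model x
  let ψ := chartAt N.Model (f x)
  have hrx : r (f x) = x := hrf.self_of_nhds
  have hxs : x ∈ φ.source := mem_chart_source _ _
  have hfs : f x ∈ ψ.source := mem_chart_source _ _
  have h0 : φ.symm (φ x) = x := φ.left_inv hxs
  have h1 : ψ.symm (ψ (f x)) = f x := ψ.left_inv hfs
  have hf' := hf.contDiffAt_extChartAt
  simp only [extChartAt_eq, extChartAt_symm_eq] at hf'
  have hr' := hr.contDiffAt_extChartAt
  rw [hrx] at hr'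
  simp only [extChartAt_eq, extChartAt_symm_eq] at hr'
  have hφc : Filter.Tendsto φ.symm (𝓝 (φ x)) (𝓝 x) := by
    have := (φ.continuousAt_symm (φ.map_source hxs)).tendsto
    rwa [h0] at this
  have hfc : Filter.Tendsto (fun y => f (φ.symm y)) (𝓝 (φ x)) (𝓝 (f x)) :=
    hf.continuousAt.tendsto.comp hφc
  have hrf' : ∀ᶠ y in 𝓝 (φ x), φ (r (ψ.symm (ψ (f (φ.symm y))))) = y := by
    filter_upwards [hφc.eventually hrf, φ.open_target.mem_nhds (φ.map_source hxs),
      hfc.eventually_mem (ψ.open_source.mem_nhds hfs)] with y h2 h3 h4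
    rw [ψ.left_inv h4, h2, φ.right_inv h3]
  have hr'' : ∀ᶠ y in 𝓝 (ψ (f (φ.symm (φ x)))), ContDiffAt 𝕜 ∞ (fun z => φ (r (ψ.symm z))) y := by
    rw [h0]; exact hr'
  have hdim := finrank_le_of_leftInverse (f := fun z => ψ (f (φ.symm z)))
    (r := fun z => φ (r (ψ.symm z))) (hf'.self_of_nhds.differentiableAt (by simp))
    (hr''.self_of_nhds.differentiableAt (by simp)) hrf'
  have hdim' : Module.finrank 𝕜 M.Model + Module.finrank 𝕜 (Compl N M)
      = Module.finrank 𝕜 N.Model := by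
    simp only [finrank_euclideanSpace, Fintype.card_fin] at hdim ⊢
    omega
  obtain ⟨e, hae, he1, he2, he3⟩ := exists_straightening_of_leftInverse (F := Compl N M) hdim'
    hf' hr'' hrf'
  let equiv : (M.Model × Compl N M) ≃L[𝕜] N.Model :=
    (LinearEquiv.ofFinrankEq _ _ (by rw [Module.finrank_prod, hdim'])).toContinuousLinearEquiv
  let e' : OpenPartialHomeomorph N.Model N.Model :=
    e ≫ₕ equiv.toHomeomorph.toOpenPartialHomeomorph
  have hsrc : e'.source = e.source := by simp [e']
  have he1' : ContDiffOn 𝕜 ∞ e' e'.source := by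
    rw [hsrc]
    exact equiv.contDiff.comp_contDiffOn he1
  have he2' : ContDiffOn 𝕜 ∞ e'.symm e'.target := by
    refine he2.comp equiv.symm.contDiff.contDiffOn ?_
    intro y hy
    rw [OpenPartialHomeomorph.trans_target] at hy
    exact hy.2
  -- The domain chart is shrunk to an open set on which `f` has its straightened form.
  obtain ⟨W, hW, hWo, hxW⟩ := eventually_nhds_iff.mp ((φ.continuousAt hxs).eventually he3)
  refine IsImmersionAtOfComplement.mk_of_continuousAt hf.continuousAt equiv (φ.restr W)
    (ψ ≫ₕ e') ?_ ?_ ?_ (trans_mem_maximalAtlas _ _ he1' he2') ?_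
  · rw [φ.restr_source, hWo.interior_eq]
    exact ⟨hxs, hxW⟩
  · rw [OpenPartialHomeomorph.trans_source, hsrc]
    refine ⟨hfs, ?_⟩
    change ψ (f x) ∈ e.source
    rwa [← h0]
  · exact restr_mem_maximalAtlas _ (IsManifold.chart_mem_maximalAtlas x) hWo
  · intro y hy
    have hy' : y ∈ (φ.restr W).target := by simpa using hy
    have hyW := (φ.restr W).map_target hy'
    rw [φ.restr_source, hWo.interior_eq] at hyW
    have hyt : y ∈ φ.target := by
      rw [φ.restr_target] at hy'
      exact hy'.1
    have h3 := hW _ hyW.2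
    have h4 : φ (φ.symm y) = y := φ.right_inv hyt
    have h5 : e (ψ (f (φ.symm y))) = (y, 0) := by
      have := h3
      change e (ψ (f (φ.symm (φ (φ.symm y))))) = (φ (φ.symm y), 0) at this
      rwa [h4] at this
    simpa [e'] using congrArg equiv h5

/-- A smooth map with a smooth local section is a submersion. -/
lemma isSubmersionAtOfComplement_of_section {f : M → N} {s : N → M} {x : M}
    (hf : SmoothNear M.I N.I f x) (hs : SmoothNear N.I M.I s (f x)) (hsx : s (f x) = x)
    (hfs : ∀ᶠ y in 𝓝 (f x), f (s y) = y) :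
    IsSubmersionAtOfComplement (Compl M N) M.I N.I ∞ f x := by
  let φ := chartAt M.Model x
  let ψ := chartAt N.Model (f x)
  have hxs : x ∈ φ.source := mem_chart_source _ _
  have hfxs : f x ∈ ψ.source := mem_chart_source _ _
  have h0 : φ.symm (φ x) = x := φ.left_inv hxs
  have h1 : ψ.symm (ψ (f x)) = f x := ψ.left_inv hfxs
  have hf' := hf.contDiffAt_extChartAt
  simp only [extChartAt_eq, extChartAt_symm_eq] at hf'
  have hs' := hs.contDiffAt_extChartAt
  rw [hsx] at hs'
  simp only [extChartAt_eq, extChartAt_symm_eq] at hs'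
  have hψc : Filter.Tendsto ψ.symm (𝓝 (ψ (f x))) (𝓝 (f x)) := by
    have := (ψ.continuousAt_symm (ψ.map_source hfxs)).tendsto
    rwa [h1] at this
  have hsc : Filter.Tendsto (fun y => s (ψ.symm y)) (𝓝 (ψ (f x))) (𝓝 x) := by
    have := hs.continuousAt.tendsto.comp hψc
    rwa [hsx] at this
  have hfs' : ∀ᶠ y in 𝓝 (ψ (f x)), ψ (f (φ.symm (φ (s (ψ.symm y))))) = y := by
    filter_upwards [hψc.eventually hfs, ψ.open_target.mem_nhds (ψ.map_source hfxs),
      hsc.eventually_mem (φ.open_source.mem_nhds hxs)] with y h2 h3 h4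
    rw [φ.left_inv h4, h2, ψ.right_inv h3]
  have hdim := finrank_le_of_leftInverse (f := fun z => φ (s (ψ.symm z)))
    (r := fun z => ψ (f (φ.symm z))) (hs'.self_of_nhds.differentiableAt (by simp))
    (show DifferentiableAt 𝕜 _ (φ (s (ψ.symm (ψ (f x))))) by
      rw [h1, hsx]; exact hf'.self_of_nhds.differentiableAt (by simp)) hfs'
  have hdim' : Module.finrank 𝕜 N.Model + Module.finrank 𝕜 (Compl M N)
      = Module.finrank 𝕜 M.Model := by
    simp only [finrank_euclideanSpace, Fintype.card_fin] at hdim ⊢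
    omega
  obtain ⟨e, hae, he1, he2, he3⟩ := exists_straightening_of_section (F := Compl M N) hdim'
    hf' (s := fun z => φ (s (ψ.symm z)))
    (show ContDiffAt 𝕜 ∞ _ (ψ (f (φ.symm (φ x)))) by rw [h0]; exact hs'.self_of_nhds)
    (show φ (s (ψ.symm (ψ (f (φ.symm (φ x)))))) = φ x by rw [h0, h1, hsx])
    (show ∀ᶠ y in 𝓝 (ψ (f (φ.symm (φ x)))), ψ (f (φ.symm (φ (s (ψ.symm y))))) = y by
      rw [h0]; exact hfs')
  let equiv : M.Model ≃L[𝕜] (N.Model × Compl M N) :=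
    (LinearEquiv.ofFinrankEq _ _ (by rw [Module.finrank_prod, hdim'])).toContinuousLinearEquiv
  let e' : OpenPartialHomeomorph M.Model M.Model :=
    e ≫ₕ equiv.symm.toHomeomorph.toOpenPartialHomeomorph
  have hsrc : e'.source = e.source := by simp [e']
  have he1' : ContDiffOn 𝕜 ∞ e' e'.source := by
    rw [hsrc]
    exact equiv.symm.contDiff.comp_contDiffOn he1
  have he2' : ContDiffOn 𝕜 ∞ e'.symm e'.target := by
    refine he2.comp equiv.contDiff.contDiffOn ?_
    intro y hy
    rw [OpenPartialHomeomorph.trans_target] at hy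
    exact hy.2
  refine IsSubmersionAtOfComplement.mk_of_continuousAt hf.continuousAt equiv (φ ≫ₕ e') ψ ?_ hfxs
    (trans_mem_maximalAtlas _ _ he1' he2') (IsManifold.chart_mem_maximalAtlas _) ?_
  · rw [OpenPartialHomeomorph.trans_source, hsrc]
    exact ⟨hxs, hae⟩
  · intro y hy
    have hy' : y ∈ (φ ≫ₕ e').target := by simpa using hy
    rw [OpenPartialHomeomorph.trans_target] at hy'
    have hy2 : e'.symm y ∈ φ.target := hy'.2
    have hy3 : e'.symm y ∈ e.source := by
      rw [← hsrc]; exact e'.map_target hy'.1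
    have h5 : e' (e'.symm y) = y := e'.right_inv hy'.1
    have h6 : equiv y = e (e'.symm y) := by
      have : equiv (e' (e'.symm y)) = e (e'.symm y) :=
        equiv.apply_symm_apply (e (e'.symm y))
      rwa [h5] at this
    change ψ (f (φ.symm (e'.symm y))) = (equiv y).1
    rw [h6, he3 _ hy3]

end SmoothMfd

/-! ### Immersions and submersions through local left inverses and local sections -/

namespace SmoothMfd

variable {𝕜 : Type v} [RCLike 𝕜] {M N : SmoothMfd.{u} 𝕜}

/-- A smooth map that has a smooth local left inverse near each point is an immersion. -/
lemma isImmersion_of_leftInverse {f : M → N} (hf : ContMDiff M.I N.I ∞ f)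
    (h : ∀ x, ∃ r : N → M, SmoothNear N.I M.I r (f x) ∧ ∀ᶠ y in 𝓝 x, r (f y) = y) :
    IsImmersion M.I N.I ∞ f := by
  -- One complement has to serve at all points; this is possible since its dimension depends only on
  -- those of `M` and `N`.
  refine ⟨Compl N M, inferInstance, inferInstance, fun x => ?_⟩
  obtain ⟨r, hr, hrf⟩ := h x
  exact isImmersionAtOfComplement_of_leftInverse hf.smoothNear hr hrf

/-- A smooth map that has a smooth local section through each point is a submersion. -/
lemma isSubmersion_of_section {f : M → N} (hf : ContMDiff M.I N.I ∞ f)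
    (h : ∀ x, ∃ s : N → M, SmoothNear N.I M.I s (f x) ∧ s (f x) = x ∧
      ∀ᶠ y in 𝓝 (f x), f (s y) = y) :
    IsSubmersion M.I N.I ∞ f := by
  refine ⟨Compl M N, inferInstance, inferInstance, fun x => ?_⟩
  obtain ⟨s, hs, hsx, hfs⟩ := h x
  exact isSubmersionAtOfComplement_of_section hf.smoothNear hs hsx hfs

/-- An immersion has a smooth local left inverse near each point. -/
lemma exists_leftInverse_of_isImmersion {f : M → N} (hf : IsImmersion M.I N.I ∞ f) (x : M) :
    ∃ r : N → M, SmoothNear N.I M.I r (f x) ∧ ∀ᶠ y in 𝓝 x, r (f y) = y := by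
  have h := hf.isImmersionAt x
  let φ := h.domChart
  let ψ := h.codChart
  have hxs : x ∈ φ.source := h.mem_domChart_source
  have hfs : f x ∈ ψ.source := h.mem_codChart_source
  have hfst : ContDiff 𝕜 ∞ fun z : N.Model => (h.equiv.symm z).1 :=
    contDiff_fst.comp h.equiv.symm.contDiff
  have key : ∀ y ∈ φ.source, (h.equiv.symm (ψ (f y))).1 = φ y := by
    intro y hy
    have h1 := h.writtenInCharts
      (show φ y ∈ (φ.extend M.I).target by simpa using φ.map_source hy)
    have h2 : ψ (f (φ.symm (φ y))) = h.equiv (φ y, 0) := by simpa using h1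
    rw [φ.left_inv hy] at h2
    rw [h2, h.equiv.symm_apply_apply]
  have hφ : SmoothNear 𝓘(𝕜, M.Model) M.I φ.symm (φ x) :=
    (contMDiffOn_symm_of_mem_maximalAtlas h.domChart_mem_maximalAtlas).smoothNear
      (φ.open_target.mem_nhds (φ.map_source hxs))
  have hψ : SmoothNear N.I 𝓘(𝕜, N.Model) ψ (f x) :=
    (contMDiffOn_of_mem_maximalAtlas h.codChart_mem_maximalAtlas).smoothNear
      (ψ.open_source.mem_nhds hfs)
  refine ⟨fun z => φ.symm (h.equiv.symm (ψ z)).1,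
    hφ.comp_of_eq (hfst.contMDiff.comp_smoothNear hψ) (key x hxs), ?_⟩
  filter_upwards [φ.open_source.mem_nhds hxs] with y hy
  rw [key y hy, φ.left_inv hy]

/-- The local normal form of a submersion: a local parametrization `τ` of the source by the target
and a vector space, with inverse `y ↦ (f y, w y)`. -/
lemma exists_normalForm_of_isSubmersion {f : M → N} (hf : IsSubmersion M.I N.I ∞ f) (x : M) :
    ∃ (τ : N × Compl M N → M) (w : M → Compl M N), τ (f x, 0) = x ∧ w x = 0 ∧
      SmoothNear (N.I.prod 𝓘(𝕜, Compl M N)) M.I τ (f x, 0) ∧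
      SmoothNear M.I 𝓘(𝕜, Compl M N) w x ∧
      (∀ᶠ q in 𝓝 (f x, (0 : Compl M N)), f (τ q) = q.1 ∧ w (τ q) = q.2) ∧
      ∀ᶠ y in 𝓝 x, τ (f y, w y) = y := by
  have h := hf.isSubmersionAt x
  let φ := h.domChart
  let ψ := h.codChart
  have hxs : x ∈ φ.source := h.mem_domChart_source
  have hfs : f x ∈ ψ.source := h.mem_codChart_source
  have : FiniteDimensional 𝕜 (N.Model × h.complement) :=
    h.equiv.toLinearEquiv.finiteDimensional
  have : FiniteDimensional 𝕜 h.complement :=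
    FiniteDimensional.of_surjective (LinearMap.snd 𝕜 N.Model h.complement) LinearMap.snd_surjective
  have hdim : Module.finrank 𝕜 h.complement = Module.finrank 𝕜 (Compl M N) := by
    have h1 := h.equiv.toLinearEquiv.finrank_eq
    rw [Module.finrank_prod] at h1
    simp only [finrank_euclideanSpace, Fintype.card_fin] at h1 ⊢
    omega
  -- The complement in the definition of a submersion is an abstract normed space, but its dimension
  -- is forced, so it can be replaced by the standard one.
  let κ : h.complement ≃L[𝕜] Compl M N :=
    (LinearEquiv.ofFinrankEq _ _ hdim).toContinuousLinearEquiv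
  let e : M.Model ≃L[𝕜] N.Model × Compl M N :=
    h.equiv.trans ((ContinuousLinearEquiv.refl 𝕜 N.Model).prodCongr κ)
  have key : ∀ y ∈ φ.source, (e (φ y)).1 = ψ (f y) := by
    intro y hy
    have h1 := h.writtenInCharts
      (show φ y ∈ (φ.extend M.I).target by simpa using φ.map_source hy)
    have h2 : ψ (f (φ.symm (φ y))) = (h.equiv (φ y)).1 := by simpa using h1
    rw [φ.left_inv hy] at h2
    exact h2.symm
  -- Recentres the fibre coordinate, so that `w` vanishes at `x`.
  let c := (e (φ x)).2
  have hφ : SmoothNear M.I 𝓘(𝕜, M.Model) φ x :=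
    (contMDiffOn_of_mem_maximalAtlas h.domChart_mem_maximalAtlas).smoothNear
      (φ.open_source.mem_nhds hxs)
  have hφ' : SmoothNear 𝓘(𝕜, M.Model) M.I φ.symm (φ x) :=
    (contMDiffOn_symm_of_mem_maximalAtlas h.domChart_mem_maximalAtlas).smoothNear
      (φ.open_target.mem_nhds (φ.map_source hxs))
  have hψ : SmoothNear N.I 𝓘(𝕜, N.Model) ψ (f x) :=
    (contMDiffOn_of_mem_maximalAtlas h.codChart_mem_maximalAtlas).smoothNear
      (ψ.open_source.mem_nhds hfs)
  let j : N × Compl M N → M.Model := fun q => e.symm (ψ q.1, q.2 + c)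
  have hj0 : j (f x, 0) = φ x := by
    have : (ψ (f x), (0 : Compl M N) + c) = e (φ x) := by
      rw [zero_add]
      exact Prod.ext (key x hxs).symm rfl
    change e.symm (ψ (f x), 0 + c) = φ x
    rw [this, e.symm_apply_apply]
  have hadd : ContDiff 𝕜 ∞ fun z : Compl M N => z + c := contDiff_id.add contDiff_const
  have hj : SmoothNear (N.I.prod 𝓘(𝕜, Compl M N)) 𝓘(𝕜, M.Model) j (f x, 0) := by
    have h1 : SmoothNear (N.I.prod 𝓘(𝕜, Compl M N)) 𝓘(𝕜, N.Model)
        (fun q : N × Compl M N => ψ q.1) (f x, 0) :=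
      hψ.comp_of_eq smoothNear_fst rfl
    have h2 : SmoothNear (N.I.prod 𝓘(𝕜, Compl M N)) 𝓘(𝕜, Compl M N)
        (fun q : N × Compl M N => q.2 + c) (f x, 0) :=
      hadd.contMDiff.comp_smoothNear smoothNear_snd
    filter_upwards [h1, h2] with q h3 h4
    exact e.symm.contDiff.contMDiff.contMDiffAt.comp q (h3.prodMk_space h4)
  have hτ := hφ'.comp_of_eq hj hj0
  refine ⟨fun q => φ.symm (j q), fun y => (e (φ y)).2 - c, ?_, sub_self _, hτ, ?_, ?_, ?_⟩
  · change φ.symm (j (f x, 0)) = x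
    rw [hj0, φ.left_inv hxs]
  · have : ContDiff 𝕜 ∞ fun z : M.Model => (e z).2 - c :=
      (contDiff_snd.comp e.contDiff).sub contDiff_const
    exact this.contMDiff.comp_smoothNear hφ
  · have h1 : ∀ᶠ q in 𝓝 (f x, (0 : Compl M N)), j q ∈ φ.target :=
      hj.continuousAt.eventually_mem (by rw [hj0]; exact φ.open_target.mem_nhds (φ.map_source hxs))
    have h2 : ∀ᶠ q in 𝓝 (f x, (0 : Compl M N)), q.1 ∈ ψ.source :=
      continuous_fst.continuousAt.eventually_mem (ψ.open_source.mem_nhds hfs)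
    filter_upwards [h1, h2] with q h3 h4
    have h5 : e (φ (φ.symm (j q))) = (ψ q.1, q.2 + c) := by
      rw [φ.right_inv h3]
      exact e.apply_symm_apply _
    have hs : φ.symm (j q) ∈ φ.source := φ.map_target h3
    constructor
    · have h6 := key _ hs
      rw [h5] at h6
      exact (ψ.injOn h4 (h.source_subset_preimage_source hs) h6).symm
    · rw [h5]
      exact add_sub_cancel_right _ _
  · filter_upwards [φ.open_source.mem_nhds hxs] with y hy
    have h1 : j (f y, (e (φ y)).2 - c) = φ y := by
      change e.symm (ψ (f y), (e (φ y)).2 - c + c) = φ y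
      rw [sub_add_cancel, ← key y hy]
      exact e.symm_apply_apply _
    change φ.symm (j (f y, (e (φ y)).2 - c)) = y
    rw [h1, φ.left_inv hy]

/-- A submersion has a smooth local section through each point. -/
lemma exists_section_of_isSubmersion {f : M → N} (hf : IsSubmersion M.I N.I ∞ f) (x : M) :
    ∃ s : N → M, SmoothNear N.I M.I s (f x) ∧ s (f x) = x ∧ ∀ᶠ y in 𝓝 (f x), f (s y) = y := by
  obtain ⟨τ, w, h1, -, h3, -, h5, -⟩ := exists_normalForm_of_isSubmersion hf x
  have hc : SmoothNear N.I (N.I.prod 𝓘(𝕜, Compl M N)) (fun y => (y, (0 : Compl M N))) (f x) :=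
    smoothNear_id.prodMk (smoothNear_const _)
  refine ⟨fun y => τ (y, 0), h3.comp_of_eq hc rfl, h1, ?_⟩
  filter_upwards [hc.continuousAt.eventually h5] with y hy using hy.1

section Lift

variable {E₁ H₁ K : Type*} [NormedAddCommGroup E₁] [NormedSpace 𝕜 E₁] [TopologicalSpace H₁]
  [TopologicalSpace K] [ChartedSpace H₁ K] {J : ModelWithCorners 𝕜 E₁ H₁}

/-- A smooth map with values in an embedded submanifold is smooth into the submanifold. -/
lemma smoothNear_of_comp_isSmoothEmbedding {i : M → N} (hi : IsSmoothEmbedding M.I N.I ∞ i)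
    {f : K → N} {g : K → M} {k : K} (hf : SmoothNear J N.I f k) (hg : ∀ᶠ y in 𝓝 k, i (g y) = f y) :
    SmoothNear J M.I g k := by
  have hgc : ContinuousAt g k := by
    rw [hi.isEmbedding.isInducing.continuousAt_iff]
    exact hf.continuousAt.congr (by filter_upwards [hg] with y hy using hy.symm)
  obtain ⟨r, hr, hri⟩ := exists_leftInverse_of_isImmersion hi.isImmersion (g k)
  rw [hg.self_of_nhds] at hr
  refine (hr.comp hf).congr ?_
  filter_upwards [hg, hgc.eventually hri] with y h1 h2
  rw [← h1, h2]

/-- A smooth map that takes values in an embedded submanifold near a point lifts locally. -/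
lemma exists_lift_of_isSmoothEmbedding {i : M → N} (hi : IsSmoothEmbedding M.I N.I ∞ i)
    {f : K → N} {k : K} (hf : SmoothNear J N.I f k) (hg : ∀ᶠ y in 𝓝 k, f y ∈ range i) :
    ∃ g : K → M, SmoothNear J M.I g k ∧ ∀ᶠ y in 𝓝 k, i (g y) = f y := by
  classical
  obtain ⟨m, -⟩ := hg.self_of_nhds
  have h : ∀ y, ∃ z, f y ∈ range i → i z = f y := by
    intro y
    by_cases hy : f y ∈ range i
    · exact ⟨hy.choose, fun _ => hy.choose_spec⟩
    · exact ⟨m, fun h => absurd h hy⟩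
  choose g hg' using h
  have h2 : ∀ᶠ y in 𝓝 k, i (g y) = f y := hg.mono fun y hy => hg' y hy
  exact ⟨g, smoothNear_of_comp_isSmoothEmbedding hi hf h2, h2⟩

end Lift

/-- A smooth local inverse, on the image, of a smooth embedding. -/
lemma exists_retraction_of_isSmoothEmbedding {i : M → N} (hi : IsSmoothEmbedding M.I N.I ∞ i)
    (x : M) : ∃ r : N → M, SmoothNear N.I M.I r (i x) ∧ r (i x) = x ∧
      (∀ᶠ y in 𝓝 x, r (i y) = y) ∧ ∀ᶠ z in 𝓝 (i x), z ∈ range i → i (r z) = z := by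
  obtain ⟨r, hr, hri⟩ := exists_leftInverse_of_isImmersion hi.isImmersion x
  refine ⟨r, hr, hri.self_of_nhds, hri, ?_⟩
  -- As the topology is induced, what holds near `x` in `M` holds at the points of the image near `i
  -- x`.
  rw [hi.isEmbedding.isInducing.nhds_eq_comap, Filter.eventually_comap] at hri
  filter_upwards [hri] with z hz
  rintro ⟨y, rfl⟩
  rw [hz y rfl]

end SmoothMfd

/-! ### Embedded submanifolds from local parametrizations -/

namespace SmoothMfd

variable {𝕜 : Type v} [RCLike 𝕜]

/-- A smooth local parametrization of dimension `d` of the subset `Y` of `X` near `y`: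
a smooth map `c` on an open set `W` with values in `Y`, and a smooth map `r` on an open
neighbourhood `V` of `y`, inverse to each other on `W` and `Y ∩ V`. -/
structure Parametrization (X : SmoothMfd.{u} 𝕜) (Y : Set X) (d : ℕ) (y : X) where
  c : EuclideanSpace 𝕜 (Fin d) → X
  r : X → EuclideanSpace 𝕜 (Fin d)
  W : Set (EuclideanSpace 𝕜 (Fin d))
  V : Set X
  isOpen_W : IsOpen W
  isOpen_V : IsOpen V
  mem_V : y ∈ V
  mem_W : r y ∈ W
  contMDiffOn_c : ContMDiffOn 𝓘(𝕜, EuclideanSpace 𝕜 (Fin d)) X.I ∞ c W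
  contMDiffOn_r : ContMDiffOn X.I 𝓘(𝕜, EuclideanSpace 𝕜 (Fin d)) ∞ r V
  c_mem : ∀ w ∈ W, c w ∈ Y
  r_c : ∀ w ∈ W, r (c w) = w
  c_r : ∀ z ∈ Y, z ∈ V → c (r z) = z

namespace Parametrization

variable {X : SmoothMfd.{u} 𝕜} {Y : Set X} {d : ℕ} {y : X}

/-- Germs of mutually inverse smooth maps give a parametrization. -/
lemma nonempty_of_eventually (c : EuclideanSpace 𝕜 (Fin d) → X)
    (r : X → EuclideanSpace 𝕜 (Fin d))
    (hc : SmoothNear 𝓘(𝕜, EuclideanSpace 𝕜 (Fin d)) X.I c (r y))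
    (hr : SmoothNear X.I 𝓘(𝕜, EuclideanSpace 𝕜 (Fin d)) r y)
    (hcY : ∀ᶠ w in 𝓝 (r y), c w ∈ Y) (hrc : ∀ᶠ w in 𝓝 (r y), r (c w) = w)
    (hcr : ∀ᶠ z in 𝓝 y, z ∈ Y → c (r z) = z) : Nonempty (Parametrization X Y d y) := by
  obtain ⟨W, hW, hWo, hyW⟩ := eventually_nhds_iff.mp (hc.and (hcY.and hrc))
  obtain ⟨V, hV, hVo, hyV⟩ := eventually_nhds_iff.mp (hr.and hcr)
  exact ⟨⟨c, r, W, V, hWo, hVo, hyV, hyW, fun w hw => (hW w hw).1.contMDiffWithinAt,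
    fun z hz => (hV z hz).1.contMDiffWithinAt, fun w hw => (hW w hw).2.1,
    fun w hw => (hW w hw).2.2, fun z hz hzV => (hV z hzV).2 hz⟩⟩

variable (P : Parametrization X Y d y)

open Classical in
/-- The chart of `Y` defined by a parametrization. -/
noncomputable def chart (hy : y ∈ Y) : OpenPartialHomeomorph Y (EuclideanSpace 𝕜 (Fin d)) where
  toFun z := P.r z
  -- The default value is never met on `target`, where `c` takes values in `Y`.
  invFun w := if h : P.c w ∈ Y then ⟨P.c w, h⟩ else ⟨y, hy⟩
  source := {z | (z : X) ∈ P.V ∩ P.r ⁻¹' P.W}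
  target := P.W ∩ P.c ⁻¹' P.V
  map_source' z hz := by
    refine ⟨hz.2, ?_⟩
    change P.c (P.r z) ∈ P.V
    rw [P.c_r z z.2 hz.1]
    exact hz.1
  map_target' w hw := by
    rw [dif_pos (P.c_mem w hw.1)]
    refine ⟨hw.2, ?_⟩
    change P.r (P.c w) ∈ P.W
    rw [P.r_c w hw.1]
    exact hw.1
  left_inv' z hz := by
    have h := P.c_r z z.2 hz.1
    rw [dif_pos (by rw [h]; exact z.2)]
    exact Subtype.ext h
  right_inv' w hw := by
    rw [dif_pos (P.c_mem w hw.1)]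
    exact P.r_c w hw.1
  open_source := (P.contMDiffOn_r.continuousOn.isOpen_inter_preimage P.isOpen_V P.isOpen_W).preimage
    continuous_subtype_val
  open_target := P.contMDiffOn_c.continuousOn.isOpen_inter_preimage P.isOpen_W P.isOpen_V
  continuousOn_toFun := P.contMDiffOn_r.continuousOn.comp continuous_subtype_val.continuousOn fun z hz => hz.1
  continuousOn_invFun := by
    rw [continuousOn_iff_continuous_domRestrict]
    refine Continuous.subtype_mk
      (continuousOn_iff_continuous_domRestrict.mp
        (P.contMDiffOn_c.continuousOn.mono (inter_subset_left (t := P.c ⁻¹' P.V))))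
      (fun w => P.c_mem w w.2.1) |>.congr fun w => ?_
    simp only [domRestrict_apply]
    rw [dif_pos (P.c_mem w w.2.1)]

lemma coe_chart_symm (hy : y ∈ Y) {w : EuclideanSpace 𝕜 (Fin d)} (hw : w ∈ P.W) :
    (((P.chart hy).symm w : Y) : X) = P.c w := by
  classical
  change ((if h : P.c w ∈ Y then (⟨P.c w, h⟩ : Y) else ⟨y, hy⟩ : Y) : X) = P.c w
  rw [dif_pos (P.c_mem w hw)]

end Parametrization

/-- A subset with smooth local parametrizations of the same dimension is an embedded
submanifold. -/
theorem isEmbeddedSubmanifold_of_parametrization (X : SmoothMfd.{u} 𝕜) (Y : Set X) (d : ℕ)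
    (hP : ∀ y ∈ Y, Nonempty (Parametrization X Y d y)) : X.IsEmbeddedSubmanifold Y := by
  let P : ∀ y : Y, Parametrization X Y d y := fun y => (hP y y.2).some
  let ch : Y → OpenPartialHomeomorph Y (EuclideanSpace 𝕜 (Fin d)) := fun y => (P y).chart y.2
  let cs : ChartedSpace (EuclideanSpace 𝕜 (Fin d)) Y :=
    { atlas := range ch
      chartAt := ch
      mem_chart_source := fun y => ⟨(P y).mem_V, (P y).mem_W⟩
      chart_mem_atlas := fun y => mem_range_self y }
  have mf : IsManifold 𝓘(𝕜, EuclideanSpace 𝕜 (Fin d)) ∞ Y := by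
    refine isManifold_of_contDiffOn _ _ _ ?_
    rintro _ _ ⟨y, rfl⟩ ⟨z, rfl⟩
    simp only [modelWithCornersSelf_coe, modelWithCornersSelf_coe_symm, range_id, inter_univ,
      Function.id_comp, Function.comp_id, preimage_id]
    -- A change of charts is the `r` of one parametrization after the `c` of another, a composite of
    -- smooth maps through the ambient manifold.
    have h1 : ContMDiffOn 𝓘(𝕜, EuclideanSpace 𝕜 (Fin d)) 𝓘(𝕜, EuclideanSpace 𝕜 (Fin d)) ∞
        (fun w => (P z).r ((P y).c w)) ((ch y).symm ≫ₕ ch z).source := by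
      refine (P z).contMDiffOn_r.comp ((P y).contMDiffOn_c.mono ?_) ?_
      · intro w hw
        rw [OpenPartialHomeomorph.trans_source] at hw
        exact hw.1.1
      · intro w hw
        rw [OpenPartialHomeomorph.trans_source] at hw
        have h2 : (((ch y).symm w : Y) : X) ∈ (P z).V := hw.2.1
        rwa [(P y).coe_chart_symm y.2 hw.1.1] at h2
    refine (contMDiffOn_iff_contDiffOn.mp h1).congr ?_
    intro w hw
    rw [OpenPartialHomeomorph.trans_source] at hw
    change (P z).r (((ch y).symm w : Y) : X) = _
    rw [(P y).coe_chart_symm y.2 hw.1.1]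
  let N : SmoothMfd.{u} 𝕜 := ⟨Y, d, inferInstance, cs, mf, inferInstance, inferInstance⟩
  have hch : ∀ y : Y, ContMDiffOn N.I 𝓘(𝕜, EuclideanSpace 𝕜 (Fin d)) ∞ (ch y) (ch y).source :=
    fun y => contMDiffOn_of_mem_maximalAtlas
      (IsManifold.chart_mem_maximalAtlas (I := N.I) (M := N) (n := ∞) y)
  have hchs : ∀ y : Y, ContMDiffOn 𝓘(𝕜, EuclideanSpace 𝕜 (Fin d)) N.I ∞ (ch y).symm
      (ch y).target :=
    fun y => contMDiffOn_symm_of_mem_maximalAtlas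
      (IsManifold.chart_mem_maximalAtlas (I := N.I) (M := N) (n := ∞) y)
  have hmem : ∀ y : Y, y ∈ (ch y).source := fun y => ⟨(P y).mem_V, (P y).mem_W⟩
  let i : N → X := fun z => Subtype.val (p := (· ∈ Y)) z
  have hi : ContMDiff N.I X.I ∞ i := by
    intro y
    have h1 : ContMDiffOn N.I X.I ∞ (fun z => (P y).c (ch y z)) (ch y).source :=
      (P y).contMDiffOn_c.comp (hch y) fun z hz => hz.2
    refine (h1.contMDiffAt ((ch y).open_source.mem_nhds (hmem y))).congr_of_eventuallyEq ?_
    filter_upwards [(ch y).open_source.mem_nhds (hmem y)] with z hz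
    exact ((P y).c_r z z.2 hz.1).symm
  refine ⟨N, i, ⟨?_, Topology.IsEmbedding.subtypeVal⟩, Subtype.range_val⟩
  refine isImmersion_of_leftInverse hi fun y => ?_
  have hr : SmoothNear X.I 𝓘(𝕜, EuclideanSpace 𝕜 (Fin d)) (P y).r (i y) :=
    (P y).contMDiffOn_r.smoothNear ((P y).isOpen_V.mem_nhds (P y).mem_V)
  have hs : SmoothNear 𝓘(𝕜, EuclideanSpace 𝕜 (Fin d)) N.I (ch y).symm (ch y y) :=
    (hchs y).smoothNear ((ch y).open_target.mem_nhds ((ch y).map_source (hmem y)))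
  refine ⟨fun x => (ch y).symm ((P y).r x), hs.comp_of_eq hr rfl, ?_⟩
  filter_upwards [(ch y).open_source.mem_nhds (hmem y)] with z hz
  exact (ch y).left_inv hz

end SmoothMfd

/-! ### Stationary curves -/

section Stationary

variable {𝕜 : Type*} [RCLike 𝕜] {E₁ H₁ M₁ E₂ H₂ M₂ : Type*}
  [NormedAddCommGroup E₁] [NormedSpace 𝕜 E₁] [TopologicalSpace H₁] [TopologicalSpace M₁]
  [NormedAddCommGroup E₂] [NormedSpace 𝕜 E₂] [TopologicalSpace H₂] [TopologicalSpace M₂]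
  [ChartedSpace H₁ M₁] [ChartedSpace H₂ M₂]
  {I₁ : ModelWithCorners 𝕜 E₁ H₁} {I₂ : ModelWithCorners 𝕜 E₂ H₂}

variable (I₁) in
/-- The curve `c` has velocity zero at time `0`. -/
def Stationary (c : 𝕜 → M₁) : Prop := HasMFDerivAt 𝓘(𝕜, 𝕜) I₁ c 0 (0 : 𝕜 →L[𝕜] E₁)

variable {c : 𝕜 → M₁} {c₂ : 𝕜 → M₂} {g : M₁ → M₂} {s : Set M₁}

lemma stationary_const (x : M₁) : Stationary I₁ (fun _ : 𝕜 => x) := hasMFDerivAt_const x 0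

lemma Stationary.congr {c' : 𝕜 → M₁} (hc : Stationary I₁ c) (h : c' =ᶠ[𝓝 0] c) :
    Stationary I₁ c' := by
  unfold Stationary at hc ⊢
  exact hc.congr_of_eventuallyEq h

lemma Stationary.prodMk (hc : Stationary I₁ c) (hc₂ : Stationary I₂ c₂) :
    Stationary (I₁.prod I₂) (fun e => (c e, c₂ e)) :=
  (HasMFDerivAt.prodMk hc hc₂).congr_mfderiv (by ext <;> rfl)

/-- Since `s` need not be open, the derivative of `g` within `s` is composed with that of the curve,
which remains in `s`. This allows products and actions to be applied to curves of composable pairs.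
-/
lemma Stationary.comp_contMDiffOn (hc : Stationary I₁ c) (hg : ContMDiffOn I₁ I₂ ∞ g s)
    (hs : ∀ᶠ e in 𝓝 0, c e ∈ s) : Stationary I₂ (fun e => g (c e)) := by
  have h1 := ((hg (c 0) hs.self_of_nhds).mdifferentiableWithinAt (by simp)).hasMFDerivWithinAt
  have h2 := (h1.comp 0 (HasMFDerivAt.hasMFDerivWithinAt (s := c ⁻¹' s) hc)
    subset_rfl).hasMFDerivAt hs
  exact h2.congr_mfderiv (ContinuousLinearMap.comp_zero _)

lemma Stationary.comp_contMDiffAt (hc : Stationary I₁ c) (hg : ContMDiffAt I₁ I₂ ∞ g (c 0)) :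
    Stationary I₂ (fun e => g (c e)) :=
  ((hg.mdifferentiableAt (by simp)).hasMFDerivAt.comp 0 hc).congr_mfderiv
    (ContinuousLinearMap.comp_zero _)

lemma MDifferentiableAt.comp_contMDiffOn {x : 𝕜} (hc : MDifferentiableAt 𝓘(𝕜, 𝕜) I₁ c x)
    (hg : ContMDiffOn I₁ I₂ ∞ g s) (hs : ∀ᶠ e in 𝓝 x, c e ∈ s) :
    MDifferentiableAt 𝓘(𝕜, 𝕜) I₂ (fun e => g (c e)) x := by
  have h1 := ((hg (c x) hs.self_of_nhds).mdifferentiableWithinAt (by simp)).hasMFDerivWithinAt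
  exact ((h1.comp x (HasMFDerivAt.hasMFDerivWithinAt (s := c ⁻¹' s) hc.hasMFDerivAt)
    subset_rfl).hasMFDerivAt hs).mdifferentiableAt

end Stationary

namespace LieMorita

variable {𝕜 : Type v} [RCLike 𝕜] {Γ Γ' : LieGroupoid.{u} 𝕜} (X : LieMorita Γ Γ')

/-! ### The orbit maps of the right action are immersions -/

lemma ract_inv_cancel (x : X.X) (g : Γ'.Arr) (h : X.p' x = Γ'.src g) :
    X.ract (X.ract x g) (Γ'.inv g) = x := by
  rw [← X.ract_mul _ _ _ h (Γ'.src_inv g).symm, Γ'.mul_inv, ← h, X.ract_unit]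

lemma ract_left_cancel {x : X.X} {g h : Γ'.Arr} (hg : X.p' x = Γ'.src g)
    (hh : X.p' x = Γ'.src h) (he : X.ract x g = X.ract x h) : g = h := by
  have ht : Γ'.tgt g = Γ'.tgt h := by rw [← X.p'_ract _ _ hg, he, X.p'_ract _ _ hh]
  have hc : Γ'.tgt g = Γ'.src (Γ'.inv h) := by rw [Γ'.src_inv, ht]
  have h1 : X.ract x (Γ'.mul g (Γ'.inv h)) = x := by
    rw [X.ract_mul _ _ _ hg hc, he, X.ract_inv_cancel _ _ hh]
  have h2 := X.ract_free _ _ (by rw [Γ'.src_mul _ _ hc, hg]) h1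
  have h3 : Γ'.mul (Γ'.mul g (Γ'.inv h)) h = g := by
    rw [Γ'.mul_assoc _ _ _ hc (Γ'.tgt_inv h), Γ'.inv_mul, ← ht, Γ'.mul_unit]
  rw [← h3, h2, hh, Γ'.unit_mul]

/-- The orbit map `g ↦ x g` is immersive at `g₀`, in terms of velocities of curves. -/
def IsOrbitImmersive (x : X.X) (g₀ : Γ'.Arr) : Prop :=
  ∀ c : 𝕜 → Γ'.Arr, MDifferentiableAt 𝓘(𝕜, 𝕜) Γ'.Arr.I c 0 → c 0 = g₀ →
    (∀ᶠ e in 𝓝 0, X.p' x = Γ'.src (c e)) → Stationary X.X.I (fun e => X.ract x (c e)) →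
    Stationary Γ'.Arr.I c

/-- An injective map is immersive somewhere. -/
lemma exists_isOrbitImmersive (x : X.X) : ∃ g, X.p' x = Γ'.src g ∧ X.IsOrbitImmersive x g := by
  let F := SmoothMfd.Compl Γ'.Arr Γ'.Obj
  obtain ⟨τ, w, hτ0, -, hτ, hw, hτw, hwτ⟩ :=
    SmoothMfd.exists_normalForm_of_isSubmersion Γ'.submersion_src (Γ'.unit (X.p' x))
  rw [Γ'.src_unit] at hτ0 hτ hτw
  -- A parametrization, near the unit, of the source fibre of `p' x`. Curves in this fibre replace a
  -- manifold structure on it.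
  let t : F → Γ'.Arr := fun a => τ (X.p' x, a)
  have hpair : SmoothNear 𝓘(𝕜, F) (Γ'.Obj.I.prod 𝓘(𝕜, F)) (fun a : F => (X.p' x, a)) 0 :=
    (smoothNear_const _).prodMk smoothNear_id
  have ht : SmoothNear 𝓘(𝕜, F) Γ'.Arr.I t 0 := hτ.comp_of_eq hpair rfl
  have ht0 : Filter.Tendsto t (𝓝 0) (𝓝 (Γ'.unit (X.p' x))) := by
    have := ht.continuousAt.tendsto
    rwa [show t 0 = _ from hτ0] at this
  have hsrc : ∀ᶠ a in 𝓝 (0 : F), Γ'.src (t a) = X.p' x ∧ w (t a) = a :=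
    hpair.continuousAt.eventually hτw
  have hr : SmoothNear 𝓘(𝕜, F) X.X.I (fun a => X.ract x (t a)) 0 :=
    X.contMDiffOn_ract.comp_smoothNear ((smoothNear_const x).prodMk ht)
      (hsrc.mono fun a ha => ha.1.symm)
  have hr0 : X.ract x (t 0) = x := by
    rw [show t 0 = _ from hτ0, X.ract_unit]
  let φ : F → X.X.Model := fun a => extChartAt X.X.I x (X.ract x (t a))
  have hφ : SmoothNear 𝓘(𝕜, F) 𝓘(𝕜, X.X.Model) φ 0 :=
    (smoothNear_extChartAt (x := x)).comp_of_eq hr hr0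
  have hchart : ∀ᶠ a in 𝓝 (0 : F), X.ract x (t a) ∈ (extChartAt X.X.I x).source :=
    hr.continuousAt.eventually_mem (by rw [hr0]; exact extChartAt_source_mem_nhds x)
  obtain ⟨U, hU, hUo, hU0⟩ := eventually_nhds_iff.mp (hφ.and (hsrc.and (hchart.and
    (ht.and ((ht0.eventually hw.eventually).and
      (ht0.eventually (eventually_eventually_nhds.mpr hwτ)))))))
  have hinj : InjOn φ U := by
    intro a ha b hb hab
    obtain ⟨-, ha1, ha2, -⟩ := hU a ha
    obtain ⟨-, hb1, hb2, -⟩ := hU b hb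
    have h1 := (extChartAt X.X.I x).injOn ha2 hb2 hab
    have h2 := X.ract_left_cancel ha1.1.symm hb1.1.symm h1
    rw [← ha1.2, h2, hb1.2]
  -- The orbit map read in charts is injective because the action is free, so it is immersive at
  -- some `a`, which need not be `0`.
  obtain ⟨a, haU, ha⟩ := exists_injective_fderiv_of_injOn hUo ⟨0, hU0⟩
    (fun b hb => (hU b hb).1.contDiffAt) hinj
  obtain ⟨ha1, ha2, ha3, ha4, ha5, ha6⟩ := hU a haU
  refine ⟨t a, ha2.1.symm, fun c hc hc0 hcs hst => ?_⟩
  have hcc : Filter.Tendsto c (𝓝 0) (𝓝 (t a)) := by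
    have := hc.continuousAt.tendsto
    rwa [hc0] at this
  -- A curve in the source fibre is recovered from its fibre coordinate, so it suffices to show that
  -- `w ∘ c` is stationary.
  have hct : ∀ᶠ e in 𝓝 0, c e = t (w (c e)) := by
    filter_upwards [hcs, hcc.eventually ha6] with e h1 h2
    rw [← h1] at h2
    exact h2.symm
  have hu : MDifferentiableAt 𝓘(𝕜, 𝕜) 𝓘(𝕜, F) (fun e => w (c e)) 0 := by
    have h1 : MDifferentiableAt Γ'.Arr.I 𝓘(𝕜, F) w (c 0) := by
      rw [hc0]; exact ha5.contMDiffAt.mdifferentiableAt (by simp)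
    exact h1.comp 0 hc
  have hu0 : w (c 0) = a := by rw [hc0, ha2.2]
  have hφu : Stationary 𝓘(𝕜, X.X.Model) (fun e => φ (w (c e))) := by
    have h1 : ContMDiffAt X.X.I 𝓘(𝕜, X.X.Model) ∞ (extChartAt X.X.I x) (X.ract x (c 0)) := by
      rw [hc0]
      exact contMDiffAt_extChartAt' (by simpa using ha3)
    refine (hst.comp_contMDiffAt h1).congr ?_
    filter_upwards [hct] with e he
    change extChartAt X.X.I x (X.ract x (t (w (c e)))) = _
    rw [← he]
  have hu' : HasFDerivAt (fun e => w (c e)) (fderiv 𝕜 (fun e => w (c e)) 0) 0 :=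
    (mdifferentiableAt_iff_differentiableAt.mp hu).hasFDerivAt
  have hφ' : HasFDerivAt φ (fderiv 𝕜 φ a) (w (c 0)) := by
    rw [hu0]; exact (ha1.contDiffAt.differentiableAt (by simp)).hasFDerivAt
  have hφu' : HasFDerivAt (fun e => φ (w (c e))) (0 : 𝕜 →L[𝕜] X.X.Model) 0 :=
    hasMFDerivAt_iff_hasFDerivAt.mp hφu
  have hφc : HasFDerivAt (fun e => φ (w (c e))) (fderiv 𝕜 φ a ∘L fderiv 𝕜 (fun e => w (c e)) 0) 0 :=
    HasFDerivAt.comp (f := fun e => w (c e)) 0 hφ' hu'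
  have hz := hφc.unique hφu'
  have hust : Stationary 𝓘(𝕜, F) (fun e => w (c e)) := by
    refine hasMFDerivAt_iff_hasFDerivAt.mpr (hu'.congr_fderiv ?_)
    ext1
    exact ha ((DFunLike.congr_fun hz 1).trans (map_zero (fderiv 𝕜 φ a)).symm)
  have : ContMDiffAt 𝓘(𝕜, F) Γ'.Arr.I ∞ t (w (c 0)) := by rw [hu0]; exact ha4
  exact (hust.comp_contMDiffAt this).congr hct

variable {X}

/-- As `(x h) k = x (h k)`, the hypothesis makes `h k` stationary, and left multiplication by `h⁻¹`
preserves stationarity. The product of the point and the arrow is `x g` in both cases. -/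
lemma IsOrbitImmersive.translate {x : X.X} {g h : Γ'.Arr} (hg : X.p' x = Γ'.src g)
    (hh : X.p' x = Γ'.src h) (hx : X.IsOrbitImmersive x g) :
    X.IsOrbitImmersive (X.ract x h) (Γ'.mul (Γ'.inv h) g) := by
  intro k hk hk0 hks hst
  rw [X.p'_ract _ _ hh] at hks
  have hc : MDifferentiableAt 𝓘(𝕜, 𝕜) Γ'.Arr.I (fun e => Γ'.mul h (k e)) 0 :=
    MDifferentiableAt.comp_contMDiffOn (c := fun e => (h, k e))
      (mdifferentiableAt_const.prodMk hk) Γ'.contMDiffOn_mul hks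
  have hsg : Γ'.src h = Γ'.src g := hh.symm.trans hg
  have h1 : Stationary Γ'.Arr.I (fun e => Γ'.mul h (k e)) := by
    refine hx _ hc ?_ ?_ (hst.congr ?_)
    · rw [hk0, ← Γ'.mul_assoc _ _ _ (Γ'.src_inv h).symm (by rw [Γ'.tgt_inv, hsg]), Γ'.mul_inv,
        hsg, Γ'.unit_mul]
    · filter_upwards [hks] with e he
      rw [Γ'.src_mul _ _ he, hh]
    · filter_upwards [hks] with e he
      rw [X.ract_mul _ _ _ hh he]
  have h2 : ∀ᶠ e in 𝓝 0, (Γ'.inv h, Γ'.mul h (k e)) ∈ {q : Γ'.Arr × Γ'.Arr |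
      Γ'.tgt q.1 = Γ'.src q.2} := by
    filter_upwards [hks] with e he
    rw [Γ'.src_mul _ _ he, Γ'.tgt_inv]
  refine (((stationary_const (Γ'.inv h)).prodMk h1).comp_contMDiffOn Γ'.contMDiffOn_mul h2).congr ?_
  filter_upwards [hks] with e he
  rw [Γ'.inv_mul_cancel_left _ _ he]

/-- The curve `k` is conjugated into `c = g k b(tgt k)`, which starts at a unit. A local section `b`
of the source through `g⁻¹` is needed because the target of `k` varies. This target equals `p' (x g
k)`, so it is stationary, and so are `b(tgt k)` and `x c = (x g k) b(tgt k)`. Hence `c` is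
stationary, and undoing the two multiplications gives the claim for `k`. -/
lemma IsOrbitImmersive.move {x : X.X} {g : Γ'.Arr} (hg : X.p' x = Γ'.src g)
    (hx : X.IsOrbitImmersive x (Γ'.unit (X.p' x))) :
    X.IsOrbitImmersive (X.ract x g) (Γ'.unit (X.p' (X.ract x g))) := by
  intro k hk hk0 hks hst
  rw [X.p'_ract _ _ hg] at hks hk0
  obtain ⟨b, hb, hb0, hbs⟩ := SmoothMfd.exists_section_of_isSubmersion Γ'.submersion_src (Γ'.inv g)
  rw [Γ'.src_inv] at hb hb0 hbs
  have htk : ∀ᶠ e in 𝓝 0, Γ'.src (b (Γ'.tgt (k e))) = Γ'.tgt (k e) := by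
    have : ContinuousAt (fun e => Γ'.tgt (k e)) 0 :=
      Γ'.submersion_tgt.contMDiff.continuous.continuousAt.comp hk.continuousAt
    refine this.eventually (p := fun m => Γ'.src (b m) = m) ?_
    simpa only [hk0, Γ'.tgt_unit] using hbs
  let c : 𝕜 → Γ'.Arr := fun e => Γ'.mul (Γ'.mul g (k e)) (b (Γ'.tgt (k e)))
  have hbd : MDifferentiableAt 𝓘(𝕜, 𝕜) Γ'.Arr.I (fun e => b (Γ'.tgt (k e))) 0 := by
    have h1 : MDifferentiableAt 𝓘(𝕜, 𝕜) Γ'.Obj.I (fun e => Γ'.tgt (k e)) 0 :=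
      (Γ'.submersion_tgt.contMDiff.mdifferentiable (by simp) _).comp 0 hk
    have h2 : MDifferentiableAt Γ'.Obj.I Γ'.Arr.I b (Γ'.tgt (k 0)) := by
      rw [hk0, Γ'.tgt_unit]; exact hb.contMDiffAt.mdifferentiableAt (by simp)
    exact h2.comp 0 h1
  have hgk : MDifferentiableAt 𝓘(𝕜, 𝕜) Γ'.Arr.I (fun e => Γ'.mul g (k e)) 0 :=
    MDifferentiableAt.comp_contMDiffOn (c := fun e => (g, k e))
      (mdifferentiableAt_const.prodMk hk) Γ'.contMDiffOn_mul hks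
  have hcomp : ∀ᶠ e in 𝓝 0, Γ'.tgt (Γ'.mul g (k e)) = Γ'.src (b (Γ'.tgt (k e))) := by
    filter_upwards [hks, htk] with e h1 h2
    rw [Γ'.tgt_mul _ _ h1, h2]
  have hc : MDifferentiableAt 𝓘(𝕜, 𝕜) Γ'.Arr.I c 0 :=
    MDifferentiableAt.comp_contMDiffOn (hgk.prodMk hbd) Γ'.contMDiffOn_mul hcomp
  have hpy : ∀ᶠ e in 𝓝 0, X.p' (X.ract (X.ract x g) (k e)) = Γ'.tgt (k e) := by
    filter_upwards [hks] with e he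
    exact X.p'_ract _ _ (by rw [X.p'_ract _ _ hg, he])
  have htst : Stationary Γ'.Obj.I (fun e => Γ'.tgt (k e)) :=
    (hst.comp_contMDiffAt (X.submersion_p'.contMDiff _)).congr (hpy.mono fun e he => he.symm)
  have hbst : Stationary Γ'.Arr.I (fun e => b (Γ'.tgt (k e))) := by
    refine htst.comp_contMDiffAt ?_
    rw [hk0, Γ'.tgt_unit]; exact hb.contMDiffAt
  have hcst : Stationary Γ'.Arr.I c := by
    refine hx c hc ?_ ?_ ?_
    · change Γ'.mul (Γ'.mul g (k 0)) (b (Γ'.tgt (k 0))) = _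
      rw [hk0, Γ'.tgt_unit, hb0, Γ'.mul_unit, Γ'.mul_inv, hg]
    · filter_upwards [hks, hcomp] with e h1 h2
      rw [Γ'.src_mul _ _ h2, Γ'.src_mul _ _ h1, hg]
    · have h1 : ∀ᶠ e in 𝓝 0, (X.ract (X.ract x g) (k e), b (Γ'.tgt (k e))) ∈
          {q : X.X × Γ'.Arr | X.p' q.1 = Γ'.src q.2} := by
        filter_upwards [hpy, htk] with e h1 h2
        exact h1.trans h2.symm
      refine ((hst.prodMk hbst).comp_contMDiffOn X.contMDiffOn_ract h1).congr ?_
      filter_upwards [hks, hcomp] with e h1 h2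
      rw [X.ract_mul _ _ _ (by rw [Γ'.src_mul _ _ h1, hg]) h2, X.ract_mul _ _ _ hg h1]
  have hbi : Stationary Γ'.Arr.I (fun e => Γ'.inv (b (Γ'.tgt (k e)))) :=
    hbst.comp_contMDiffAt (Γ'.contMDiff_inv _)
  have h3 : Stationary Γ'.Arr.I (fun e => Γ'.mul (c e) (Γ'.inv (b (Γ'.tgt (k e))))) := by
    refine (hcst.prodMk hbi).comp_contMDiffOn Γ'.contMDiffOn_mul ?_
    filter_upwards [hcomp] with e h1
    change Γ'.tgt (Γ'.mul _ _) = _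
    rw [Γ'.tgt_mul _ _ h1, Γ'.src_inv]
  have h4 : Stationary Γ'.Arr.I (fun e => Γ'.mul g (k e)) := by
    refine h3.congr ?_
    filter_upwards [hcomp] with e h1
    change _ = Γ'.mul (Γ'.mul _ _) _
    rw [Γ'.mul_assoc _ _ _ h1 (Γ'.src_inv _).symm, Γ'.mul_inv, ← h1, Γ'.mul_unit]
  have h5 : ∀ᶠ e in 𝓝 0, (Γ'.inv g, Γ'.mul g (k e)) ∈ {q : Γ'.Arr × Γ'.Arr |
      Γ'.tgt q.1 = Γ'.src q.2} := by
    filter_upwards [hks] with e he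
    rw [Γ'.src_mul _ _ he, Γ'.tgt_inv]
  refine (((stationary_const (Γ'.inv g)).prodMk h4).comp_contMDiffOn Γ'.contMDiffOn_mul h5).congr ?_
  filter_upwards [hks] with e he
  rw [Γ'.inv_mul_cancel_left _ _ he]

variable (X)

/-- The orbit maps of the right action are immersive. -/
lemma isOrbitImmersive (x : X.X) (g : Γ'.Arr) (hg : X.p' x = Γ'.src g) :
    X.IsOrbitImmersive x g := by
  -- Starting from an immersive pair `(y, h)`, translation by `h` gives the pair `(y h, unit)`, and
  -- moving by `h⁻¹` returns to `y` while keeping a unit.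
  have hunit : ∀ y : X.X, X.IsOrbitImmersive y (Γ'.unit (X.p' y)) := by
    intro y
    obtain ⟨h, hh, hy⟩ := X.exists_isOrbitImmersive y
    have h1 := hy.translate hh hh
    have h2 : X.p' (X.ract y h) = Γ'.src (Γ'.inv h) := by rw [X.p'_ract _ _ hh, Γ'.src_inv]
    rw [Γ'.inv_mul, ← X.p'_ract _ _ hh] at h1
    have h3 := h1.move h2
    rwa [X.ract_inv_cancel _ _ hh] at h3
  have h2 : X.p' (X.ract x g) = Γ'.src (Γ'.inv g) := by rw [X.p'_ract _ _ hg, Γ'.src_inv]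
  -- The pair `(x, g)` is the translate of `(x g, unit)` by `g⁻¹`.
  have h1 := (hunit (X.ract x g)).translate (Γ'.src_unit _).symm h2
  rw [X.ract_inv_cancel _ _ hg, Γ'.inv_inv, X.p'_ract _ _ hg, Γ'.mul_unit] at h1
  exact h1

/-! ### Division -/

/-- The right action is principal: `g` depends continuously on `x` and `x g`. -/
lemma tendsto_division {ι : Type*} {l : Filter ι} {z : ι → X.X} {g : ι → Γ'.Arr} {z₀ : X.X}
    {g₀ : Γ'.Arr} (h₀ : X.p' z₀ = Γ'.src g₀) (hz : Filter.Tendsto z l (𝓝 z₀))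
    (hx : Filter.Tendsto (fun n => X.ract (z n) (g n)) l (𝓝 (X.ract z₀ g₀)))
    (h : ∀ᶠ n in l, X.p' (z n) = Γ'.src (g n)) : Filter.Tendsto g l (𝓝 g₀) := by
  classical
  let θ := fun q : {q : X.X × Γ'.Arr // X.p' q.1 = Γ'.src q.2} => (q.1.1, X.ract q.1.1 q.1.2)
  have hinj : Function.Injective θ := by
    rintro ⟨⟨a, g⟩, ha⟩ ⟨⟨b, k⟩, hb⟩ hab
    obtain rfl : a = b := congrArg Prod.fst hab
    obtain rfl : g = k := X.ract_left_cancel ha hb (congrArg Prod.snd hab)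
    rfl
  -- Freeness makes `(x, g) ↦ (x, x g)` injective, and an injective proper map is a closed
  -- embedding; the arrow is a component of its inverse.
  have hemb : IsClosedEmbedding θ := .of_continuous_injective_isClosedMap
    X.ract_proper.continuous hinj X.ract_proper.isClosedMap
  let q : ι → {q : X.X × Γ'.Arr // X.p' q.1 = Γ'.src q.2} := fun n =>
    if hn : X.p' (z n) = Γ'.src (g n) then ⟨(z n, g n), hn⟩ else ⟨(z₀, g₀), h₀⟩
  have hq : ∀ᶠ n in l, (q n).1 = (z n, g n) := by
    filter_upwards [h] with n hn
    simp only [q, dif_pos hn]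
  have h1 : Filter.Tendsto q l (𝓝 ⟨(z₀, g₀), h₀⟩) := by
    rw [hemb.isInducing.tendsto_nhds_iff]
    refine (hz.prodMk_nhds hx).congr' ?_
    filter_upwards [hq] with n hn
    simp only [Function.comp_apply, θ, hn]
  have h2 : Filter.Tendsto (fun n => (q n).1.2) l (𝓝 g₀) :=
    ((continuous_snd.comp continuous_subtype_val).tendsto _).comp h1
  exact h2.congr' (by filter_upwards [hq] with n hn; rw [hn])

/-- The right action is principal: locally, `g` is a smooth function of `x` and `x g`. -/
lemma exists_division (z₀ : X.X) (g₀ : Γ'.Arr) (h₀ : X.p' z₀ = Γ'.src g₀) :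
    ∃ D : X.X × X.X → Γ'.Arr,
      SmoothNear (X.X.I.prod X.X.I) Γ'.Arr.I D (z₀, X.ract z₀ g₀) ∧
      ∀ᶠ q : X.X × Γ'.Arr in 𝓝 (z₀, g₀), X.p' q.1 = Γ'.src q.2 →
        D (q.1, X.ract q.1 q.2) = q.2 := by
  let F := SmoothMfd.Compl Γ'.Arr Γ'.Obj
  obtain ⟨τ, w, hτ0, hw0, hτ, hw, hτw, hwτ⟩ :=
    SmoothMfd.exists_normalForm_of_isSubmersion Γ'.submersion_src g₀
  rw [← h₀] at hτ0 hτ hτw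
  have hpair : SmoothNear (X.X.I.prod 𝓘(𝕜, F)) (Γ'.Obj.I.prod 𝓘(𝕜, F))
      (fun q : X.X × F => (X.p' q.1, q.2)) (z₀, 0) :=
    (X.submersion_p'.contMDiff.comp_smoothNear smoothNear_fst).prodMk smoothNear_snd
  have hσ : SmoothNear (X.X.I.prod 𝓘(𝕜, F)) Γ'.Arr.I
      (fun q : X.X × F => τ (X.p' q.1, q.2)) (z₀, 0) := hτ.comp_of_eq hpair rfl
  have hσs : ∀ᶠ q : X.X × F in 𝓝 (z₀, 0), Γ'.src (τ (X.p' q.1, q.2)) = X.p' q.1 ∧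
      w (τ (X.p' q.1, q.2)) = q.2 := hpair.continuousAt.eventually hτw
  let A : X.X × F → X.X × X.X := fun q => (q.1, X.ract q.1 (τ (X.p' q.1, q.2)))
  have hA : SmoothNear (X.X.I.prod 𝓘(𝕜, F)) (X.X.I.prod X.X.I) A (z₀, 0) := by
    refine smoothNear_fst.prodMk (X.contMDiffOn_ract.comp_smoothNear (smoothNear_fst.prodMk hσ) ?_)
    exact hσs.mono fun q hq => hq.1.symm
  have hA0 : A (z₀, 0) = (z₀, X.ract z₀ g₀) := by
    simp only [A, hτ0]
  -- A vector in the kernel has first component zero because `A` preserves the first coordinate. Its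
  -- second component is the velocity of a line in the fibre, which `isOrbitImmersive` forces to be
  -- zero.
  have hinj : Function.Injective (mfderiv (X.X.I.prod 𝓘(𝕜, F)) (X.X.I.prod X.X.I) A (z₀, 0)) := by
    have hA' := (hA.contMDiffAt.mdifferentiableAt (by simp)).hasMFDerivAt
    set A' := mfderiv (X.X.I.prod 𝓘(𝕜, F)) (X.X.I.prod X.X.I) A (z₀, 0)
    rw [injective_iff_map_eq_zero]
    intro a ha
    have h1 := hasMFDerivAt_unique ((hasMFDerivAt_fst (A (z₀, 0))).comp (z₀, 0) hA')
      (hasMFDerivAt_fst (I := X.X.I) (I' := 𝓘(𝕜, F)) (z₀, (0 : F)))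
    have ha1 : a.1 = 0 := by
      have h2 := DFunLike.congr_fun h1 a
      change (A' a).1 = a.1 at h2
      rw [← h2, ha]
      rfl
    let l : 𝕜 →L[𝕜] F := (ContinuousLinearMap.id 𝕜 𝕜).smulRight a.2
    have hl : HasMFDerivAt 𝓘(𝕜, 𝕜) 𝓘(𝕜, F) l 0 l := l.hasMFDerivAt
    have hl0 : l 0 = 0 := map_zero l
    have hcurve : HasMFDerivAt 𝓘(𝕜, 𝕜) (X.X.I.prod 𝓘(𝕜, F)) (fun e => (z₀, l e)) 0
        (ContinuousLinearMap.prod (0 : 𝕜 →L[𝕜] X.X.Model) l) :=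
      (hasMFDerivAt_const z₀ 0).prodMk hl
    have hcst : Stationary (X.X.I.prod X.X.I) (fun e => A (z₀, l e)) := by
      have hA'' : HasMFDerivAt (X.X.I.prod 𝓘(𝕜, F)) (X.X.I.prod X.X.I) A (z₀, l 0) A' := by
        rw [hl0]; exact hA'
      refine (hA''.comp 0 hcurve).congr_mfderiv ?_
      ext1
      change A' (0, (1 : 𝕜) • a.2) = 0
      rw [one_smul, ← ha1]
      exact ha
    have hc0 : Filter.Tendsto (fun e => (z₀, l e)) (𝓝 0) (𝓝 (z₀, (0 : F))) := by
      have := hcurve.continuousAt.tendsto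
      rwa [hl0] at this
    have hst : Stationary Γ'.Arr.I (fun e => τ (X.p' z₀, l e)) := by
      refine X.isOrbitImmersive z₀ g₀ h₀ _ ?_ (by rw [hl0, hτ0]) ?_
        (hcst.comp_contMDiffAt contMDiffAt_snd)
      · have h2 : MDifferentiableAt (X.X.I.prod 𝓘(𝕜, F)) Γ'.Arr.I
            (fun q : X.X × F => τ (X.p' q.1, q.2)) (z₀, l 0) := by
          rw [hl0]; exact hσ.contMDiffAt.mdifferentiableAt (by simp)
        exact h2.comp (f := fun e => (z₀, l e)) 0 hcurve.mdifferentiableAt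
      · filter_upwards [hc0.eventually hσs] with e he using he.1.symm
    have hlst : Stationary 𝓘(𝕜, F) (fun e => l e) := by
      have h2 : ContMDiffAt Γ'.Arr.I 𝓘(𝕜, F) ∞ w (τ (X.p' z₀, l 0)) := by
        rw [hl0, hτ0]; exact hw.contMDiffAt
      refine (hst.comp_contMDiffAt h2).congr ?_
      filter_upwards [hc0.eventually hσs] with e he using he.2.symm
    have hl' : l = 0 := hasMFDerivAt_unique hl hlst
    have ha2 : a.2 = 0 := by
      have h3 : l 1 = 0 := by rw [hl']; rfl
      rwa [show l 1 = (1 : 𝕜) • a.2 from rfl, one_smul] at h3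
    exact Prod.ext ha1 ha2
  obtain ⟨r, hr, hrA⟩ := hA.exists_leftInverse hinj
  rw [hA0] at hr
  have hr0 : r (z₀, X.ract z₀ g₀) = (z₀, 0) := by rw [← hA0]; exact hrA.self_of_nhds
  refine ⟨fun q => τ (X.p' (r q).1, (r q).2), hσ.comp_of_eq hr hr0, ?_⟩
  have h1 : Filter.Tendsto (fun q : X.X × Γ'.Arr => (q.1, w q.2)) (𝓝 (z₀, g₀)) (𝓝 (z₀, 0)) := by
    have h2 : ContinuousAt (fun q : X.X × Γ'.Arr => (q.1, w q.2)) (z₀, g₀) :=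
      continuous_fst.continuousAt.prodMk
        (ContinuousAt.comp (f := Prod.snd) (g := w) hw.continuousAt continuous_snd.continuousAt)
    have h3 := h2.tendsto
    rwa [hw0] at h3
  have h2 : ∀ᶠ q : X.X × Γ'.Arr in 𝓝 (z₀, g₀), τ (Γ'.src q.2, w q.2) = q.2 :=
    continuous_snd.continuousAt.eventually (p := fun g => τ (Γ'.src g, w g) = g) hwτ
  filter_upwards [h1.eventually hrA, h2] with q h3 h4 hq
  rw [← hq] at h4
  have h5 : r (q.1, X.ract q.1 q.2) = (q.1, w q.2) := by
    rw [← h3]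
    simp only [A, h4]
  simp only [h5, h4]

/-- Smooth division. -/
lemma smoothNear_division {E₁ H₁ K : Type*} [NormedAddCommGroup E₁] [NormedSpace 𝕜 E₁]
    [TopologicalSpace H₁] [TopologicalSpace K] [ChartedSpace H₁ K] {J : ModelWithCorners 𝕜 E₁ H₁}
    {z x : K → X.X} {g : K → Γ'.Arr} {k : K} (hz : SmoothNear J X.X.I z k)
    (hx : SmoothNear J X.X.I x k)
    (h : ∀ᶠ n in 𝓝 k, X.p' (z n) = Γ'.src (g n) ∧ X.ract (z n) (g n) = x n) :
    SmoothNear J Γ'.Arr.I g k := by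
  obtain ⟨h₀, hx₀⟩ := h.self_of_nhds
  -- The local division map is known to recover the arrow only near `g k`, so continuity of `g` has
  -- to come first; it rests on properness.
  have hg : Filter.Tendsto g (𝓝 k) (𝓝 (g k)) := by
    refine X.tendsto_division h₀ hz.continuousAt.tendsto ?_ (h.mono fun n hn => hn.1)
    rw [hx₀]
    exact hx.continuousAt.tendsto.congr' (h.mono fun n hn => hn.2.symm)
  obtain ⟨D, hD, hDg⟩ := X.exists_division (z k) (g k) h₀
  rw [hx₀] at hD
  refine (hD.comp_of_eq (hz.prodMk hx) rfl).congr ?_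
  filter_upwards [h, (hz.continuousAt.tendsto.prodMk_nhds hg).eventually hDg] with n h1 h2
  rw [← h1.2, h2 h1.1]

end LieMorita

/-! ### Plots of the resolutions -/

section Plots

variable {𝕜 : Type*} [RCLike 𝕜] {E₁ H₁ M₁ E₂ H₂ M₂ : Type*}
  [NormedAddCommGroup E₁] [NormedSpace 𝕜 E₁] [TopologicalSpace H₁] [TopologicalSpace M₁]
  [NormedAddCommGroup E₂] [NormedSpace 𝕜 E₂] [TopologicalSpace H₂] [TopologicalSpace M₂]
  [ChartedSpace H₁ M₁] [ChartedSpace H₂ M₂]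
  {I₁ : ModelWithCorners 𝕜 E₁ H₁} {I₂ : ModelWithCorners 𝕜 E₂ H₂}

lemma SmoothNear.exists_subtype {P : M₂ → Prop} {f : M₁ → M₂} {x : M₁}
    (hf : SmoothNear I₁ I₂ f x) (hP : ∀ᶠ y in 𝓝 x, P (f y)) :
    ∃ g : M₁ → {z // P z}, SmoothNear I₁ I₂ (fun y => (g y).1) x ∧ ∀ᶠ y in 𝓝 x, (g y).1 = f y := by
  classical
  let g : M₁ → {z // P z} := fun y => if h : P (f y) then ⟨f y, h⟩ else ⟨f x, hP.self_of_nhds⟩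
  have hg : ∀ᶠ y in 𝓝 x, (g y).1 = f y := hP.mono fun y hy => by simp only [g, dif_pos hy]
  exact ⟨g, hf.congr hg, hg⟩

lemma SmoothNear.exists_opens {f : M₁ → M₂} {x : M₁} (hf : SmoothNear I₁ I₂ f x) {U : Opens M₁}
    (hx : x ∈ U) {P : M₁ → Prop} (hP : ∀ᶠ y in 𝓝 x, P y) :
    ∃ V : Opens M₁, x ∈ V ∧ V ≤ U ∧ ContMDiffOn I₁ I₂ ∞ f V ∧ ∀ y ∈ V, P y := by
  obtain ⟨V, hV, hVo, hxV⟩ := eventually_nhds_iff.mp ((U.isOpen.eventually_mem hx).and (hf.and hP))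
  exact ⟨⟨V, hVo⟩, hxV, fun y hy => (hV y hy).1,
    fun y hy => (hV y hy).2.1.contMDiffWithinAt, fun y hy => (hV y hy).2.2⟩

end Plots

namespace LieSubgroupoid

variable {𝕜 : Type v} [RCLike 𝕜] {Γ : LieGroupoid.{u} 𝕜} (R : LieSubgroupoid Γ)

/-- Stated with germs, so that plots can be assembled with `SmoothNear` without choosing open sets.
-/
lemma resolution_isPlot_iff {n : ℕ} {U : Opens (EuclideanSpace 𝕜 (Fin n))}
    {f : EuclideanSpace 𝕜 (Fin n) → R.resolution.Z} :
    R.resolution.str.IsPlot U f ↔ ∀ k ∈ U, ∃ a : EuclideanSpace 𝕜 (Fin n) → R.SourceIn,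
      SmoothNear 𝓘(𝕜, EuclideanSpace 𝕜 (Fin n)) Γ.Arr.I (fun y => (a y).1) k ∧
      ∀ᶠ y in 𝓝 k, f y = Quotient.mk R.leftOrbitRel (a y) := by
  constructor
  · intro hf k hk
    obtain ⟨V, a, hkV, -, ha, hfa⟩ := hf k hk
    exact ⟨a, ContMDiffOn.smoothNear ha (V.isOpen.mem_nhds hkV),
      (V.isOpen.eventually_mem hkV).mono hfa⟩
  · intro hf k hk
    obtain ⟨a, ha, hfa⟩ := hf k hk
    obtain ⟨V, hkV, hVU, haV, hV⟩ := ha.exists_opens hk hfa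
    exact ⟨V, a, hkV, hVU, haV, hV⟩

end LieSubgroupoid

/-! ### The transported resolution as `R \ p⁻¹(L)` -/

namespace LieMorita

variable {𝕜 : Type v} [RCLike 𝕜] {Γ Γ' : LieGroupoid.{u} 𝕜} (X : LieMorita Γ Γ')
  (R : LieSubgroupoid Γ)

/-- The class of `([1], x)` in the transported resolution. -/
noncomputable def transportMk (x : {x : X.X // X.p x ∈ R.base}) : (X.transport R.resolution).Z :=
  Quotient.mk (X.diagRel R.resolution)
    ⟨(Quotient.mk R.leftOrbitRel ⟨Γ.unit (X.p x.1), by rw [Γ.src_unit]; exact x.2⟩, x.1),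
      Γ.tgt_unit _⟩

/-- Apply the diagonal relation with the arrow `a` itself: `([a], x) ∼ ([a a⁻¹], a x)`. Hence every
class has a representative whose first entry is a unit. -/
lemma transportMk_lact (a : R.SourceIn) (x : X.X) (h : Γ.tgt a.1 = X.p x)
    (h' : R.resolution.φ (Quotient.mk R.leftOrbitRel a) = X.p x) :
    Quotient.mk (X.diagRel R.resolution) ⟨(Quotient.mk R.leftOrbitRel a, x), h'⟩ =
      X.transportMk R ⟨X.lact a.1 x, by rw [X.p_lact _ _ h]; exact a.2⟩ := by
  refine Quotient.sound ⟨a.1, h, ?_, rfl⟩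
  refine congrArg (Quotient.mk R.leftOrbitRel) (Subtype.ext ?_)
  change Γ.unit (X.p (X.lact a.1 x)) = (R.translate a (Γ.inv a.1)).1
  rw [R.coe_translate _ _ (Γ.src_inv _).symm, Γ.mul_inv, X.p_lact _ _ h]

/-- The arrow that relates the two representatives must carry the class of a unit to the class of a
unit, so it lies in `R`. -/
lemma transportMk_eq_iff {x y : {x : X.X // X.p x ∈ R.base}} :
    X.transportMk R x = X.transportMk R y ↔
      ∃ r, Γ.tgt (R.incl r) = X.p x.1 ∧ y.1 = X.lact (R.incl r) x.1 := by
  constructor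
  · intro h
    obtain ⟨g, hg, h1, h2⟩ := Quotient.exact h
    change Γ.tgt g = X.p x.1 at hg
    change y.1 = X.lact g x.1 at h2
    obtain ⟨r, hr, h3⟩ := Quotient.exact h1
    change Γ.tgt (R.incl r) = Γ.src (Γ.unit (X.p y.1)) at hr
    rw [Γ.src_unit] at hr
    change (R.translate _ (Γ.inv g)).1 = Γ.mul (R.incl r) (Γ.unit (X.p y.1)) at h3
    rw [R.coe_translate _ _ (by rw [Γ.tgt_unit, Γ.src_inv, hg]), ← hr, Γ.mul_unit] at h3
    change Γ.mul (Γ.unit (X.p x.1)) (Γ.inv g) = _ at h3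
    rw [← hg, ← Γ.src_inv, Γ.unit_mul] at h3
    refine ⟨R.R.inv r, ?_, ?_⟩
    · rw [R.incl_inv, ← h3, Γ.inv_inv, hg]
    · rw [R.incl_inv, ← h3, Γ.inv_inv, h2]
  · rintro ⟨r, hr, hy⟩
    have h1 : X.p y.1 = Γ.src (R.incl r) := by rw [hy, X.p_lact _ _ hr]
    refine Quotient.sound ⟨R.incl r, hr, ?_, hy⟩
    refine Quotient.sound ⟨R.R.inv r, ?_, ?_⟩
    · change _ = Γ.src (Γ.unit (X.p y.1))
      rw [R.incl_inv, Γ.tgt_inv, Γ.src_unit, h1]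
    · change (R.translate _ (Γ.inv (R.incl r))).1 = Γ.mul _ (Γ.unit (X.p y.1))
      rw [R.coe_translate _ _ (by rw [Γ.tgt_unit, Γ.src_inv, hr])]
      change Γ.mul (Γ.unit (X.p x.1)) (Γ.inv (R.incl r)) = _
      rw [← hr, ← Γ.src_inv, Γ.unit_mul, R.incl_inv, h1, ← Γ.tgt_inv, Γ.mul_unit]

lemma exists_transportMk_eq (z : (X.transport R.resolution).Z) : ∃ x, X.transportMk R x = z := by
  obtain ⟨⟨⟨w, x⟩, h⟩, rfl⟩ := Quotient.exists_rep z
  obtain ⟨a, rfl⟩ := Quotient.exists_rep w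
  exact ⟨_, (X.transportMk_lact R a x h h).symm⟩

/-- A lift `(a, x)` to `Γ_L × X` can be replaced by the lift `a x` to `p⁻¹(L)`, so the smooth
structure is that of the quotient `R \ p⁻¹(L)`. -/
lemma transport_isPlot_iff {n : ℕ} {U : Opens (EuclideanSpace 𝕜 (Fin n))}
    {f : EuclideanSpace 𝕜 (Fin n) → (X.transport R.resolution).Z} :
    (X.transport R.resolution).str.IsPlot U f ↔ ∀ k ∈ U,
      ∃ ξ : EuclideanSpace 𝕜 (Fin n) → {x : X.X // X.p x ∈ R.base},
        SmoothNear 𝓘(𝕜, EuclideanSpace 𝕜 (Fin n)) X.X.I (fun y => (ξ y).1) k ∧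
        ∀ᶠ y in 𝓝 k, f y = X.transportMk R (ξ y) := by
  constructor
  · intro hf k hk
    obtain ⟨V, g, hkV, -, hg, hfg⟩ := hf k hk
    obtain ⟨a, ha, hga⟩ := R.resolution_isPlot_iff.mp hg.1 k hkV
    have hx : SmoothNear 𝓘(𝕜, EuclideanSpace 𝕜 (Fin n)) X.X.I (fun y => (g y).1.2) k :=
      ContMDiffOn.smoothNear hg.2 (V.isOpen.mem_nhds hkV)
    have hc : ∀ᶠ y in 𝓝 k, Γ.tgt (a y).1 = X.p (g y).1.2 := by
      filter_upwards [hga] with y hy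
      have h1 := (g y).2
      rw [hy] at h1
      exact h1
    have hξ : SmoothNear 𝓘(𝕜, EuclideanSpace 𝕜 (Fin n)) X.X.I
        (fun y => X.lact (a y).1 (g y).1.2) k :=
      X.contMDiffOn_lact.comp_smoothNear (ha.prodMk hx) hc
    obtain ⟨ξ, hξs, hξe⟩ := hξ.exists_subtype (P := fun x => X.p x ∈ R.base)
      (hc.mono fun y hy => by rw [X.p_lact _ _ hy]; exact (a y).2)
    refine ⟨ξ, hξs, ?_⟩
    filter_upwards [hξe, hga, hc, V.isOpen.eventually_mem hkV] with y h1 h2 h3 h4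
    rw [hfg y h4]
    have h5 : g y = ⟨(Quotient.mk R.leftOrbitRel (a y), (g y).1.2), h3⟩ :=
      Subtype.ext (Prod.ext h2 rfl)
    rw [h5, X.transportMk_lact R (a y) _ h3 h3]
    exact congrArg (X.transportMk R) (Subtype.ext h1.symm)
  · intro hf k hk
    obtain ⟨ξ, hξ, hfξ⟩ := hf k hk
    obtain ⟨V, hkV, hVU, hξV, hV⟩ := hξ.exists_opens hk hfξ
    refine ⟨V, fun y => ⟨(Quotient.mk R.leftOrbitRel ⟨Γ.unit (X.p (ξ y).1), by
      rw [Γ.src_unit]; exact (ξ y).2⟩, (ξ y).1), Γ.tgt_unit _⟩, hkV, hVU, ⟨?_, hξV⟩, hV⟩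
    refine R.resolution_isPlot_iff.mpr fun l hl => ⟨fun y => ⟨Γ.unit (X.p (ξ y).1), by
      rw [Γ.src_unit]; exact (ξ y).2⟩, ?_, Filter.Eventually.of_forall fun y => rfl⟩
    exact Γ.contMDiff_unit.comp_smoothNear (X.submersion_p.contMDiff.comp_smoothNear
      (hξV.smoothNear (V.isOpen.mem_nhds hl)))

/-! ### Isomorphisms of resolutions as relations -/

variable {R}

/-- The relation between `p⁻¹ L` and `Γ'_{L'}` corresponding to an isomorphism
between the transport of `Z(R)` and `Z(R')`. -/
structure IsResolutionRel (R : LieSubgroupoid Γ) (R' : LieSubgroupoid Γ')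
    (rel : X.X → Γ'.Arr → Prop) : Prop where
  p_mem : ∀ {x a}, rel x a → X.p x ∈ R.base
  src_mem : ∀ {x a}, rel x a → Γ'.src a ∈ R'.base
  tgt_eq : ∀ {x a}, rel x a → Γ'.tgt a = X.p' x
  -- The two lifting fields express smoothness of the bijection and of its inverse, and also, for `n
  -- = 0`, that each point and each arrow is related to something. The last four fields say that the
  -- relation descends to the quotients as a one-to-one correspondence.
  lift : ∀ {n : ℕ} {ξ : EuclideanSpace 𝕜 (Fin n) → X.X} {k : EuclideanSpace 𝕜 (Fin n)},
    SmoothNear 𝓘(𝕜, EuclideanSpace 𝕜 (Fin n)) X.X.I ξ k → (∀ᶠ y in 𝓝 k, X.p (ξ y) ∈ R.base) →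
    ∃ a, SmoothNear 𝓘(𝕜, EuclideanSpace 𝕜 (Fin n)) Γ'.Arr.I a k ∧ ∀ᶠ y in 𝓝 k, rel (ξ y) (a y)
  lift' : ∀ {n : ℕ} {a : EuclideanSpace 𝕜 (Fin n) → Γ'.Arr} {k : EuclideanSpace 𝕜 (Fin n)},
    SmoothNear 𝓘(𝕜, EuclideanSpace 𝕜 (Fin n)) Γ'.Arr.I a k →
    (∀ᶠ y in 𝓝 k, Γ'.src (a y) ∈ R'.base) →
    ∃ ξ, SmoothNear 𝓘(𝕜, EuclideanSpace 𝕜 (Fin n)) X.X.I ξ k ∧ ∀ᶠ y in 𝓝 k, rel (ξ y) (a y)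
  rel_mul : ∀ {x a r}, rel x a → Γ'.tgt (R'.incl r) = Γ'.src a → rel x (Γ'.mul (R'.incl r) a)
  rel_lact : ∀ {x a r}, rel x a → Γ.tgt (R.incl r) = X.p x → rel (X.lact (R.incl r) x) a
  exists_mul : ∀ {x a b}, rel x a → rel x b →
    ∃ r, Γ'.tgt (R'.incl r) = Γ'.src a ∧ b = Γ'.mul (R'.incl r) a
  exists_lact : ∀ {x y a}, rel x a → rel y a →
    ∃ r, Γ.tgt (R.incl r) = X.p x ∧ y = X.lact (R.incl r) x

variable {X} {R' : LieSubgroupoid Γ'}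

/-- The relation is the graph of the isomorphism `e`, pulled back to `p⁻¹(L) × Γ'_{L'}`. Smoothness
of `e` and of its inverse gives the two liftings, and injectivity gives `exists_lact`. -/
lemma exists_isResolutionRel (h : (X.transport R.resolution).Coincide R'.resolution) :
    ∃ rel, X.IsResolutionRel R R' rel := by
  obtain ⟨e, he, he', hφ⟩ := h
  refine ⟨fun x a => ∃ (hx : X.p x ∈ R.base) (ha : Γ'.src a ∈ R'.base),
    e (X.transportMk R ⟨x, hx⟩) = Quotient.mk R'.leftOrbitRel ⟨a, ha⟩,
    ?_, ?_, ?_, ?_, ?_, ?_, ?_, ?_, ?_⟩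
  · rintro x a ⟨hx, -, -⟩
    exact hx
  · rintro x a ⟨-, ha, -⟩
    exact ha
  · rintro x a ⟨hx, ha, h⟩
    have h1 := hφ (X.transportMk R ⟨x, hx⟩)
    rw [h] at h1
    exact h1
  · intro n ξ k hξ hk
    obtain ⟨ξ', hξ', hξe⟩ := hξ.exists_subtype (P := fun x => X.p x ∈ R.base) hk
    obtain ⟨V, hkV, -, hV, -⟩ := hξ'.exists_opens (Opens.mem_top k) (P := fun _ => True)
      (Filter.Eventually.of_forall fun _ => trivial)
    have h1 := he V (fun y => X.transportMk R (ξ' y)) ((X.transport_isPlot_iff R).mpr fun l hl =>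
      ⟨ξ', hV.smoothNear (V.isOpen.mem_nhds hl), Filter.Eventually.of_forall fun _ => rfl⟩)
    obtain ⟨a, ha, hea⟩ := R'.resolution_isPlot_iff.mp h1 k hkV
    refine ⟨_, ha, ?_⟩
    filter_upwards [hea, hξe] with y h2 h3
    refine ⟨by rw [← h3]; exact (ξ' y).2, (a y).2, ?_⟩
    rw [← h2]
    exact congrArg (fun z => e (X.transportMk R z)) (Subtype.ext h3.symm)
  · intro n a k ha hk
    obtain ⟨a', ha', hae⟩ := ha.exists_subtype (P := fun a => Γ'.src a ∈ R'.base) hk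
    obtain ⟨V, hkV, -, hV, -⟩ := ha'.exists_opens (Opens.mem_top k) (P := fun _ => True)
      (Filter.Eventually.of_forall fun _ => trivial)
    have h1 := he' V (fun y => Quotient.mk R'.leftOrbitRel (a' y))
      (R'.resolution_isPlot_iff.mpr fun l hl =>
        ⟨a', hV.smoothNear (V.isOpen.mem_nhds hl), Filter.Eventually.of_forall fun _ => rfl⟩)
    obtain ⟨ξ, hξ, heξ⟩ := (X.transport_isPlot_iff R).mp h1 k hkV
    refine ⟨_, hξ, ?_⟩
    filter_upwards [heξ, hae] with y h2 h3
    refine ⟨(ξ y).2, by rw [← h3]; exact (a' y).2, ?_⟩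
    rw [← h2]
    exact (e.apply_symm_apply _).trans (congrArg (Quotient.mk R'.leftOrbitRel) (Subtype.ext h3))
  · rintro x a r ⟨hx, ha, h⟩ hr
    refine ⟨hx, by rw [Γ'.src_mul _ _ hr, R'.src_incl]; exact mem_range_self _, ?_⟩
    rw [h]
    exact Quotient.sound ⟨r, hr, rfl⟩
  · rintro x a r ⟨hx, ha, h⟩ hr
    refine ⟨by rw [X.p_lact _ _ hr, R.src_incl]; exact mem_range_self _, ha, ?_⟩
    rw [← h]
    exact congrArg e (((X.transportMk_eq_iff R).mpr ⟨r, hr, rfl⟩).symm)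
  · rintro x a b ⟨hx, ha, h⟩ ⟨hx', hb, h'⟩
    exact Quotient.exact (h.symm.trans h')
  · rintro x y a ⟨hx, ha, h⟩ ⟨hy, ha', h'⟩
    exact (X.transportMk_eq_iff R).mp (e.injective (h.trans h'.symm))

/-- The relation descends to the graph `Q` of a bijection of the quotients. Its smoothness in both
directions is the lifting of plots. -/
lemma IsResolutionRel.coincide {rel : X.X → Γ'.Arr → Prop} (H : X.IsResolutionRel R R' rel) :
    (X.transport R.resolution).Coincide R'.resolution := by
  let Q : (X.transport R.resolution).Z → R'.resolution.Z → Prop := fun z w =>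
    ∃ x a, rel x.1 a.1 ∧ X.transportMk R x = z ∧ Quotient.mk R'.leftOrbitRel a = w
  have hQ : ∀ z, ∃ w, Q z w := by
    intro z
    obtain ⟨x, rfl⟩ := X.exists_transportMk_eq R z
    -- Lifting a plot of dimension `0` yields an arrow related to the given point.
    obtain ⟨a, -, ha⟩ := H.lift (n := 0) (k := 0) (smoothNear_const x.1)
      (Filter.Eventually.of_forall fun _ => x.2)
    exact ⟨_, x, ⟨a 0, H.src_mem ha.self_of_nhds⟩, ha.self_of_nhds, rfl, rfl⟩
  have hQ' : ∀ w, ∃ z, Q z w := by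
    intro w
    obtain ⟨a, rfl⟩ := Quotient.exists_rep w
    obtain ⟨x, -, hx⟩ := H.lift' (n := 0) (k := 0) (smoothNear_const a.1)
      (Filter.Eventually.of_forall fun _ => a.2)
    exact ⟨_, ⟨x 0, H.p_mem hx.self_of_nhds⟩, a, hx.self_of_nhds, rfl, rfl⟩
  have hu : ∀ {z w w'}, Q z w → Q z w' → w = w' := by
    rintro z w w' ⟨x, a, hxa, rfl, rfl⟩ ⟨y, b, hyb, hxy, rfl⟩
    obtain ⟨r, hr, hy⟩ := (X.transportMk_eq_iff R).mp hxy
    obtain ⟨r', hr', h⟩ := H.exists_mul (hy ▸ H.rel_lact hyb hr) hxa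
    exact (Quotient.sound ⟨r', hr', h⟩ : Quotient.mk R'.leftOrbitRel b = _).symm
  have hu' : ∀ {z z' w}, Q z w → Q z' w → z = z' := by
    rintro z z' w ⟨x, a, hxa, rfl, rfl⟩ ⟨y, b, hyb, rfl, hab⟩
    obtain ⟨r, hr, ha⟩ := Quotient.exact hab
    have h1 : rel y.1 a.1 := by
      have := H.rel_mul hyb hr
      rwa [← ha] at this
    exact (X.transportMk_eq_iff R).mpr (H.exists_lact hxa h1)
  choose F hF using hQ
  choose G hG using hQ'
  refine ⟨⟨F, G, fun z => hu' (hG _) (hF z), fun w => hu (hF _) (hG w)⟩, ?_, ?_, ?_⟩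
  · intro n U f hf
    refine R'.resolution_isPlot_iff.mpr fun k hk => ?_
    obtain ⟨ξ, hξ, hfξ⟩ := (X.transport_isPlot_iff R).mp hf k hk
    obtain ⟨a, ha, hra⟩ := H.lift hξ (Filter.Eventually.of_forall fun y => (ξ y).2)
    obtain ⟨a', ha', hae⟩ := ha.exists_subtype (P := fun a => Γ'.src a ∈ R'.base)
      (hra.mono fun y hy => H.src_mem hy)
    refine ⟨a', ha', ?_⟩
    filter_upwards [hfξ, hra, hae] with y h1 h2 h3
    exact hu (hF _) ⟨ξ y, a' y, h3 ▸ h2, h1.symm, rfl⟩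
  · intro n U f hf
    refine (X.transport_isPlot_iff R).mpr fun k hk => ?_
    obtain ⟨a, ha, hfa⟩ := R'.resolution_isPlot_iff.mp hf k hk
    obtain ⟨ξ, hξ, hrξ⟩ := H.lift' ha (Filter.Eventually.of_forall fun y => (a y).2)
    obtain ⟨ξ', hξ', hξe⟩ := hξ.exists_subtype (P := fun x => X.p x ∈ R.base)
      (hrξ.mono fun y hy => H.p_mem hy)
    refine ⟨ξ', hξ', ?_⟩
    filter_upwards [hfa, hrξ, hξe] with y h1 h2 h3
    exact hu' (hG _) ⟨ξ' y, a y, h3 ▸ h2, rfl, h1.symm⟩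
  · intro z
    obtain ⟨x, a, hxa, h1, h2⟩ := hF z
    change R'.resolution.φ (F z) = _
    rw [← h2, ← h1]
    exact H.tgt_eq hxa

end LieMorita

/-! ### Parametrizations by products, and corestriction to embedded submanifolds -/

section

variable {𝕜 : Type v} [RCLike 𝕜]

/-- Germs of mutually inverse smooth maps between `N × F` and `Y ⊆ X` give a parametrization. -/
lemma SmoothMfd.Parametrization.nonempty_of_prod {X N : SmoothMfd.{u} 𝕜} {Y : Set X} {y : X}
    {F : Type*} [NormedAddCommGroup F] [NormedSpace 𝕜 F] [FiniteDimensional 𝕜 F]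
    (c : N × F → X) (r : X → N × F)
    (hc : SmoothNear (N.I.prod 𝓘(𝕜, F)) X.I c (r y))
    (hr : SmoothNear X.I (N.I.prod 𝓘(𝕜, F)) r y)
    (hcY : ∀ᶠ w in 𝓝 (r y), c w ∈ Y) (hrc : ∀ᶠ w in 𝓝 (r y), r (c w) = w)
    (hcr : ∀ᶠ z in 𝓝 y, z ∈ Y → c (r z) = z) :
    Nonempty (SmoothMfd.Parametrization X Y (N.dim + Module.finrank 𝕜 F) y) := by
  let A : EuclideanSpace 𝕜 (Fin (N.dim + Module.finrank 𝕜 F)) ≃L[𝕜] N.Model × F :=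
    ContinuousLinearEquiv.ofFinrankEq (by simp)
  let φ := extChartAt N.I (r y).1
  let B : EuclideanSpace 𝕜 (Fin (N.dim + Module.finrank 𝕜 F)) → N × F := fun v =>
    (φ.symm (A v).1, (A v).2)
  let B' : N × F → EuclideanSpace 𝕜 (Fin (N.dim + Module.finrank 𝕜 F)) := fun q =>
    A.symm (φ q.1, q.2)
  have hB'0 : B (B' (r y)) = r y := by
    simp only [B, B', ContinuousLinearEquiv.apply_symm_apply]
    exact Prod.ext (extChartAt_to_inv (r y).1) rfl
  have hA1 : ContDiff 𝕜 ∞ fun v => (A v).1 := contDiff_fst.comp A.contDiff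
  have hA2 : ContDiff 𝕜 ∞ fun v => (A v).2 := contDiff_snd.comp A.contDiff
  have hB : SmoothNear 𝓘(𝕜, EuclideanSpace 𝕜 (Fin (N.dim + Module.finrank 𝕜 F)))
      (N.I.prod 𝓘(𝕜, F)) B (B' (r y)) := by
    refine SmoothNear.prodMk ?_ hA2.contMDiff.smoothNear
    refine smoothNear_extChartAt_symm.comp_of_eq hA1.contMDiff.smoothNear ?_
    simp only [B', ContinuousLinearEquiv.apply_symm_apply, φ]
  have hB' : SmoothNear (N.I.prod 𝓘(𝕜, F))
      𝓘(𝕜, EuclideanSpace 𝕜 (Fin (N.dim + Module.finrank 𝕜 F))) B' (r y) := by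
    have h1 : ContDiff 𝕜 ∞ fun v : F => A.symm (0, v) :=
      A.symm.contDiff.comp (contDiff_const.prodMk contDiff_id)
    have h2 : ContDiff 𝕜 ∞ fun v : N.Model => A.symm (v, 0) :=
      A.symm.contDiff.comp (contDiff_id.prodMk contDiff_const)
    have h3 : SmoothNear (N.I.prod 𝓘(𝕜, F))
        𝓘(𝕜, EuclideanSpace 𝕜 (Fin (N.dim + Module.finrank 𝕜 F)))
        (fun q => A.symm (φ q.1, 0)) (r y) :=
      h2.contMDiff.comp_smoothNear ((smoothNear_extChartAt (I₁ := N.I)).comp_of_eq smoothNear_fst rfl)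
    have h4 : SmoothNear (N.I.prod 𝓘(𝕜, F))
        𝓘(𝕜, EuclideanSpace 𝕜 (Fin (N.dim + Module.finrank 𝕜 F)))
        (fun q => A.symm (0, q.2)) (r y) := h1.contMDiff.comp_smoothNear smoothNear_snd
    filter_upwards [h3, h4] with q h5 h6
    refine (h5.add h6).congr_of_eventuallyEq (Filter.Eventually.of_forall fun p => ?_)
    simp only [B', Pi.add_apply, ← map_add, Prod.mk_add_mk, add_zero, zero_add]
  have hBt : Filter.Tendsto B (𝓝 (B' (r y))) (𝓝 (r y)) := by
    have := hB.continuousAt.tendsto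
    rwa [hB'0] at this
  refine nonempty_of_eventually (fun v => c (B v)) (fun z => B' (r z)) (hc.comp_of_eq hB hB'0)
    (hB'.comp hr) (hBt.eventually hcY) ?_ ?_
  · have h1 : ∀ᶠ v in 𝓝 (B' (r y)), φ (φ.symm (A v).1) = (A v).1 := by
      have h2 : Filter.Tendsto (fun v => (A v).1) (𝓝 (B' (r y))) (𝓝 (φ (r y).1)) := by
        have := hA1.continuous.tendsto (B' (r y))
        simpa only [B', ContinuousLinearEquiv.apply_symm_apply] using this
      exact h2.eventually eventually_extChartAt_extChartAt_symm
    filter_upwards [h1, hBt.eventually hrc] with v h2 h3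
    rw [h3]
    simp only [B, B', h2]
    exact A.symm_apply_apply v
  · have h1 : ∀ᶠ z in 𝓝 y, φ.symm (φ (r z).1) = (r z).1 :=
      (continuousAt_fst.comp hr.continuousAt).eventually
        (eventually_extChartAt_symm_extChartAt (I₁ := N.I))
    filter_upwards [h1, hcr] with z h2 h3 hz
    have h4 : B (B' (r z)) = r z := by
      simp only [B, B', ContinuousLinearEquiv.apply_symm_apply, h2]
    simp only [h4, h3 hz]

/-- A map into an embedded manifold is smooth on a set if it is smooth as a map into the ambient
manifold. -/
lemma SmoothMfd.contMDiffOn_of_comp_isSmoothEmbedding {E₁ H₁ K : Type*} [NormedAddCommGroup E₁]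
    [NormedSpace 𝕜 E₁] [TopologicalSpace H₁] [TopologicalSpace K] [ChartedSpace H₁ K]
    {J : ModelWithCorners 𝕜 E₁ H₁} {M N : SmoothMfd.{u} 𝕜} {i : M → N}
    (hi : IsSmoothEmbedding M.I N.I ∞ i) {f : K → N} {g : K → M} {s : Set K}
    (hf : ContMDiffOn J N.I ∞ f s) (hg : ∀ y ∈ s, i (g y) = f y) : ContMDiffOn J M.I ∞ g s := by
  intro k hk
  have hgc : ContinuousWithinAt g s k := by
    rw [hi.isEmbedding.isInducing.continuousWithinAt_iff]
    exact (hf k hk).continuousWithinAt.congr hg (hg k hk)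
  obtain ⟨r, hr, hri⟩ := SmoothMfd.exists_leftInverse_of_isImmersion hi.isImmersion (g k)
  rw [hg k hk] at hr
  have h1 : ContMDiffWithinAt J M.I ∞ (fun y => r (f y)) s k :=
    hr.contMDiffAt.comp_contMDiffWithinAt k (hf k hk)
  have h2 : ∀ᶠ y in 𝓝[s] k, g y = r (f y) := by
    filter_upwards [hgc.eventually hri, self_mem_nhdsWithin] with y h3 h4
    rw [← hg y h4, h3]
  exact h1.congr_of_eventuallyEq h2 (h2.self_of_nhdsWithin hk)

end

/-! ### Closed and full subgroupoids -/

namespace LieSubgroupoid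

variable {𝕜 : Type v} [RCLike 𝕜] {Γ : LieGroupoid.{u} 𝕜} {R : LieSubgroupoid Γ}

/-- `R` is the trace on `Γ_L^L` of a closed subset `T` of `Γ`, and membership in `T` passes to
limits. -/
lemma mem_arrows_of_frequently (hR : R.IsClosedSubgroupoid) {K : Type*} [TopologicalSpace K]
    {d : K → Γ.Arr} {k : K} (hd : ContinuousAt d k)
    (h : ∀ᶠ n in 𝓝 k, Γ.src (d n) ∈ R.base ∧ Γ.tgt (d n) ∈ R.base)
    (hf : ∃ᶠ n in 𝓝 k, d n ∈ R.arrows) : d k ∈ R.arrows := by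
  obtain ⟨T, hT, hTR⟩ := isClosed_induced_iff.mp hR
  have hTR : ∀ g, Γ.src g ∈ R.base ∧ Γ.tgt g ∈ R.base → (g ∈ T ↔ g ∈ R.arrows) := fun g hg =>
    Set.ext_iff.mp hTR ⟨g, hg⟩
  rw [← hTR _ h.self_of_nhds]
  refine hT.mem_of_frequently_of_tendsto ?_ hd
  exact (hf.and_eventually h).mono fun n hn => (hTR _ hn.2).mpr hn.1

end LieSubgroupoid

namespace LieMorita

variable {𝕜 : Type v} [RCLike 𝕜] {Γ Γ' : LieGroupoid.{u} 𝕜} {X : LieMorita Γ Γ'}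

/-- Two points of `X` with the same image under `p'` differ by an arrow of `Γ`, which cannot leave
the stable set `S`. -/
lemma p'_mem_image_iff {S : Set Γ.Obj} (hS : Γ.IsStable S) (x : X.X) :
    X.p' x ∈ X.image S ↔ X.p x ∈ S := by
  refine ⟨?_, fun h => ⟨x, h, rfl⟩⟩
  rintro ⟨y, hy, hxy⟩
  obtain ⟨g, hg, rfl⟩ := X.lact_transitive x y hxy.symm
  rw [← hg, hS g, ← X.p_lact _ _ hg]
  exact hy

lemma isStable_image {S : Set Γ.Obj} (hS : Γ.IsStable S) : Γ'.IsStable (X.image S) := by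
  intro g
  obtain ⟨x, hx⟩ := X.surjective_p' (Γ'.src g)
  rw [← hx, ← X.p'_ract _ _ hx, p'_mem_image_iff hS, p'_mem_image_iff hS, X.p_ract _ _ hx]

variable {R : LieSubgroupoid Γ} {R' : LieSubgroupoid Γ'} {S : Set Γ.Obj}

/-- A continuous family of arrows between points of `L'`, parametrized by `L`, consists of arrows
of `R'` if it does so over `L ∩ S`. -/
lemma mem_arrows_of_isFullIn (hS : Γ.IsStable S) (hR : R.IsFullIn S)
    (hR'c : R'.IsClosedSubgroupoid) (hR' : R'.IsFullIn (X.image S)) {d : R.R.Obj → Γ'.Arr}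
    {l₀ : R.R.Obj} (hd : ContinuousAt d l₀)
    (h : ∀ᶠ l in 𝓝 l₀, Γ'.src (d l) ∈ R'.base ∧ Γ'.tgt (d l) ∈ R'.base)
    (hs : ∀ᶠ l in 𝓝 l₀, R.inclObj l ∈ S → Γ'.src (d l) ∈ X.image S) : d l₀ ∈ R'.arrows := by
  refine R'.mem_arrows_of_frequently hR'c hd h ?_
  -- Density of `L ∩ S` in `L` provides points of `S` arbitrarily close to `l₀`. At these, fullness
  -- of `R'` applies, because both ends of the arrow lie in `L'` and in the stable set corresponding
  -- to `S`.
  refine ((mem_closure_iff_frequently.mp (hR.dense l₀)).and_eventually (h.and hs)).mono ?_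
  rintro l ⟨hl, ⟨h1, h2⟩, h3⟩
  exact hR'.full _ ⟨h1, h3 hl⟩ ⟨h2, (isStable_image hS _).mpr (h3 hl)⟩

/-! ### Automatic equivariance of isomorphisms of resolutions -/

namespace IsResolutionRel

variable {rel : X.X → Γ'.Arr → Prop}

/-- Points over `L` have related arrows, depending smoothly on the point. -/
lemma lift_mfd (H : X.IsResolutionRel R R' rel) {N : SmoothMfd.{u} 𝕜} {ξ : N → X.X} {k : N}
    (hξ : SmoothNear N.I X.X.I ξ k) (hk : ∀ᶠ y in 𝓝 k, X.p (ξ y) ∈ R.base) :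
    ∃ a, SmoothNear N.I Γ'.Arr.I a k ∧ ∀ᶠ y in 𝓝 k, rel (ξ y) (a y) := by
  have h0 : (extChartAt N.I k).symm (extChartAt N.I k k) = k := extChartAt_to_inv k
  have h1 : SmoothNear 𝓘(𝕜, N.Model) N.I (extChartAt N.I k).symm (extChartAt N.I k k) :=
    smoothNear_extChartAt_symm
  have h2 := h1.continuousAt.tendsto
  rw [h0] at h2
  obtain ⟨a, ha, hra⟩ := H.lift (hξ.comp_of_eq h1 h0) (h2.eventually hk)
  refine ⟨fun y => a (extChartAt N.I k y), ha.comp smoothNear_extChartAt, ?_⟩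
  filter_upwards [(smoothNear_extChartAt (I₁ := N.I)).continuousAt.eventually hra,
    eventually_extChartAt_symm_extChartAt (I₁ := N.I) (x := k)] with y h3 h4
  rwa [h4] at h3

/-- Arrows with source in `L'` have related points, depending smoothly on the arrow. -/
lemma lift'_mfd (H : X.IsResolutionRel R R' rel) {N : SmoothMfd.{u} 𝕜} {a : N → Γ'.Arr} {k : N}
    (ha : SmoothNear N.I Γ'.Arr.I a k) (hk : ∀ᶠ y in 𝓝 k, Γ'.src (a y) ∈ R'.base) :
    ∃ ξ, SmoothNear N.I X.X.I ξ k ∧ ∀ᶠ y in 𝓝 k, rel (ξ y) (a y) := by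
  have h0 : (extChartAt N.I k).symm (extChartAt N.I k k) = k := extChartAt_to_inv k
  have h1 : SmoothNear 𝓘(𝕜, N.Model) N.I (extChartAt N.I k).symm (extChartAt N.I k k) :=
    smoothNear_extChartAt_symm
  have h2 := h1.continuousAt.tendsto
  rw [h0] at h2
  obtain ⟨ξ, hξ, hrξ⟩ := H.lift' (ha.comp_of_eq h1 h0) (h2.eventually hk)
  refine ⟨fun y => ξ (extChartAt N.I k y), hξ.comp smoothNear_extChartAt, ?_⟩
  filter_upwards [(smoothNear_extChartAt (I₁ := N.I)).continuousAt.eventually hrξ,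
    eventually_extChartAt_symm_extChartAt (I₁ := N.I) (x := k)] with y h3 h4
  rwa [h4] at h3

/-- The relation is compatible with the right action of `Γ'`. -/
lemma rel_ract (H : X.IsResolutionRel R R' rel) (hS : Γ.IsStable S) (hR : R.IsFullIn S)
    (hR'c : R'.IsClosedSubgroupoid) (hR' : R'.IsFullIn (X.image S)) {x : X.X} {a g : Γ'.Arr}
    (h : rel x a) (hg : X.p' x = Γ'.src g) : rel (X.ract x g) (Γ'.mul a g) := by
  obtain ⟨l₀, hl₀⟩ := H.p_mem h
  obtain ⟨s, hs, hsx, hps⟩ := SmoothMfd.exists_section_of_isSubmersion X.submersion_p x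
  obtain ⟨b, hb, hbg, hsb⟩ := SmoothMfd.exists_section_of_isSubmersion Γ'.submersion_src g
  rw [← hg] at hb hbg hsb
  rw [← hl₀] at hs hsx hps
  have hi : SmoothNear R.R.Obj.I Γ.Obj.I R.inclObj l₀ :=
    R.embedding_inclObj.isImmersion.contMDiff.smoothNear
  -- The point `x` and the arrow `g` are extended to smooth families `ξ` and `G` along `L`, so that
  -- density of `L ∩ S` can be used.
  let ξ : R.R.Obj → X.X := fun l => s (R.inclObj l)
  have hξ : SmoothNear R.R.Obj.I X.X.I ξ l₀ := hs.comp hi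
  have hξ0 : ξ l₀ = x := hsx
  have hpξ : ∀ᶠ l in 𝓝 l₀, X.p (ξ l) = R.inclObj l := hi.continuousAt.eventually hps
  let G : R.R.Obj → Γ'.Arr := fun l => b (X.p' (ξ l))
  have hp'ξ : SmoothNear R.R.Obj.I Γ'.Obj.I (fun l => X.p' (ξ l)) l₀ :=
    X.submersion_p'.contMDiff.comp_smoothNear hξ
  have hp'0 : X.p' (ξ l₀) = X.p' x := by rw [hξ0]
  have hG : SmoothNear R.R.Obj.I Γ'.Arr.I G l₀ := hb.comp_of_eq hp'ξ hp'0
  have hG0 : G l₀ = g := by simp only [G, hp'0, hbg]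
  have hGs : ∀ᶠ l in 𝓝 l₀, X.p' (ξ l) = Γ'.src (G l) := by
    have h1 := hp'ξ.continuousAt.tendsto
    rw [hp'0] at h1
    exact (h1.eventually hsb).mono fun l hl => hl.symm
  have hξG : SmoothNear R.R.Obj.I X.X.I (fun l => X.ract (ξ l) (G l)) l₀ :=
    X.contMDiffOn_ract.comp_smoothNear (hξ.prodMk hG) hGs
  obtain ⟨α, hα, hrα⟩ := H.lift_mfd hξ (hpξ.mono fun l hl => ⟨l, hl.symm⟩)
  obtain ⟨β, hβ, hrβ⟩ := H.lift_mfd hξG (by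
    filter_upwards [hpξ, hGs] with l h1 h2
    rw [X.p_ract _ _ h2, h1]
    exact mem_range_self l)
  have hαG : ∀ᶠ l in 𝓝 l₀, Γ'.tgt (α l) = Γ'.src (G l) := by
    filter_upwards [hrα, hGs] with l h1 h2
    rw [H.tgt_eq h1, h2]
  have hβG : ∀ᶠ l in 𝓝 l₀, Γ'.tgt (β l) = Γ'.tgt (Γ'.mul (α l) (G l)) := by
    filter_upwards [hrβ, hGs, hαG] with l h1 h2 h3
    rw [H.tgt_eq h1, Γ'.tgt_mul _ _ h3, X.p'_ract _ _ h2]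
  -- The defect of equivariance: an arrow from the source of `β` to that of `α`, both in `L'`.
  -- Equivariance means that it belongs to `R'`.
  let d : R.R.Obj → Γ'.Arr := fun l => Γ'.mul (β l) (Γ'.inv (Γ'.mul (α l) (G l)))
  have hd : SmoothNear R.R.Obj.I Γ'.Arr.I d l₀ := by
    refine Γ'.contMDiffOn_mul.comp_smoothNear (hβ.prodMk (Γ'.contMDiff_inv.comp_smoothNear
      (Γ'.contMDiffOn_mul.comp_smoothNear (hα.prodMk hG) hαG))) (hβG.mono fun l hl => ?_)
    exact hl.trans (Γ'.src_inv _).symm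
  have hdm : d l₀ ∈ R'.arrows := by
    refine mem_arrows_of_isFullIn hS hR hR'c hR' hd.continuousAt ?_ ?_
    · filter_upwards [hrα, hrβ, hαG, hβG] with l h1 h2 h3 h4
      have h5 : Γ'.tgt (β l) = Γ'.src (Γ'.inv (Γ'.mul (α l) (G l))) := by rw [Γ'.src_inv, h4]
      rw [Γ'.src_mul _ _ h5, Γ'.tgt_mul _ _ h5, Γ'.tgt_inv, Γ'.src_mul _ _ h3]
      exact ⟨H.src_mem h2, H.src_mem h1⟩
    · filter_upwards [hrβ, hβG, hGs, hpξ] with l h2 h4 h5 h6 hl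
      rw [Γ'.src_mul _ _ (by rw [Γ'.src_inv, h4]), ← isStable_image hS, H.tgt_eq h2,
        p'_mem_image_iff hS, X.p_ract _ _ h5, h6]
      exact hl
  obtain ⟨r, hr⟩ := hdm
  have h1 : rel x (α l₀) := hξ0 ▸ hrα.self_of_nhds
  have h2 : rel (X.ract x g) (β l₀) := by
    have := hrβ.self_of_nhds
    rwa [hξ0, hG0] at this
  have h3 : Γ'.tgt (α l₀) = Γ'.src g := hG0 ▸ hαG.self_of_nhds
  have h4 : Γ'.tgt (β l₀) = Γ'.tgt (Γ'.mul (α l₀) g) := hG0 ▸ hβG.self_of_nhds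
  have hr : R'.incl r = Γ'.mul (β l₀) (Γ'.inv (Γ'.mul (α l₀) g)) := by
    rw [hr]
    simp only [d, hG0]
  have h5 : Γ'.tgt (β l₀) = Γ'.src (Γ'.inv (Γ'.mul (α l₀) g)) := by rw [Γ'.src_inv, h4]
  have h6 : Γ'.tgt (R'.incl r) = Γ'.src (Γ'.mul (α l₀) g) := by
    rw [hr, Γ'.tgt_mul _ _ h5, Γ'.tgt_inv]
  have h7 : Γ'.mul (R'.incl r) (Γ'.mul (α l₀) g) = β l₀ := by
    rw [hr, Γ'.mul_assoc _ _ _ h5 (Γ'.tgt_inv _), Γ'.inv_mul, ← h4, Γ'.mul_unit]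
  -- As `β` is related to `x g` and differs from `α g` by an arrow of `R'`, the arrow `α g` is
  -- related to `x g` too.
  have h8 : rel (X.ract x g) (Γ'.mul (α l₀) g) := by
    rw [← Γ'.inv_mul_cancel_left _ _ h6, h7, ← R'.incl_inv]
    refine H.rel_mul h2 ?_
    rw [R'.incl_inv, Γ'.tgt_inv, ← h7, Γ'.src_mul _ _ h6]
  -- The lift `α` need not pass through `a`; the two arrows differ by an arrow of `R'`, which the
  -- relation absorbs.
  obtain ⟨r', hr', rfl⟩ := H.exists_mul h1 h
  rw [Γ'.mul_assoc _ _ _ hr' h3]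
  exact H.rel_mul h8 (by rw [Γ'.src_mul _ _ h3, hr'])

end IsResolutionRel

end LieMorita

/-! ### Subbimodules -/

namespace LieMorita

variable {𝕜 : Type v} [RCLike 𝕜] {Γ Γ' : LieGroupoid.{u} 𝕜} (X : LieMorita Γ Γ')

/-- A subset of `X` that is a principal bimodule over `R` and `R'` with smooth local sections. -/
structure IsSubbimodule (R : LieSubgroupoid Γ) (R' : LieSubgroupoid Γ') (Y : Set X.X) : Prop where
  p_mem : ∀ x ∈ Y, X.p x ∈ R.base
  p'_mem : ∀ x ∈ Y, X.p' x ∈ R'.base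
  lact_mem : ∀ x ∈ Y, ∀ r, Γ.tgt (R.incl r) = X.p x → X.lact (R.incl r) x ∈ Y
  ract_mem : ∀ x ∈ Y, ∀ r, X.p' x = Γ'.src (R'.incl r) → X.ract x (R'.incl r) ∈ Y
  exists_lact : ∀ x ∈ Y, ∀ y ∈ Y, X.p' x = X.p' y →
    ∃ r, Γ.tgt (R.incl r) = X.p x ∧ X.lact (R.incl r) x = y
  exists_ract : ∀ x ∈ Y, ∀ y ∈ Y, X.p x = X.p y →
    ∃ r, X.p' x = Γ'.src (R'.incl r) ∧ X.ract x (R'.incl r) = y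
  exists_section : ∀ l₀, ∃ σ : R.R.Obj → X.X, SmoothNear R.R.Obj.I X.X.I σ l₀ ∧
    ∀ᶠ l in 𝓝 l₀, σ l ∈ Y ∧ X.p (σ l) = R.inclObj l
  exists_section' : ∀ l₀, ∃ σ : R'.R.Obj → X.X, SmoothNear R'.R.Obj.I X.X.I σ l₀ ∧
    ∀ᶠ l in 𝓝 l₀, σ l ∈ Y ∧ X.p' (σ l) = R'.inclObj l

variable {X} {R : LieSubgroupoid Γ} {R' : LieSubgroupoid Γ'}

/-- Through equivariance the whole relation is recovered from the points related to units: `x` is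
related to `a` if and only if `x a⁻¹` is such a point. -/
lemma IsResolutionRel.isSubbimodule {S : Set Γ.Obj} {rel : X.X → Γ'.Arr → Prop}
    (H : X.IsResolutionRel R R' rel) (hS : Γ.IsStable S) (hR : R.IsFullIn S)
    (hR'c : R'.IsClosedSubgroupoid) (hR' : R'.IsFullIn (X.image S)) :
    X.IsSubbimodule R R' {x | rel x (Γ'.unit (X.p' x))} := by
  have hdiv : ∀ {x a}, rel x a → rel (X.ract x (Γ'.inv a)) (Γ'.unit (X.p' (X.ract x (Γ'.inv a)))) ∧
      X.p' x = Γ'.src (Γ'.inv a) := by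
    intro x a h
    have h1 : X.p' x = Γ'.src (Γ'.inv a) := by rw [Γ'.src_inv, H.tgt_eq h]
    refine ⟨?_, h1⟩
    rw [X.p'_ract _ _ h1, Γ'.tgt_inv, ← Γ'.mul_inv]
    exact H.rel_ract hS hR hR'c hR' h h1
  refine ⟨fun x hx => H.p_mem hx, fun x hx => ?_, fun x hx r hr => ?_, fun x hx r hr => ?_,
    fun x hx y hy hxy => ?_, fun x hx y hy hxy => ?_, fun l₀ => ?_, fun l₀ => ?_⟩
  · have := H.src_mem hx
    rwa [Γ'.src_unit] at this
  · change rel _ (Γ'.unit _)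
    rw [X.p'_lact _ _ hr]
    exact H.rel_lact hx hr
  · change rel _ (Γ'.unit _)
    have h1 := H.rel_ract hS hR hR'c hR' hx hr
    rw [hr, Γ'.unit_mul] at h1
    rw [X.p'_ract _ _ hr, ← Γ'.inv_mul, ← R'.incl_inv]
    exact H.rel_mul h1 (by rw [R'.incl_inv, Γ'.tgt_inv])
  · have hx : rel x (Γ'.unit (X.p' x)) := hx
    have hy : rel y (Γ'.unit (X.p' y)) := hy
    rw [← hxy] at hy
    obtain ⟨r, hr, h⟩ := H.exists_lact hx hy
    exact ⟨r, hr, h.symm⟩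
  · have hx : rel x (Γ'.unit (X.p' x)) := hx
    obtain ⟨g, hg, rfl⟩ := X.ract_transitive x y hxy
    have hy : rel _ (Γ'.unit _) := hy
    have h1 := H.rel_ract hS hR hR'c hR' hx hg
    -- Both `g` and a unit are related to `x g`, so `g` lies in `R'`.
    rw [hg, Γ'.unit_mul] at h1
    obtain ⟨r, hr, h⟩ := H.exists_mul hy h1
    rw [Γ'.src_unit] at hr
    rw [← hr, Γ'.mul_unit] at h
    exact ⟨r, h ▸ hg, by rw [h]⟩
  · obtain ⟨x, hx⟩ := X.surjective_p (R.inclObj l₀)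
    obtain ⟨s, hs, hsx, hps⟩ := SmoothMfd.exists_section_of_isSubmersion X.submersion_p x
    rw [hx] at hs hsx hps
    have hi : SmoothNear R.R.Obj.I Γ.Obj.I R.inclObj l₀ :=
      R.embedding_inclObj.isImmersion.contMDiff.smoothNear
    have hpξ : ∀ᶠ l in 𝓝 l₀, X.p (s (R.inclObj l)) = R.inclObj l := hi.continuousAt.eventually hps
    obtain ⟨a, ha, hra⟩ := H.lift_mfd (hs.comp hi) (hpξ.mono fun l hl => ⟨l, hl.symm⟩)
    -- An arbitrary section of `p` along `L`, corrected by the inverse of a smooth family of related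
    -- arrows, takes values in the subbimodule.
    refine ⟨fun l => X.ract (s (R.inclObj l)) (Γ'.inv (a l)),
      X.contMDiffOn_ract.comp_smoothNear ((hs.comp hi).prodMk
        (Γ'.contMDiff_inv.comp_smoothNear ha)) (hra.mono fun l hl => (hdiv hl).2), ?_⟩
    filter_upwards [hra, hpξ] with l h1 h2
    exact ⟨(hdiv h1).1, by rw [X.p_ract _ _ (hdiv h1).2, h2]⟩
  · have hi : ContMDiff R'.R.Obj.I Γ'.Obj.I ∞ R'.inclObj :=
      R'.embedding_inclObj.isImmersion.contMDiff
    -- Over `L'` no correction is needed: a smooth family of points related to the units is already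
    -- a section.
    obtain ⟨ζ, hζ, hrζ⟩ := H.lift'_mfd (k := l₀)
      (Γ'.contMDiff_unit.comp_smoothNear hi.smoothNear)
      (Filter.Eventually.of_forall fun l => by rw [Γ'.src_unit]; exact mem_range_self l)
    refine ⟨ζ, hζ, hrζ.mono fun l hl => ?_⟩
    have h1 := H.tgt_eq hl
    rw [Γ'.tgt_unit] at h1
    refine ⟨?_, h1.symm⟩
    change rel _ (Γ'.unit _)
    rwa [← h1]

namespace IsSubbimodule

variable {Y : Set X.X}

/-- The value at `l₀` of any section with values in `Y` differs from `y₀` by an arrow of `R'`. This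
arrow extends to a smooth family in `R'`, by which the section is multiplied. -/
lemma exists_section_eq (H : X.IsSubbimodule R R' Y) {y₀ : X.X} (hy₀ : y₀ ∈ Y) {l₀ : R.R.Obj}
    (hl₀ : X.p y₀ = R.inclObj l₀) : ∃ σ : R.R.Obj → X.X, SmoothNear R.R.Obj.I X.X.I σ l₀ ∧
      σ l₀ = y₀ ∧ ∀ᶠ l in 𝓝 l₀, σ l ∈ Y ∧ X.p (σ l) = R.inclObj l := by
  obtain ⟨σ, hσ, hσY⟩ := H.exists_section l₀
  obtain ⟨h1, h2⟩ := hσY.self_of_nhds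
  obtain ⟨r, hr, hry⟩ := H.exists_ract _ h1 _ hy₀ (h2.trans hl₀.symm)
  obtain ⟨q, hq, hqσ⟩ := SmoothMfd.exists_lift_of_isSmoothEmbedding R'.embedding_inclObj
    (X.submersion_p'.contMDiff.comp_smoothNear hσ) (hσY.mono fun l hl => H.p'_mem _ hl.1)
  have hq0 : q l₀ = R'.R.src r := R'.embedding_inclObj.isEmbedding.injective (by
    rw [hqσ.self_of_nhds, hr, R'.src_incl])
  obtain ⟨b, hb, hbr, hsb⟩ := SmoothMfd.exists_section_of_isSubmersion R'.R.submersion_src r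
  rw [← hq0] at hb hbr hsb
  have hi : ContMDiff R'.R.Arr.I Γ'.Arr.I ∞ R'.incl := R'.embedding_incl.isImmersion.contMDiff
  have hc : ∀ᶠ l in 𝓝 l₀, X.p' (σ l) = Γ'.src (R'.incl (b (q l))) := by
    filter_upwards [hqσ, hq.continuousAt.eventually hsb] with l h3 h4
    rw [R'.src_incl, h4, h3]
  refine ⟨fun l => X.ract (σ l) (R'.incl (b (q l))), X.contMDiffOn_ract.comp_smoothNear
    (hσ.prodMk (hi.comp_smoothNear (hb.comp hq))) hc, by simp only [hbr, hry], ?_⟩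
  filter_upwards [hσY, hc] with l h3 h4
  exact ⟨H.ract_mem _ h3.1 _ h4, by rw [X.p_ract _ _ h4, h3.2]⟩

lemma exists_section'_eq (H : X.IsSubbimodule R R' Y) {y₀ : X.X} (hy₀ : y₀ ∈ Y) {l₀ : R'.R.Obj}
    (hl₀ : X.p' y₀ = R'.inclObj l₀) : ∃ σ : R'.R.Obj → X.X, SmoothNear R'.R.Obj.I X.X.I σ l₀ ∧
      σ l₀ = y₀ ∧ ∀ᶠ l in 𝓝 l₀, σ l ∈ Y ∧ X.p' (σ l) = R'.inclObj l := by
  obtain ⟨σ, hσ, hσY⟩ := H.exists_section' l₀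
  obtain ⟨h1, h2⟩ := hσY.self_of_nhds
  obtain ⟨r, hr, hry⟩ := H.exists_lact _ h1 _ hy₀ (h2.trans hl₀.symm)
  obtain ⟨q, hq, hqσ⟩ := SmoothMfd.exists_lift_of_isSmoothEmbedding R.embedding_inclObj
    (X.submersion_p.contMDiff.comp_smoothNear hσ) (hσY.mono fun l hl => H.p_mem _ hl.1)
  have hq0 : q l₀ = R.R.tgt r := R.embedding_inclObj.isEmbedding.injective (by
    rw [hqσ.self_of_nhds, ← hr, R.tgt_incl])
  obtain ⟨b, hb, hbr, hsb⟩ := SmoothMfd.exists_section_of_isSubmersion R.R.submersion_tgt r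
  rw [← hq0] at hb hbr hsb
  have hi : ContMDiff R.R.Arr.I Γ.Arr.I ∞ R.incl := R.embedding_incl.isImmersion.contMDiff
  have hc : ∀ᶠ l in 𝓝 l₀, Γ.tgt (R.incl (b (q l))) = X.p (σ l) := by
    filter_upwards [hqσ, hq.continuousAt.eventually hsb] with l h3 h4
    rw [R.tgt_incl, h4, h3]
  refine ⟨fun l => X.lact (R.incl (b (q l))) (σ l), X.contMDiffOn_lact.comp_smoothNear
    ((hi.comp_smoothNear (hb.comp hq)).prodMk hσ) hc, by simp only [hbr, hry], ?_⟩
  filter_upwards [hσY, hc] with l h3 h4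
  exact ⟨H.lact_mem _ h3.1 _ h4, by rw [X.p'_lact _ _ h4, h3.2]⟩

/-- Near `y₀`, a point of `Y` is `σ l · r` with `σ` a section through `y₀`, `l ∈ L`, and `r` an
arrow of `R'` near a unit. Thus `Y` looks like `L` times a source fibre of `R'`, whence the
dimension. The inverse reads `l` off `p` and `r` off smooth division. -/
lemma nonempty_parametrization (H : X.IsSubbimodule R R' Y) {y₀ : X.X} (hy₀ : y₀ ∈ Y) :
    Nonempty (SmoothMfd.Parametrization X.X Y
      (R.R.Obj.dim + Module.finrank 𝕜 (SmoothMfd.Compl R'.R.Arr R'.R.Obj)) y₀) := by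
  obtain ⟨l₀, hl₀⟩ := H.p_mem _ hy₀
  obtain ⟨σ, hσ, hσ0, hσY⟩ := H.exists_section_eq hy₀ hl₀.symm
  obtain ⟨q, hq, hqσ⟩ := SmoothMfd.exists_lift_of_isSmoothEmbedding R'.embedding_inclObj
    (X.submersion_p'.contMDiff.comp_smoothNear hσ) (hσY.mono fun l hl => H.p'_mem _ hl.1)
  obtain ⟨lam, hlam, hlam0, hlami, hilam⟩ :=
    SmoothMfd.exists_retraction_of_isSmoothEmbedding R.embedding_inclObj l₀
  let u₀ : R'.R.Arr := R'.R.unit (q l₀)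
  obtain ⟨ρ, hρ, hρ0, hρi, -⟩ :=
    SmoothMfd.exists_retraction_of_isSmoothEmbedding R'.embedding_incl u₀
  let F := SmoothMfd.Compl R'.R.Arr R'.R.Obj
  obtain ⟨τ, w, hτ0, hw0, hτ, hw, hτw, hwτ⟩ :=
    SmoothMfd.exists_normalForm_of_isSubmersion R'.R.submersion_src u₀
  rw [R'.R.src_unit] at hτ0 hτ hτw
  have hq0 : R'.inclObj (q l₀) = X.p' y₀ := by rw [hqσ.self_of_nhds, hσ0]
  have hu₀ : R'.incl u₀ = Γ'.unit (X.p' y₀) := by rw [R'.incl_unit, hq0]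
  have hact0 : X.ract y₀ (R'.incl u₀) = y₀ := by rw [hu₀, X.ract_unit]
  obtain ⟨D, hD, hDg⟩ := X.exists_division y₀ (R'.incl u₀) (by rw [hu₀, Γ'.src_unit])
  rw [hact0] at hD
  have hi : ContMDiff R.R.Obj.I Γ.Obj.I ∞ R.inclObj := R.embedding_inclObj.isImmersion.contMDiff
  have hi' : ContMDiff R'.R.Arr.I Γ'.Arr.I ∞ R'.incl := R'.embedding_incl.isImmersion.contMDiff
  -- the parametrization
  let t : R.R.Obj × F → R'.R.Arr := fun v => τ (q v.1, v.2)
  let c : R.R.Obj × F → X.X := fun v => X.ract (σ v.1) (R'.incl (t v))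
  have hqv : SmoothNear (R.R.Obj.I.prod 𝓘(𝕜, F)) (R'.R.Obj.I.prod 𝓘(𝕜, F))
      (fun v : R.R.Obj × F => (q v.1, v.2)) (l₀, 0) :=
    (hq.comp_of_eq smoothNear_fst rfl).prodMk smoothNear_snd
  have ht : SmoothNear (R.R.Obj.I.prod 𝓘(𝕜, F)) R'.R.Arr.I t (l₀, 0) := hτ.comp_of_eq hqv rfl
  have ht0 : Filter.Tendsto t (𝓝 (l₀, 0)) (𝓝 u₀) := by
    have := ht.continuousAt.tendsto
    rwa [show t (l₀, 0) = u₀ from hτ0] at this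
  have htw : ∀ᶠ v in 𝓝 (l₀, (0 : F)), R'.R.src (t v) = q v.1 ∧ w (t v) = v.2 :=
    hqv.continuousAt.eventually hτw
  have hfst : Filter.Tendsto (Prod.fst : R.R.Obj × F → R.R.Obj) (𝓝 (l₀, 0)) (𝓝 l₀) :=
    continuous_fst.tendsto (l₀, (0 : F))
  have hcs : ∀ᶠ v in 𝓝 (l₀, (0 : F)), X.p' (σ v.1) = Γ'.src (R'.incl (t v)) := by
    filter_upwards [htw, hfst.eventually hqσ] with v h1 h2
    rw [R'.src_incl, h1.1, h2]
  have hc : SmoothNear (R.R.Obj.I.prod 𝓘(𝕜, F)) X.X.I c (l₀, 0) :=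
    X.contMDiffOn_ract.comp_smoothNear ((hσ.comp_of_eq smoothNear_fst rfl).prodMk
      (hi'.comp_smoothNear ht)) hcs
  have hcY : ∀ᶠ v in 𝓝 (l₀, (0 : F)), c v ∈ Y := by
    filter_upwards [hcs, hfst.eventually hσY] with v h1 h2
    exact H.ract_mem _ h2.1 _ h1
  -- its inverse
  let z₁ : X.X → R.R.Obj := fun z => lam (X.p z)
  have hz₁ : SmoothNear X.X.I R.R.Obj.I z₁ y₀ :=
    hlam.comp_of_eq X.submersion_p.contMDiff.smoothNear hl₀.symm
  have hz₁0 : z₁ y₀ = l₀ := by simp only [z₁, ← hl₀, hlam0]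
  have hz₁t : Filter.Tendsto z₁ (𝓝 y₀) (𝓝 l₀) := by
    have := hz₁.continuousAt.tendsto
    rwa [hz₁0] at this
  -- The arrow from `σ (z₁ z)` to `z`, found by division in `X` and pulled back to `R'` by the
  -- retraction `ρ`. It has this meaning only for `z` in `Y`, but it is smooth on a neighbourhood of
  -- `y₀`.
  let z₂ : X.X → R'.R.Arr := fun z => ρ (D (σ (z₁ z), z))
  have hσz : SmoothNear X.X.I (X.X.I.prod X.X.I) (fun z => (σ (z₁ z), z)) y₀ :=
    (hσ.comp_of_eq hz₁ hz₁0).prodMk smoothNear_id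
  have hσz0 : (σ (z₁ y₀), y₀) = (y₀, y₀) := by rw [hz₁0, hσ0]
  have hD0 : D (y₀, y₀) = R'.incl u₀ := by
    have := hDg.self_of_nhds (by rw [hu₀, Γ'.src_unit])
    rwa [hact0] at this
  have hDz : SmoothNear X.X.I Γ'.Arr.I (fun z => D (σ (z₁ z), z)) y₀ := hD.comp_of_eq hσz hσz0
  have hz₂ : SmoothNear X.X.I R'.R.Arr.I z₂ y₀ := hρ.comp_of_eq hDz (by rw [hσz0, hD0])
  have hz₂0 : z₂ y₀ = u₀ := by simp only [z₂, hσz0, hD0, hρ0]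
  have hr : SmoothNear X.X.I (R.R.Obj.I.prod 𝓘(𝕜, F)) (fun z => (z₁ z, w (z₂ z))) y₀ :=
    hz₁.prodMk (hw.comp_of_eq hz₂ hz₂0)
  have hr0 : (z₁ y₀, w (z₂ y₀)) = (l₀, 0) := by rw [hz₁0, hz₂0, hw0]
  have hdiv : ∀ᶠ v : R.R.Obj × R'.R.Arr in 𝓝 (l₀, u₀), X.p' (σ v.1) = Γ'.src (R'.incl v.2) →
      ρ (D (σ v.1, X.ract (σ v.1) (R'.incl v.2))) = v.2 := by
    have h1 : Filter.Tendsto (fun v : R.R.Obj × R'.R.Arr => (σ v.1, R'.incl v.2)) (𝓝 (l₀, u₀))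
        (𝓝 (y₀, R'.incl u₀)) := by
      have h2 := hσ.continuousAt.tendsto
      rw [hσ0] at h2
      exact (h2.comp (continuous_fst.tendsto (l₀, u₀))).prodMk_nhds
        ((hi'.continuous.comp continuous_snd).tendsto (l₀, u₀))
    filter_upwards [h1.eventually hDg, (continuous_snd.tendsto (l₀, u₀)).eventually hρi]
      with v h3 h4 h5
    rw [h3 h5, h4]
  refine SmoothMfd.Parametrization.nonempty_of_prod c (fun z => (z₁ z, w (z₂ z)))
    (by rw [hr0]; exact hc) hr (by rw [hr0]; exact hcY) ?_ ?_
  · rw [hr0]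
    filter_upwards [htw, hcs, hfst.eventually hσY, hfst.eventually hlami,
      (hfst.prodMk_nhds ht0).eventually hdiv] with v h1 h2 h3 h4 h5
    have h6 : z₁ (c v) = v.1 := by
      simp only [z₁, c]
      rw [X.p_ract _ _ h2, h3.2, h4]
    have h7 : z₂ (c v) = t v := by
      simp only [z₂, h6]
      exact h5 h2
    rw [h6, h7, h1.2]
  -- Set-theoretically the arrow exists by transitivity of `R'` on the fibres of `p` in `Y`; the
  -- value `u₀` is a default for the other `z`.
  · have hex : ∀ z, ∃ r : R'.R.Arr, z ∈ Y → σ (z₁ z) ∈ Y → X.p (σ (z₁ z)) = X.p z →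
        X.p' (σ (z₁ z)) = Γ'.src (R'.incl r) ∧ X.ract (σ (z₁ z)) (R'.incl r) = z := by
      intro z
      by_cases h : z ∈ Y ∧ σ (z₁ z) ∈ Y ∧ X.p (σ (z₁ z)) = X.p z
      · obtain ⟨r, hr⟩ := H.exists_ract _ h.2.1 _ h.1 h.2.2
        exact ⟨r, fun _ _ _ => hr⟩
      · exact ⟨u₀, fun h1 h2 h3 => absurd ⟨h1, h2, h3⟩ h⟩
    choose r hr' using hex
    have hz₁Y : Filter.Tendsto z₁ (𝓝[Y] y₀) (𝓝 l₀) := hz₁t.mono_left nhdsWithin_le_nhds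
    have hpz : ∀ᶠ z in 𝓝[Y] y₀, R.inclObj (z₁ z) = X.p z := by
      have h1 : ∀ᶠ z in 𝓝 y₀, X.p z ∈ range R.inclObj → R.inclObj (lam (X.p z)) = X.p z := by
        have h2 := X.submersion_p.contMDiff.continuous.tendsto y₀
        rw [← hl₀] at h2
        exact h2.eventually hilam
      filter_upwards [h1.filter_mono nhdsWithin_le_nhds, self_mem_nhdsWithin] with z h2 h3
      exact h2 (H.p_mem _ h3)
    have hrz : ∀ᶠ z in 𝓝[Y] y₀, X.p' (σ (z₁ z)) = Γ'.src (R'.incl (r z)) ∧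
        X.ract (σ (z₁ z)) (R'.incl (r z)) = z := by
      filter_upwards [hpz, self_mem_nhdsWithin, hz₁Y.eventually hσY] with z h1 h2 h3
      exact hr' z h2 h3.1 (h3.2.trans h1)
    -- Properness of the action makes the chosen arrows tend to the unit `u₀`. This is needed
    -- because the formula `hdiv` recovers only arrows near `u₀`, and it is what makes `Y` embedded.
    have hrt : Filter.Tendsto r (𝓝[Y] y₀) (𝓝 u₀) := by
      rw [R'.embedding_incl.isEmbedding.isInducing.tendsto_nhds_iff]
      refine X.tendsto_division (z := fun z => σ (z₁ z)) (z₀ := y₀) (by rw [hu₀, Γ'.src_unit])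
        ?_ ?_ (hrz.mono fun z hz => hz.1)
      · have := hσ.continuousAt.tendsto
        rw [hσ0] at this
        exact this.comp hz₁Y
      · rw [hact0]
        refine Filter.Tendsto.congr' (hrz.mono fun z hz => hz.2.symm) ?_
        exact Filter.tendsto_id'.mpr nhdsWithin_le_nhds
    have hfin : ∀ᶠ z in 𝓝[Y] y₀, c (z₁ z, w (z₂ z)) = z := by
      filter_upwards [hrz, (hz₁Y.prodMk_nhds hrt).eventually hdiv, hrt.eventually hwτ,
        hz₁Y.eventually hqσ] with z h1 h2 h3 h4
      have h2 := h2 h1.1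
      rw [h1.2] at h2
      have h5 : z₂ z = r z := h2
      have h6 : R'.R.src (r z) = q (z₁ z) := R'.embedding_inclObj.isEmbedding.injective (by
        rw [h4, h1.1, R'.src_incl])
      change X.ract (σ (z₁ z)) (R'.incl (τ (q (z₁ z), w (z₂ z)))) = z
      rw [h5, ← h6, h3, h1.2]
    exact eventually_nhdsWithin_iff.mp hfin

end IsSubbimodule

end LieMorita

/-! ### From a subbimodule to a Morita equivalence of subgroupoids -/

namespace LieMorita

variable {𝕜 : Type v} [RCLike 𝕜] {Γ Γ' : LieGroupoid.{u} 𝕜} (X : LieMorita Γ Γ')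

lemma lact_left_cancel {x : X.X} {g h : Γ.Arr} (hg : Γ.tgt g = X.p x) (hh : Γ.tgt h = X.p x)
    (he : X.lact g x = X.lact h x) : g = h := by
  have hs : Γ.src h = Γ.src g := by rw [← X.p_lact _ _ hg, he, X.p_lact _ _ hh]
  have hc : Γ.tgt (Γ.inv h) = Γ.src g := by rw [Γ.tgt_inv, hs]
  have h1 : X.lact (Γ.mul (Γ.inv h) g) x = x := by
    rw [X.lact_mul _ _ _ hc hg, he, ← X.lact_mul _ _ _ (Γ.tgt_inv h) hh, Γ.inv_mul, hh,
      X.lact_unit]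
  have h2 := X.lact_free _ _ (by rw [Γ.tgt_mul _ _ hc, hg]) h1
  have h3 : Γ.mul h (Γ.mul (Γ.inv h) g) = g := by
    rw [← Γ.mul_assoc _ _ _ (Γ.src_inv h).symm hc, Γ.mul_inv, hs, Γ.unit_mul]
  rw [← h3, h2, ← hh, Γ.mul_unit]

/-- The left action is principal: `g` depends continuously on `x` and `g x`. -/
lemma tendsto_division_left {ι : Type*} {l : Filter ι} {z : ι → X.X} {g : ι → Γ.Arr} {z₀ : X.X}
    {g₀ : Γ.Arr} (h₀ : Γ.tgt g₀ = X.p z₀) (hz : Filter.Tendsto z l (𝓝 z₀))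
    (hx : Filter.Tendsto (fun n => X.lact (g n) (z n)) l (𝓝 (X.lact g₀ z₀)))
    (h : ∀ᶠ n in l, Γ.tgt (g n) = X.p (z n)) : Filter.Tendsto g l (𝓝 g₀) := by
  classical
  let θ := fun q : {q : Γ.Arr × X.X // Γ.tgt q.1 = X.p q.2} => (X.lact q.1.1 q.1.2, q.1.2)
  have hinj : Function.Injective θ := by
    rintro ⟨⟨g, a⟩, ha⟩ ⟨⟨k, b⟩, hb⟩ hab
    obtain rfl : a = b := congrArg Prod.snd hab
    obtain rfl : g = k := X.lact_left_cancel ha hb (congrArg Prod.fst hab)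
    rfl
  have hemb : IsClosedEmbedding θ := .of_continuous_injective_isClosedMap
    X.lact_proper.continuous hinj X.lact_proper.isClosedMap
  let q : ι → {q : Γ.Arr × X.X // Γ.tgt q.1 = X.p q.2} := fun n =>
    if hn : Γ.tgt (g n) = X.p (z n) then ⟨(g n, z n), hn⟩ else ⟨(g₀, z₀), h₀⟩
  have hq : ∀ᶠ n in l, (q n).1 = (g n, z n) := by
    filter_upwards [h] with n hn
    simp only [q, dif_pos hn]
  have h1 : Filter.Tendsto q l (𝓝 ⟨(g₀, z₀), h₀⟩) := by
    rw [hemb.isInducing.tendsto_nhds_iff]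
    refine (hx.prodMk_nhds hz).congr' ?_
    filter_upwards [hq] with n hn
    simp only [Function.comp_apply, θ, hn]
  have h2 : Filter.Tendsto (fun n => (q n).1.1) l (𝓝 g₀) :=
    ((continuous_fst.comp continuous_subtype_val).tendsto _).comp h1
  exact h2.congr' (by filter_upwards [hq] with n hn; rw [hn])

variable {X} {R : LieSubgroupoid Γ} {R' : LieSubgroupoid Γ'}

/-- A subbimodule is a manifold, and gives a Morita equivalence of subgroupoids. -/
lemma IsSubbimodule.nonempty_subgroupoidMorita {Y : Set X.X} (H : X.IsSubbimodule R R' Y) :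
    Nonempty (SubgroupoidMorita X R R') := by
  obtain ⟨N, e, he, heY⟩ := SmoothMfd.isEmbeddedSubmanifold_of_parametrization X.X Y _
    (fun y hy => H.nonempty_parametrization hy)
  have hei := he.isEmbedding.injective
  have hes : ContMDiff N.I X.X.I ∞ e := he.isImmersion.contMDiff
  have hmem : ∀ y, e y ∈ Y := fun y => heY ▸ mem_range_self y
  have hex : ∀ x ∈ Y, ∃ y, e y = x := fun x hx => by rwa [← heY] at hx
  have hoi := R.embedding_inclObj.isEmbedding.injective
  have hoi' := R'.embedding_inclObj.isEmbedding.injective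
  have hai : ContMDiff R.R.Arr.I Γ.Arr.I ∞ R.incl := R.embedding_incl.isImmersion.contMDiff
  have hai' : ContMDiff R'.R.Arr.I Γ'.Arr.I ∞ R'.incl := R'.embedding_incl.isImmersion.contMDiff
  choose p hp using fun y => H.p_mem _ (hmem y)
  choose p' hp' using fun y => H.p'_mem _ (hmem y)
  have hc : ∀ {r y}, R.R.tgt r = p y → Γ.tgt (R.incl r) = X.p (e y) := fun h => by
    rw [R.tgt_incl, h, hp]
  have hc' : ∀ {y r}, p' y = R'.R.src r → X.p' (e y) = Γ'.src (R'.incl r) := fun h => by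
    rw [R'.src_incl, ← h, hp']
  -- The actions of `X` restrict to `Y`; for non-composable pairs an arbitrary value is taken.
  have hlact : ∀ r y, ∃ z, R.R.tgt r = p y → e z = X.lact (R.incl r) (e y) := by
    intro r y
    by_cases h : R.R.tgt r = p y
    · obtain ⟨z, hz⟩ := hex _ (H.lact_mem _ (hmem y) r (hc h))
      exact ⟨z, fun _ => hz⟩
    · exact ⟨y, fun h' => absurd h' h⟩
  have hract : ∀ y r, ∃ z, p' y = R'.R.src r → e z = X.ract (e y) (R'.incl r) := by
    intro y r
    by_cases h : p' y = R'.R.src r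
    · obtain ⟨z, hz⟩ := hex _ (H.ract_mem _ (hmem y) r (hc' h))
      exact ⟨z, fun _ => hz⟩
    · exact ⟨y, fun h' => absurd h' h⟩
  choose lact hl using hlact
  choose ract hr using hract
  have p_lact : ∀ r y, R.R.tgt r = p y → p (lact r y) = R.R.src r := fun r y h => hoi (by
    rw [hp, hl _ _ h, X.p_lact _ _ (hc h), R.src_incl])
  have p'_lact : ∀ r y, R.R.tgt r = p y → p' (lact r y) = p' y := fun r y h => hoi' (by
    rw [hp', hl _ _ h, X.p'_lact _ _ (hc h), hp'])
  have p'_ract : ∀ y r, p' y = R'.R.src r → p' (ract y r) = R'.R.tgt r := fun y r h => hoi' (by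
    rw [hp', hr _ _ h, X.p'_ract _ _ (hc' h), R'.tgt_incl])
  have p_ract : ∀ y r, p' y = R'.R.src r → p (ract y r) = p y := fun y r h => hoi (by
    rw [hp, hr _ _ h, X.p_ract _ _ (hc' h), hp])
  have hps : ContMDiff N.I R.R.Obj.I ∞ p := contMDiff_of_smoothNear fun y =>
    SmoothMfd.smoothNear_of_comp_isSmoothEmbedding R.embedding_inclObj
      (X.submersion_p.contMDiff.comp_smoothNear hes.smoothNear) (Filter.Eventually.of_forall hp)
  have hps' : ContMDiff N.I R'.R.Obj.I ∞ p' := contMDiff_of_smoothNear fun y =>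
    SmoothMfd.smoothNear_of_comp_isSmoothEmbedding R'.embedding_inclObj
      (X.submersion_p'.contMDiff.comp_smoothNear hes.smoothNear) (Filter.Eventually.of_forall hp')
  have submersion_p : IsSubmersion N.I R.R.Obj.I ∞ p := by
    refine SmoothMfd.isSubmersion_of_section hps fun y => ?_
    obtain ⟨σ, hσ, hσ0, hσY⟩ := H.exists_section_eq (hmem y) (hp y).symm
    obtain ⟨s, hs, hes'⟩ := SmoothMfd.exists_lift_of_isSmoothEmbedding he hσ
      (hσY.mono fun l h => heY ▸ h.1)
    refine ⟨s, hs, hei (hes'.self_of_nhds.trans hσ0), ?_⟩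
    filter_upwards [hσY, hes'] with l h1 h2
    exact hoi (by rw [hp, h2, h1.2])
  have submersion_p' : IsSubmersion N.I R'.R.Obj.I ∞ p' := by
    refine SmoothMfd.isSubmersion_of_section hps' fun y => ?_
    obtain ⟨σ, hσ, hσ0, hσY⟩ := H.exists_section'_eq (hmem y) (hp' y).symm
    obtain ⟨s, hs, hes'⟩ := SmoothMfd.exists_lift_of_isSmoothEmbedding he hσ
      (hσY.mono fun l h => heY ▸ h.1)
    refine ⟨s, hs, hei (hes'.self_of_nhds.trans hσ0), ?_⟩
    filter_upwards [hσY, hes'] with l h1 h2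
    exact hoi' (by rw [hp', h2, h1.2])
  have lact_smooth : ContMDiffOn (R.R.Arr.I.prod N.I) N.I ∞
      (fun q : R.R.Arr × N => lact q.1 q.2) {q | R.R.tgt q.1 = p q.2} := by
    refine SmoothMfd.contMDiffOn_of_comp_isSmoothEmbedding he
      (f := fun q => X.lact (R.incl q.1) (e q.2)) ?_ fun q hq => hl _ _ hq
    exact X.contMDiffOn_lact.comp ((hai.comp contMDiff_fst).prodMk
      (hes.comp contMDiff_snd)).contMDiffOn fun q hq => hc hq
  have ract_smooth : ContMDiffOn (N.I.prod R'.R.Arr.I) N.I ∞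
      (fun q : N × R'.R.Arr => ract q.1 q.2) {q | p' q.1 = R'.R.src q.2} := by
    refine SmoothMfd.contMDiffOn_of_comp_isSmoothEmbedding he
      (f := fun q => X.ract (e q.1) (R'.incl q.2)) ?_ fun q hq => hr _ _ hq
    exact X.contMDiffOn_ract.comp ((hes.comp contMDiff_fst).prodMk
      (hai'.comp contMDiff_snd)).contMDiffOn fun q hq => hc' hq
  have lact_transitive : ∀ x y, p' x = p' y → ∃ r, R.R.tgt r = p x ∧ lact r x = y := by
    intro x y h
    obtain ⟨r, h1, h2⟩ := H.exists_lact _ (hmem x) _ (hmem y) (by rw [← hp', ← hp', h])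
    have h3 : R.R.tgt r = p x := hoi (by rw [← R.tgt_incl, h1, hp])
    exact ⟨r, h3, hei (by rw [hl _ _ h3, h2])⟩
  have ract_transitive : ∀ x y, p x = p y → ∃ r, p' x = R'.R.src r ∧ ract x r = y := by
    intro x y h
    obtain ⟨r, h1, h2⟩ := H.exists_ract _ (hmem x) _ (hmem y) (by rw [← hp, ← hp, h])
    have h3 : p' x = R'.R.src r := hoi' (by rw [← R'.src_incl, ← h1, hp'])
    exact ⟨r, h3, hei (by rw [hr _ _ h3, h2])⟩
  have lact_proper : IsProperMap
      (fun q : {q : R.R.Arr × N // R.R.tgt q.1 = p q.2} => (lact q.1.1 q.1.2, q.1.2)) := by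
    refine isProperMap_iff_ultrafilter.mpr ⟨?_, fun U y hU => ?_⟩
    · exact (continuousOn_iff_continuous_domRestrict.mp lact_smooth.continuousOn).prodMk
        (continuous_snd.comp continuous_subtype_val)
    · have h1 : Filter.Tendsto (fun q : {q : R.R.Arr × N // R.R.tgt q.1 = p q.2} =>
          lact q.1.1 q.1.2) U (𝓝 y.1) := (continuous_fst.tendsto y).comp hU
      have h2 : Filter.Tendsto (fun q : {q : R.R.Arr × N // R.R.tgt q.1 = p q.2} => q.1.2) U
          (𝓝 y.2) := (continuous_snd.tendsto y).comp hU
      -- The action preserves `p'`, so the two limits lie in one fibre of `p'`. Transitivity then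
      -- supplies the candidate `r` for the limit of the arrows.
      have h3 : p' y.2 = p' y.1 := by
        refine tendsto_nhds_unique ((hps'.continuous.tendsto _).comp h2)
          (((hps'.continuous.tendsto _).comp h1).congr fun q => ?_)
        exact p'_lact _ _ q.2
      obtain ⟨r, h4, h5⟩ := lact_transitive _ _ h3
      refine ⟨⟨(r, y.2), h4⟩, Prod.ext h5 rfl, ?_⟩
      -- Properness of the action on `X` gives convergence of the arrows in `Γ`, hence in `R`, since
      -- `R` is embedded.
      have h6 : Filter.Tendsto (fun q : {q : R.R.Arr × N // R.R.tgt q.1 = p q.2} => q.1.1) U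
          (𝓝 r) := by
        rw [R.embedding_incl.isEmbedding.isInducing.tendsto_nhds_iff]
        refine X.tendsto_division_left (hc h4) ((hes.continuous.tendsto _).comp h2) ?_
          (Filter.Eventually.of_forall fun q => hc q.2)
        rw [← hl _ _ h4, h5]
        exact ((hes.continuous.tendsto _).comp h1).congr fun q => hl _ _ q.2
      rw [nhds_subtype_eq_comap, ← Filter.tendsto_iff_comap]
      exact h6.prodMk_nhds h2
  have ract_proper : IsProperMap
      (fun q : {q : N × R'.R.Arr // p' q.1 = R'.R.src q.2} => (q.1.1, ract q.1.1 q.1.2)) := by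
    refine isProperMap_iff_ultrafilter.mpr ⟨?_, fun U y hU => ?_⟩
    · exact (continuous_fst.comp continuous_subtype_val).prodMk
        (continuousOn_iff_continuous_domRestrict.mp ract_smooth.continuousOn)
    · have h1 : Filter.Tendsto (fun q : {q : N × R'.R.Arr // p' q.1 = R'.R.src q.2} =>
          ract q.1.1 q.1.2) U (𝓝 y.2) := (continuous_snd.tendsto y).comp hU
      have h2 : Filter.Tendsto (fun q : {q : N × R'.R.Arr // p' q.1 = R'.R.src q.2} => q.1.1) U
          (𝓝 y.1) := (continuous_fst.tendsto y).comp hU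
      have h3 : p y.1 = p y.2 := by
        refine tendsto_nhds_unique ((hps.continuous.tendsto _).comp h2)
          (((hps.continuous.tendsto _).comp h1).congr fun q => ?_)
        exact p_ract _ _ q.2
      obtain ⟨r, h4, h5⟩ := ract_transitive _ _ h3
      refine ⟨⟨(y.1, r), h4⟩, Prod.ext rfl h5, ?_⟩
      have h6 : Filter.Tendsto (fun q : {q : N × R'.R.Arr // p' q.1 = R'.R.src q.2} => q.1.2) U
          (𝓝 r) := by
        rw [R'.embedding_incl.isEmbedding.isInducing.tendsto_nhds_iff]
        refine X.tendsto_division (hc' h4) ((hes.continuous.tendsto _).comp h2) ?_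
          (Filter.Eventually.of_forall fun q => hc' q.2)
        rw [← hr _ _ h4, h5]
        exact ((hes.continuous.tendsto _).comp h1).congr fun q => hr _ _ q.2
      rw [nhds_subtype_eq_comap, ← Filter.tendsto_iff_comap]
      exact h2.prodMk_nhds h6
  refine ⟨⟨
    { X := N
      p := p
      p' := p'
      lact := lact
      ract := ract
      surjective_p := fun l => ?_
      surjective_p' := fun l => ?_
      submersion_p := submersion_p
      submersion_p' := submersion_p'
      p_lact := p_lact
      lact_mul := fun g h y h1 h2 => hei ?_
      lact_unit := fun y => hei ?_
      contMDiffOn_lact := lact_smooth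
      p'_ract := p'_ract
      ract_mul := fun y g h h1 h2 => hei ?_
      ract_unit := fun y => hei ?_
      contMDiffOn_ract := ract_smooth
      p'_lact := p'_lact
      p_ract := p_ract
      lact_ract := fun g y h h1 h2 => hei ?_
      lact_free := fun r y h1 h2 => R.embedding_incl.isEmbedding.injective ?_
      ract_free := fun y r h1 h2 => R'.embedding_incl.isEmbedding.injective ?_
      lact_transitive := lact_transitive
      ract_transitive := ract_transitive
      lact_proper := lact_proper
      ract_proper := ract_proper }, e, hei, he.isImmersion, fun y => (hp y).symm,
      fun y => (hp' y).symm, fun r y r' h1 h2 => ?_⟩⟩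
  · obtain ⟨σ, -, hσ⟩ := H.exists_section l
    obtain ⟨y, hy⟩ := hex _ hσ.self_of_nhds.1
    exact ⟨y, hoi (by rw [hp, hy, hσ.self_of_nhds.2])⟩
  · obtain ⟨σ, -, hσ⟩ := H.exists_section' l
    obtain ⟨y, hy⟩ := hex _ hσ.self_of_nhds.1
    exact ⟨y, hoi' (by rw [hp', hy, hσ.self_of_nhds.2])⟩
  · rw [hl _ _ (by rw [R.R.tgt_mul _ _ h1, h2]), hl _ _ (by rw [p_lact _ _ h2, h1]), hl _ _ h2,
      R.incl_mul _ _ h1, X.lact_mul _ _ _ (by rw [R.tgt_incl, R.src_incl, h1]) (hc h2)]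
  · rw [hl _ _ (R.R.tgt_unit _), R.incl_unit, hp, X.lact_unit]
  · rw [hr _ _ (by rw [R'.R.src_mul _ _ h2, h1]), hr _ _ (by rw [p'_ract _ _ h1, h2]), hr _ _ h1,
      R'.incl_mul _ _ h2, X.ract_mul _ _ _ (hc' h1) (by rw [R'.tgt_incl, R'.src_incl, h2])]
  · rw [hr _ _ (R'.R.src_unit _).symm, R'.incl_unit, hp', X.ract_unit]
  · rw [hr _ _ (by rw [p'_lact _ _ h1, h2]), hl _ _ h1, hl _ _ (by rw [p_ract _ _ h2, h1]),
      hr _ _ h2, X.lact_ract _ _ _ (hc h1) (hc' h2)]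
  · rw [R.incl_unit, hp]
    exact X.lact_free _ _ (hc h1) (by rw [← hl _ _ h1, h2])
  · rw [R'.incl_unit, hp']
    exact X.ract_free _ _ (hc' h1) (by rw [← hr _ _ h1, h2])
  · change e (ract (lact r y) r') = _
    change p' y = _ at h2
    rw [hr _ _ (by rw [p'_lact _ _ h1, h2]), hl _ _ h1]

end LieMorita

/-! ### Morita equivalences of subgroupoids -/

namespace SubgroupoidMorita

variable {𝕜 : Type v} [RCLike 𝕜] {Γ Γ' : LieGroupoid.{u} 𝕜} {X : LieMorita Γ Γ'}
  {R : LieSubgroupoid Γ} {R' : LieSubgroupoid Γ'} (A : SubgroupoidMorita X R R')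

lemma i_ract (y : A.Y.X) (r : R'.R.Arr) (h : A.Y.p' y = R'.R.src r) :
    A.i (A.Y.ract y r) = X.ract (A.i y) (R'.incl r) := by
  have h1 := A.i_act (R.R.unit (A.Y.p y)) y r (R.R.tgt_unit _) h
  rwa [A.Y.lact_unit, R.incl_unit, ← A.p_i, X.lact_unit] at h1

lemma i_lact (r : R.R.Arr) (y : A.Y.X) (h : R.R.tgt r = A.Y.p y) :
    A.i (A.Y.lact r y) = X.lact (R.incl r) (A.i y) := by
  have h1 := A.i_act r y (R'.R.unit (A.Y.p' y)) h (R'.R.src_unit _).symm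
  rw [← A.Y.p'_lact _ _ h, A.Y.ract_unit] at h1
  have h2 : Γ.tgt (R.incl r) = X.p (A.i y) := by rw [R.tgt_incl, h, A.p_i]
  rw [h1, R'.incl_unit, A.Y.p'_lact _ _ h, ← A.p'_i, ← X.p'_lact _ _ h2, X.ract_unit]

lemma contMDiff_i : ContMDiff A.Y.X.I X.X.I ∞ A.i := A.immersion_i.contMDiff

lemma p'_i_eq {y : A.Y.X} {r : R'.R.Arr} : A.Y.p' y = R'.R.src r ↔
    X.p' (A.i y) = Γ'.src (R'.incl r) := by
  rw [A.p'_i, R'.src_incl, R'.embedding_inclObj.isEmbedding.injective.eq_iff]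

lemma p_i_eq {r : R.R.Arr} {y : A.Y.X} : R.R.tgt r = A.Y.p y ↔
    Γ.tgt (R.incl r) = X.p (A.i y) := by
  rw [A.p_i, R.tgt_incl, R.embedding_inclObj.isEmbedding.injective.eq_iff]

/-- The relation is `x = i(y) a` for some `y`. Lifting a family of arrows needs only a local section
of `p'` on `Y`; lifting a family of points takes a section of `p` and then smooth division in `X`.
-/
lemma isResolutionRel : X.IsResolutionRel R R'
    fun x a => ∃ y, X.p' (A.i y) = Γ'.src a ∧ X.ract (A.i y) a = x where
  p_mem := by
    rintro x a ⟨y, h, rfl⟩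
    rw [X.p_ract _ _ h, A.p_i]
    exact mem_range_self _
  src_mem := by
    rintro x a ⟨y, h, rfl⟩
    rw [← h, A.p'_i]
    exact mem_range_self _
  tgt_eq := by
    rintro x a ⟨y, h, rfl⟩
    rw [X.p'_ract _ _ h]
  lift := by
    intro n ξ k hξ hk
    obtain ⟨l, hl, hlξ⟩ := SmoothMfd.exists_lift_of_isSmoothEmbedding R.embedding_inclObj
      (X.submersion_p.contMDiff.comp_smoothNear hξ) hk
    obtain ⟨y₀, hy₀⟩ := A.Y.surjective_p (l k)
    obtain ⟨s, hs, -, hps⟩ := SmoothMfd.exists_section_of_isSubmersion A.Y.submersion_p y₀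
    rw [hy₀] at hs hps
    have hp : ∀ᶠ m in 𝓝 k, X.p (A.i (s (l m))) = X.p (ξ m) := by
      filter_upwards [hlξ, hl.continuousAt.eventually hps] with m h1 h2
      rw [A.p_i, h2, h1]
    -- The arrow is chosen pointwise; `smoothNear_division` makes the choice smooth, the arrow being
    -- unique.
    have hex : ∀ m, ∃ a, X.p (A.i (s (l m))) = X.p (ξ m) →
        X.p' (A.i (s (l m))) = Γ'.src a ∧ X.ract (A.i (s (l m))) a = ξ m := by
      intro m
      by_cases h : X.p (A.i (s (l m))) = X.p (ξ m)
      · obtain ⟨a, ha⟩ := X.ract_transitive _ _ h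
        exact ⟨a, fun _ => ha⟩
      · exact ⟨Γ'.unit (X.p' (ξ m)), fun h' => absurd h' h⟩
    choose a ha using hex
    exact ⟨a, X.smoothNear_division (A.contMDiff_i.comp_smoothNear (hs.comp hl)) hξ
      (hp.mono ha), hp.mono fun m hm => ⟨_, ha m hm⟩⟩
  lift' := by
    intro n a k ha hk
    obtain ⟨l, hl, hla⟩ := SmoothMfd.exists_lift_of_isSmoothEmbedding R'.embedding_inclObj
      (Γ'.submersion_src.contMDiff.comp_smoothNear ha) hk
    obtain ⟨y₀, hy₀⟩ := A.Y.surjective_p' (l k)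
    obtain ⟨s, hs, -, hps⟩ := SmoothMfd.exists_section_of_isSubmersion A.Y.submersion_p' y₀
    rw [hy₀] at hs hps
    have hp : ∀ᶠ m in 𝓝 k, X.p' (A.i (s (l m))) = Γ'.src (a m) := by
      filter_upwards [hla, hl.continuousAt.eventually hps] with m h1 h2
      rw [A.p'_i, h2, h1]
    exact ⟨_, X.contMDiffOn_ract.comp_smoothNear
      ((A.contMDiff_i.comp_smoothNear (hs.comp hl)).prodMk ha) hp, hp.mono fun m hm => ⟨_, hm, rfl⟩⟩
  rel_mul := by
    rintro x a r ⟨y, h, rfl⟩ hr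
    -- The witness is `y r⁻¹`, since `i(y) a = i(y r⁻¹) (r a)`.
    have h1 : A.Y.p' y = R'.R.src (R'.R.inv r) := by
      rw [A.p'_i_eq, h, R'.incl_inv, Γ'.src_inv, hr]
    have h2 := A.p'_i_eq.mp h1
    have h3 : X.p' (A.i (A.Y.ract y (R'.R.inv r))) = Γ'.src (Γ'.mul (R'.incl r) a) := by
      rw [A.i_ract _ _ h1, X.p'_ract _ _ h2, R'.incl_inv, Γ'.tgt_inv, Γ'.src_mul _ _ hr]
    refine ⟨A.Y.ract y (R'.R.inv r), h3, ?_⟩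
    rw [A.i_ract _ _ h1, ← X.ract_mul _ _ _ h2
      (by rw [R'.incl_inv, Γ'.tgt_inv, Γ'.src_mul _ _ hr]), R'.incl_inv,
      Γ'.inv_mul_cancel_left _ _ hr]
  rel_lact := by
    rintro x a r ⟨y, h, rfl⟩ hr
    rw [X.p_ract _ _ h] at hr
    have h1 := A.p_i_eq.mpr hr
    exact ⟨A.Y.lact r y, by rw [A.i_lact _ _ h1, X.p'_lact _ _ hr, h],
      by rw [A.i_lact _ _ h1, X.lact_ract _ _ _ hr h]⟩
  exists_mul := by
    rintro x a b ⟨y, h, rfl⟩ ⟨z, h', hx⟩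
    have h1 : A.Y.p z = A.Y.p y := R.embedding_inclObj.isEmbedding.injective (by
      rw [← A.p_i, ← A.p_i, ← X.p_ract _ _ h', hx, X.p_ract _ _ h])
    obtain ⟨r, hr, rfl⟩ := A.Y.ract_transitive _ _ h1
    rw [A.i_ract _ _ hr] at h hx
    have h2 := A.p'_i_eq.mp hr
    rw [X.p'_ract _ _ h2] at h
    rw [← X.ract_mul _ _ _ h2 h] at hx
    exact ⟨r, h, X.ract_left_cancel h' (by rw [Γ'.src_mul _ _ h, h2]) hx⟩
  exists_lact := by
    rintro x y a ⟨z, h, rfl⟩ ⟨w, h', rfl⟩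
    have h1 : A.Y.p' z = A.Y.p' w := R'.embedding_inclObj.isEmbedding.injective (by
      rw [← A.p'_i, ← A.p'_i, h, h'])
    obtain ⟨r, hr, rfl⟩ := A.Y.lact_transitive _ _ h1
    have h2 := A.p_i_eq.mp hr
    exact ⟨r, by rw [X.p_ract _ _ h, h2], by rw [A.i_lact _ _ hr, X.lact_ract _ _ _ h2 h]⟩

/-! ### Uniqueness of the Morita equivalence of subgroupoids -/

variable {A} {B : SubgroupoidMorita X R R'} {S : Set Γ.Obj}

/-- Points of the two images over the same point of `L` differ by an arrow `g` of `Γ'` between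
points of `L'`. Along local sections `g` is a smooth family over `L`, in `R'` over `L ∩ S` by
fullness, hence in `R'` by density and closedness. So the image of `B`, stable under `R'`, contains
that of `A`. -/
lemma exists_i_eq (hS : Γ.IsStable S) (hR : R.IsFullIn S) (hR'c : R'.IsClosedSubgroupoid)
    (hR' : R'.IsFullIn (X.image S)) (y : A.Y.X) : ∃ z, B.i z = A.i y := by
  obtain ⟨z, hz⟩ := B.Y.surjective_p (A.Y.p y)
  obtain ⟨s, hs, hsy, hps⟩ := SmoothMfd.exists_section_of_isSubmersion A.Y.submersion_p y
  obtain ⟨t, ht, htz, hpt⟩ := SmoothMfd.exists_section_of_isSubmersion B.Y.submersion_p z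
  rw [hz] at ht htz hpt
  have hex : ∀ l, ∃ g, A.Y.p (s l) = l ∧ B.Y.p (t l) = l →
      X.p' (B.i (t l)) = Γ'.src g ∧ X.ract (B.i (t l)) g = A.i (s l) := by
    intro l
    by_cases h : A.Y.p (s l) = l ∧ B.Y.p (t l) = l
    · obtain ⟨g, hg⟩ := X.ract_transitive (B.i (t l)) (A.i (s l)) (by rw [B.p_i, A.p_i, h.1, h.2])
      exact ⟨g, fun _ => hg⟩
    · exact ⟨Γ'.unit (X.p' (B.i (t l))), fun h' => absurd h' h⟩
  choose g hg using hex
  have hg' := (hps.and hpt).mono hg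
  have hgs := X.smoothNear_division (B.contMDiff_i.comp_smoothNear ht)
    (A.contMDiff_i.comp_smoothNear hs) hg'
  have hmem : g (A.Y.p y) ∈ R'.arrows := by
    refine LieMorita.mem_arrows_of_isFullIn hS hR hR'c hR' hgs.continuousAt ?_ ?_
    · filter_upwards [hg'] with l h
      rw [← h.1, B.p'_i, ← X.p'_ract _ _ h.1, h.2, A.p'_i]
      exact ⟨mem_range_self _, mem_range_self _⟩
    · filter_upwards [hg', hpt] with l h h1 h2
      rw [← h.1, LieMorita.p'_mem_image_iff hS, B.p_i, h1]
      exact h2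
  obtain ⟨r, hr⟩ := hmem
  obtain ⟨h1, h2⟩ := hg'.self_of_nhds
  rw [htz, ← hr] at h1 h2
  rw [hsy] at h2
  exact ⟨B.Y.ract z r, by rw [B.i_ract _ _ (B.p'_i_eq.mpr h1), h2]⟩

/-- As `B.i` is only an injective immersion, smoothness of `B.i ∘ h` does not at once yield that of
`h`. Instead `h w` is written as `s (p w) · r w` with a local section `s` of `p`. Division in `X`
makes `r` smooth into `Γ'`, hence into the embedded `R'`. -/
lemma exists_map (hS : Γ.IsStable S) (hR : R.IsFullIn S) (hR'c : R'.IsClosedSubgroupoid)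
    (hR' : R'.IsFullIn (X.image S)) :
    ∃ h : A.Y.X → B.Y.X, ContMDiff A.Y.X.I B.Y.X.I ∞ h ∧ ∀ y, B.i (h y) = A.i y := by
  choose h hh using fun y : A.Y.X => exists_i_eq (B := B) hS hR hR'c hR' y
  have hp : ∀ y, B.Y.p (h y) = A.Y.p y := fun y =>
    R.embedding_inclObj.isEmbedding.injective (by rw [← B.p_i, hh, A.p_i])
  refine ⟨h, contMDiff_of_smoothNear fun y => ?_, hh⟩
  obtain ⟨s, hs, -, hps⟩ := SmoothMfd.exists_section_of_isSubmersion B.Y.submersion_p (h y)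
  rw [hp] at hs hps
  have hpA : SmoothNear A.Y.X.I R.R.Obj.I A.Y.p y := A.Y.submersion_p.contMDiff.smoothNear
  have hsp : SmoothNear A.Y.X.I B.Y.X.I (fun w => s (A.Y.p w)) y := hs.comp hpA
  have hex : ∀ w, ∃ r, B.Y.p (s (A.Y.p w)) = A.Y.p w →
      B.Y.p' (s (A.Y.p w)) = R'.R.src r ∧ B.Y.ract (s (A.Y.p w)) r = h w := by
    intro w
    by_cases hw : B.Y.p (s (A.Y.p w)) = A.Y.p w
    · obtain ⟨r, hr⟩ := B.Y.ract_transitive _ (h w) (hw.trans (hp w).symm)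
      exact ⟨r, fun _ => hr⟩
    · exact ⟨R'.R.unit (B.Y.p' (h w)), fun h' => absurd h' hw⟩
  choose r hr using hex
  have hr' := (hpA.continuousAt.eventually hps).mono hr
  have hir : SmoothNear A.Y.X.I Γ'.Arr.I (fun w => R'.incl (r w)) y := by
    refine X.smoothNear_division (B.contMDiff_i.comp_smoothNear hsp) A.contMDiff_i.smoothNear
      (hr'.mono fun w hw => ⟨B.p'_i_eq.mp hw.1, ?_⟩)
    rw [← B.i_ract _ _ hw.1, hw.2, hh]
  have hrs := SmoothMfd.smoothNear_of_comp_isSmoothEmbedding R'.embedding_incl hir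
    (Filter.Eventually.of_forall fun _ => rfl)
  exact (B.Y.contMDiffOn_ract.comp_smoothNear (hsp.prodMk hrs) (hr'.mono fun w hw => hw.1)).congr
    (hr'.mono fun w hw => hw.2.symm)

lemma nonempty_iso (hS : Γ.IsStable S) (hR : R.IsFullIn S) (hR'c : R'.IsClosedSubgroupoid)
    (hR' : R'.IsFullIn (X.image S)) (A B : SubgroupoidMorita X R R') : Nonempty (A.Iso B) := by
  obtain ⟨h, hs, hh⟩ := exists_map (A := A) (B := B) hS hR hR'c hR'
  obtain ⟨k, ks, hk⟩ := exists_map (A := B) (B := A) hS hR hR'c hR'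
  have hp : ∀ y, B.Y.p (h y) = A.Y.p y := fun y =>
    R.embedding_inclObj.isEmbedding.injective (by rw [← B.p_i, hh, A.p_i])
  have hp' : ∀ y, B.Y.p' (h y) = A.Y.p' y := fun y =>
    R'.embedding_inclObj.isEmbedding.injective (by rw [← B.p'_i, hh, A.p'_i])
  refine ⟨⟨⟨⟨h, k, fun y => A.injective_i (by rw [hk, hh]), fun y => B.injective_i (by rw [hh, hk])⟩,
    hs, ks⟩, hh, hp, hp', fun r y hr => B.injective_i ?_, fun y r hr => B.injective_i ?_⟩⟩
  · change B.i (h (A.Y.lact r y)) = B.i (B.Y.lact r (h y))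
    rw [hh, A.i_lact _ _ hr, B.i_lact _ _ (by rw [hp, hr]), hh]
  · change B.i (h (A.Y.ract y r)) = B.i (B.Y.ract (h y) r)
    rw [hh, A.i_ract _ _ hr, B.i_ract _ _ (by rw [hp', hr]), hh]

end SubgroupoidMorita

/-! ### The equivalence and the uniqueness -/

theorem mainTheorem2 {𝕜 : Type v} [RCLike 𝕜] {Γ Γ' : LieGroupoid.{u} 𝕜} (X : LieMorita Γ Γ')
    (S : Set Γ.Obj) (hS : Γ.Obj.IsEmbeddedSubmanifold S) (hstable : Γ.IsStable S)
    (R : LieSubgroupoid Γ) (hRclosed : R.IsClosedSubgroupoid) (hR : R.IsFullIn S)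
    (R' : LieSubgroupoid Γ') (hR'closed : R'.IsClosedSubgroupoid)
    (hR' : R'.IsFullIn (X.image S)) :
    ((X.transport R.resolution).Coincide R'.resolution ↔ Nonempty (SubgroupoidMorita X R R')) ∧
    (∀ A B : SubgroupoidMorita X R R', range A.i = range B.i ∧ Nonempty (A.Iso B)) := by
  refine ⟨⟨fun h => ?_, fun ⟨A⟩ => A.isResolutionRel.coincide⟩, fun A B => ⟨?_, ?_⟩⟩
  · obtain ⟨rel, H⟩ := LieMorita.exists_isResolutionRel h
    exact (H.isSubbimodule hstable hR hR'closed hR').nonempty_subgroupoidMorita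
  · have h : ∀ A B : SubgroupoidMorita X R R', range A.i ⊆ range B.i := by
      rintro A B _ ⟨y, rfl⟩
      exact SubgroupoidMorita.exists_i_eq hstable hR hR'closed hR' y
    exact (h A B).antisymm (h B A)
  · exact SubgroupoidMorita.nonempty_iso hstable hR hR'closed hR' A B
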